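/- Let $r>a\ge 1$ be coprime integers, with Hirzebruch--Jung expansions $\frac ra=[\alpha_1,\dots,\alpha_n]$ and $\frac r{r-a}=[\beta_1,\dots,\beta_{e-2}]$, where $[x_1,x_2,\dots]=x_1-\frac1{x_2-\cdots}$ and all entries are $\ge 2$; then $e-2=1+\sum_i(\alpha_i-2)$. Let $Q$ be the quiver with vertices $0,1,\dots,n$ (read modulo $n+1$), a clockwise arrow $c_{v,v-1}\colon v\to v-1$ and an anticlockwise arrow $a_{v,v+1}\colon v\to v+1$ for every vertex $v$, and, for each $1\le i\le n$, $\alpha_i-2$ further arrows $i\to 0$; the further arrows are numbered $k_1,\dots,k_{e-3}$ in the order of increasing $i$. Put $k_0=c_{10}$ and $k_{e-2}=a_{n0}$, and let $l_h$ be the tail of $k_h$, so $l_0=1$ and $l_{e-2}=n$. For $v\ne 0$ let $C_{0v}=c_{0n}c_{n,n-1}\cdots c_{v+1,v}$ and $A_{0v}=a_{01}a_{12}\cdots a_{v-1,v}$, where $pq$ means $p$ followed by $q$. Given complex parameters $\lambda=(\lambda_{i,j})_{1\le i\le e-2,\ 0\le j<\beta_i}$, the deformed reconstruction algebra $A_{r,a,\lambda}$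 is the path algebra $\mathbb CQ$ modulo the following relations, for $1\le i\le e-2$. For every vertex $v$ with $l_{i-1}\le v\le l_i$, $$U_{i,v}-D_{i,v}=\lambda_{i,\,v-l_{i-1}+1}\,e_v ,$$ where $U_{i,v}=k_iC_{0l_i}$ if $v=l_i$ and $U_{i,v}=a_{v,v+1}c_{v+1,v}$ otherwise, while $D_{i,v}=k_{i-1}A_{0l_{i-1}}$ if $v=l_{i-1}$ and $D_{i,v}=c_{v,v-1}a_{v-1,v}$ otherwise; and at the vertex $0$, $$A_{0l_{i-1}}k_{i-1}-C_{0l_i}k_i=\lambda_{i,0}\,e_0 .$$ (Here $\beta_i=l_i-l_{i-1}+2$.) Let $\Delta$ be the set of all $\lambda$ with $\sum_{j=0}^{\beta_i-1}\lambda_{i,j}=0$ for every $1\le i\le e-2$. Let $\delta=(1,\dots,1)$ and let $\mathrm{Rep}(A_{r,a,\lambda},\delta)$ be the scheme of representations of dimension vector $\delta$, i.e. the closed subscheme of the affine space of all representations of $Q$ of dimension vector $\delta$ that is cut out by the relations. The group $\mathrm{GL}=\prod_{v=0}^n\mathbb C^*$ acts on its coordinate ring, an arrow $p$ from $t(p)$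 to $h(p)$ being sent by $\mu$ to $\mu_{t(p)}^{-1}\,p\,\mu_{h(p)}$. Let $\theta=(-n,1,\dots,1)$, with character $\mu\mapsto\prod_v\mu_v^{\theta_v}$, and put $$\mathrm{Rep}(A_{r,a,\lambda},\delta)/\!\!/_\theta\mathrm{GL}=\mathrm{Proj}\Big(\bigoplus_{k\ge0}\mathbb C[\mathrm{Rep}(A_{r,a,\lambda},\delta)]^{\mathrm{GL},\theta^k}\Big),\qquad \mathrm{Rep}(A_{r,a,\lambda},\delta)/\!\!/\mathrm{GL}=\mathrm{Spec}\,\mathbb C[\mathrm{Rep}(A_{r,a,\lambda},\delta)]^{\mathrm{GL}},$$ where the superscript $\mathrm{GL},\theta^k$ denotes the functions $f$ with $\mu\cdot f=\big(\prod_v\mu_v^{\theta_v}\big)^k f$ for all $\mu\in\mathrm{GL}$. Then, for every $\lambda\in\Delta$, the canonical morphism $$\mathrm{Rep}(A_{r,a,\lambda},\delta)/\!\!/_\theta\mathrm{GL}\longrightarrow \mathrm{Rep}(A_{r,a,\lambda},\delta)/\!\!/\mathrm{GL}$$ is a resolution of singularities: both schemes are integral, the morphism is proper and birational, and the source is regular.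 -/

import Mathlib

open AlgebraicGeometry CategoryTheory

noncomputable section

/-! ### Resolutions of singularities -/

/-- A morphism of schemes is birational if it restricts to an isomorphism over a dense open
subscheme of the target whose preimage is dense in the source. -/
def IsBirationalMorphism {X Y : Scheme.{0}} (f : X ⟶ Y) : Prop :=
  ∃ U : Y.Opens, Dense (U : Set Y) ∧ Dense ((f ⁻¹ᵁ U : X.Opens) : Set X) ∧ IsIso (f ∣_ U)

/-- A resolution of singularities: a proper birational morphism of integral schemes
whose source is regular. -/
structure IsResolutionOfSingularities {X Y : Scheme.{0}} (f : X ⟶ Y) : Prop where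
  integral_source : IsIntegral X
  integral_target : IsIntegral Y
  proper : IsProper f
  birational : IsBirationalMorphism f
  regular : ∀ x : X, IsRegularLocalRing (X.presheaf.stalk x)

/-! ### Path algebras of finite quivers and quotients of them -/

/-- A quiver with vertex set `V` and arrow set `E`. -/
structure ArrowQuiver (V E : Type) where
  tail : E → V
  head : E → V

namespace ArrowQuiver

variable {V E : Type} [Fintype V] [DecidableEq V] (Q : ArrowQuiver V E)

/-- The defining relations of the path algebra, on the free algebra on vertices and arrows:
the vertices are orthogonal idempotents with sum `1`, and every arrow goes from its tail to its
head. A product `p * q` means `p` followed by `q`. -/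
inductive PathRel : FreeAlgebra ℂ (V ⊕ E) → FreeAlgebra ℂ (V ⊕ E) → Prop
  | idem (v : V) : PathRel
      (FreeAlgebra.ι ℂ (Sum.inl v) * FreeAlgebra.ι ℂ (Sum.inl v)) (FreeAlgebra.ι ℂ (Sum.inl v))
  | orth (v w : V) (h : v ≠ w) : PathRel
      (FreeAlgebra.ι ℂ (Sum.inl v) * FreeAlgebra.ι ℂ (Sum.inl w)) 0
  | sum_vertices : PathRel (∑ v : V, FreeAlgebra.ι ℂ (Sum.inl v)) 1
  | tail (p : E) : PathRel
      (FreeAlgebra.ι ℂ (Sum.inl (Q.tail p)) * FreeAlgebra.ι ℂ (Sum.inr p))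
      (FreeAlgebra.ι ℂ (Sum.inr p))
  | head (p : E) : PathRel
      (FreeAlgebra.ι ℂ (Sum.inr p) * FreeAlgebra.ι ℂ (Sum.inl (Q.head p)))
      (FreeAlgebra.ι ℂ (Sum.inr p))

/-- The path algebra `ℂQ`. -/
abbrev PathAlgebra : Type := RingQuot (PathRel Q)

/-- The trivial path at the vertex `v`. -/
def vertex (v : V) : Q.PathAlgebra :=
  RingQuot.mkAlgHom ℂ (PathRel Q) (FreeAlgebra.ι ℂ (Sum.inl v))

/-- The path of length one given by an arrow. -/
def arrow (p : E) : Q.PathAlgebra :=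
  RingQuot.mkAlgHom ℂ (PathRel Q) (FreeAlgebra.ι ℂ (Sum.inr p))

/-- The universal representation of `Q` of dimension vector `(1,…,1)`, on generators. -/
def univRepAux : FreeAlgebra ℂ (V ⊕ E) →ₐ[ℂ] Matrix V V (MvPolynomial E ℂ) :=
  FreeAlgebra.lift ℂ (Sum.elim (fun v => Matrix.single v v 1)
    (fun p => Matrix.single (Q.tail p) (Q.head p) (MvPolynomial.X p)))

theorem univRepAux_rel ⦃x y : FreeAlgebra ℂ (V ⊕ E)⦄ (h : PathRel Q x y) :
    Q.univRepAux x = Q.univRepAux y := by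
  induction h with
  | idem v => simp [univRepAux]
  | orth v w h => simp [univRepAux, Matrix.single_mul_single_of_ne, h]
  | sum_vertices =>
    simp only [univRepAux, map_sum, FreeAlgebra.lift_ι_apply, Sum.elim_inl, map_one]
    ext i j
    simp [Matrix.sum_apply, Matrix.single_apply, Matrix.one_apply, ite_and]
  | tail p => simp [univRepAux]
  | head p => simp [univRepAux]

/-- The universal representation of `Q` of dimension vector `(1,…,1)`: the vertex `v` acts as
the matrix unit `E_{vv}` and the arrow `p` as its coordinate function times `E_{t(p)h(p)}`. -/
def univRep : Q.PathAlgebra →ₐ[ℂ] Matrix V V (MvPolynomial E ℂ) :=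
  RingQuot.liftAlgHom ℂ ⟨Q.univRepAux, Q.univRepAux_rel⟩

variable (rel : Q.PathAlgebra → Q.PathAlgebra → Prop)

/-- The quotient of the path algebra `ℂQ` by the two-sided ideal generated by the relations
`rel`. -/
abbrev QuotAlgebra : Type := RingQuot rel

/-- The ideal of `Rep(A,(1,…,1))`, with `A = ℂQ/(rel)`, in the affine space `Rep(ℂQ,(1,…,1))`:
it is generated by the matrix entries of all the elements of `ℂQ` which vanish in `A`. -/
def repIdeal : Ideal (MvPolynomial E ℂ) :=
  Ideal.span {f | ∃ (x : Q.PathAlgebra) (i j : V),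
    (RingQuot.mkAlgHom ℂ rel x : Q.QuotAlgebra rel) = 0 ∧ f = Q.univRep x i j}

/-- The coordinate ring `ℂ[Rep(A,(1,…,1))]`, with `A = ℂQ/(rel)`. -/
abbrev RepRing : Type := MvPolynomial E ℂ ⧸ Q.repIdeal rel

/-- The action of `μ ∈ ∏_v ℂˣ` on `ℂ[Rep(ℂQ,(1,…,1))]`, where an arrow `p` is sent to
`μ_{t(p)}⁻¹ p μ_{h(p)}`. -/
def polyAct (μ : V → ℂˣ) : MvPolynomial E ℂ →ₐ[ℂ] MvPolynomial E ℂ :=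
  MvPolynomial.aeval fun p =>
    MvPolynomial.C (((μ (Q.tail p))⁻¹ * μ (Q.head p) : ℂˣ) : ℂ) * MvPolynomial.X p

theorem polyAct_univRep (μ : V → ℂˣ) (x : Q.PathAlgebra) (i j : V) :
    Q.polyAct μ (Q.univRep x i j) =
      MvPolynomial.C (((μ i)⁻¹ * μ j : ℂˣ) : ℂ) * Q.univRep x i j := by
  obtain ⟨y, rfl⟩ := RingQuot.mkAlgHom_surjective ℂ (PathRel Q) x
  have hy : ∀ y, Q.univRep (RingQuot.mkAlgHom ℂ (PathRel Q) y) = Q.univRepAux y := fun y => by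
    simp [univRep]
  rw [hy]
  induction y using FreeAlgebra.induction generalizing i j with
  | grade0 c =>
    rw [AlgHom.commutes, Matrix.algebraMap_matrix_apply]
    split_ifs with h
    · subst h
      simp
    · simp
  | grade1 g =>
    rcases g with v | p
    · simp only [univRepAux, FreeAlgebra.lift_ι_apply, Sum.elim_inl, Matrix.single_apply]
      split_ifs with h
      · obtain ⟨rfl, rfl⟩ := h
        simp
      · simp
    · simp only [univRepAux, FreeAlgebra.lift_ι_apply, Sum.elim_inr, Matrix.single_apply]
      split_ifs with h
      · obtain ⟨rfl, rfl⟩ := h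
        simp [polyAct]
      · simp
  | mul y z ihy ihz =>
    rw [map_mul, Matrix.mul_apply, map_sum, Finset.mul_sum]
    refine Finset.sum_congr rfl fun l _ => ?_
    rw [map_mul, ihy, ihz]
    have : (((μ i)⁻¹ * μ j : ℂˣ) : ℂ) =
        (((μ i)⁻¹ * μ l : ℂˣ) : ℂ) * (((μ l)⁻¹ * μ j : ℂˣ) : ℂ) := by
      rw [← Units.val_mul]
      congr 1
      group
    rw [this, MvPolynomial.C_mul]
    ring
  | add y z ihy ihz =>
    rw [map_add, Matrix.add_apply, map_add, ihy, ihz, mul_add]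

theorem repIdeal_le_comap (μ : V → ℂˣ) :
    Q.repIdeal rel ≤ (Q.repIdeal rel).comap (Q.polyAct μ) := by
  refine Ideal.span_le.2 ?_
  rintro f ⟨x, i, j, hx, rfl⟩
  change Q.polyAct μ (Q.univRep x i j) ∈ Q.repIdeal rel
  rw [polyAct_univRep]
  exact Ideal.mul_mem_left _ _ (Ideal.subset_span ⟨x, i, j, hx, rfl⟩)

/-- The action of `μ ∈ GL = ∏_v ℂˣ` on `ℂ[Rep(A,(1,…,1))]`. -/
def act (μ : V → ℂˣ) : Q.RepRing rel →ₐ[ℂ] Q.RepRing rel :=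
  Ideal.quotientMapₐ (Q.repIdeal rel) (Q.polyAct μ) (Q.repIdeal_le_comap rel μ)

/-- The ring of invariants `ℂ[Rep(A,(1,…,1))]^GL`. -/
def invariants : Subalgebra ℂ (Q.RepRing rel) where
  carrier := {f | ∀ μ : V → ℂˣ, Q.act rel μ f = f}
  mul_mem' hf hg μ := by rw [map_mul, hf μ, hg μ]
  add_mem' hf hg μ := by rw [map_add, hf μ, hg μ]
  algebraMap_mem' c μ := AlgHom.commutes _ c

/-- The character of `∏_v ℂˣ` given by `θ`. -/
def character (θ : V → ℤ) (μ : V → ℂˣ) : ℂˣ := ∏ v, μ v ^ θ v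

/-- The semi-invariants `ℂ[Rep(A,(1,…,1))]^{GL,θ^k}` for the `k`-th power of the character of
`θ`. -/
def semiInvariants (θ : V → ℤ) (k : ℕ) : Submodule ℂ (Q.RepRing rel) where
  carrier := {f | ∀ μ : V → ℂˣ, Q.act rel μ f = ((character θ μ ^ k : ℂˣ) : ℂ) • f}
  add_mem' hf hg μ := by rw [map_add, hf μ, hg μ, smul_add]
  zero_mem' μ := by rw [map_zero, smul_zero]
  smul_mem' c f hf μ := by rw [map_smul, hf μ, smul_comm]

instance semiInvariants_gradedMonoid (θ : V → ℤ) :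
    SetLike.GradedMonoid (Q.semiInvariants rel θ) where
  one_mem μ := by simp
  mul_mem i j f g hf hg μ := by
    rw [map_mul, hf μ, hg μ, smul_mul_smul_comm, ← Units.val_mul, pow_add]

/-- The graded ring `⨁_{k ≥ 0} ℂ[Rep(A,(1,…,1))]^{GL,θ^k}`. -/
def SemiInvariantRing (θ : V → ℤ) : Type :=
  DirectSum ℕ fun k => Q.semiInvariants rel θ k

instance semiInvariantRing_commRing (θ : V → ℤ) : CommRing (Q.SemiInvariantRing rel θ) :=
  inferInstanceAs (CommRing (DirectSum ℕ fun k => Q.semiInvariants rel θ k))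

instance semiInvariantRing_algebra (θ : V → ℤ) : Algebra ℂ (Q.SemiInvariantRing rel θ) :=
  inferInstanceAs (Algebra ℂ (DirectSum ℕ fun k => Q.semiInvariants rel θ k))

/-- The inclusion of the degree `k` summand. -/
def homogeneous (θ : V → ℤ) (k : ℕ) :
    Q.semiInvariants rel θ k →ₗ[ℂ] Q.SemiInvariantRing rel θ where
  toFun := DirectSum.of (fun k => Q.semiInvariants rel θ k) k
  map_add' := map_add (DirectSum.of (fun k => Q.semiInvariants rel θ k) k)
  map_smul' := map_smul (DirectSum.lof ℂ ℕ (fun k => Q.semiInvariants rel θ k) k)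

/-- The degree `k` part of `⨁_{k ≥ 0} ℂ[Rep(A,(1,…,1))]^{GL,θ^k}`. -/
def semiInvariantGrading (θ : V → ℤ) (k : ℕ) : Submodule ℂ (Q.SemiInvariantRing rel θ) :=
  LinearMap.range (Q.homogeneous rel θ k)

/-- The decomposition of an element into its homogeneous parts. -/
def decomposeHom (θ : V → ℤ) : Q.SemiInvariantRing rel θ →+
    DirectSum ℕ fun k => Q.semiInvariantGrading rel θ k :=
  DirectSum.toAddMonoid (β := fun k => Q.semiInvariants rel θ k) fun k =>
    (DirectSum.of (fun k => Q.semiInvariantGrading rel θ k) k).comp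
      (Q.homogeneous rel θ k).rangeRestrict.toAddMonoidHom

theorem decomposeHom_homogeneous (θ : V → ℤ) (k : ℕ) (f : Q.semiInvariants rel θ k) :
    Q.decomposeHom rel θ (Q.homogeneous rel θ k f) =
      DirectSum.of (fun k => Q.semiInvariantGrading rel θ k) k
        ⟨Q.homogeneous rel θ k f, f, rfl⟩ :=
  DirectSum.toAddMonoid_of (β := fun k => Q.semiInvariants rel θ k) _ k f

theorem semiInvariantRing_induction (θ : V → ℤ) {P : Q.SemiInvariantRing rel θ → Prop}
    (zero : P 0) (hom : ∀ k f, P (Q.homogeneous rel θ k f))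
    (add : ∀ x y, P x → P y → P (x + y)) (x : Q.SemiInvariantRing rel θ) : P x :=
  DirectSum.induction_on (β := fun k => Q.semiInvariants rel θ k) (motive := P) x zero hom add

instance semiInvariantGrading_gradedAlgebra (θ : V → ℤ) :
    GradedAlgebra (Q.semiInvariantGrading rel θ) where
  one_mem := ⟨⟨1, SetLike.GradedOne.one_mem⟩, rfl⟩
  mul_mem := by
    rintro i j _ _ ⟨f, rfl⟩ ⟨g, rfl⟩
    exact ⟨⟨f * g, SetLike.GradedMul.mul_mem f.2 g.2⟩,
      (DirectSum.of_mul_of (A := fun k => Q.semiInvariants rel θ k) f g).symm⟩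
  decompose' := Q.decomposeHom rel θ
  left_inv x := by
    induction x using semiInvariantRing_induction with
    | zero => rw [map_zero, map_zero]
    | hom k f => rw [decomposeHom_homogeneous, DirectSum.coeAddMonoidHom_of]
    | add x y hx hy => rw [map_add, map_add, hx, hy]
  right_inv x := by
    induction x using DirectSum.induction_on with
    | zero => rw [map_zero, map_zero]
    | of k f =>
      obtain ⟨_, f, rfl⟩ := f
      rw [DirectSum.coeAddMonoidHom_of, decomposeHom_homogeneous]
    | add x y hx hy => rw [map_add, map_add, hx, hy]

/-- The GIT quotient `Rep(A,(1,…,1)) //_θ GL = Proj ⨁_{k ≥ 0} ℂ[Rep(A,(1,…,1))]^{GL,θ^k}`. -/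
def gitQuotient (θ : V → ℤ) : Scheme.{0} := Proj (Q.semiInvariantGrading rel θ)

/-- The affine quotient `Rep(A,(1,…,1)) // GL = Spec ℂ[Rep(A,(1,…,1))]^GL`. -/
def affineQuotient : Scheme.{0} := Spec (CommRingCat.of (Q.invariants rel))

theorem mem_semiInvariants_zero (θ : V → ℤ) (f : Q.invariants rel) :
    (f : Q.RepRing rel) ∈ Q.semiInvariants rel θ 0 := fun μ => by
  rw [pow_zero, Units.val_one, one_smul]
  exact f.2 μ

/-- The inclusion of the invariants as the degree `0` part of the ring of semi-invariants. -/
def invariantsToZero (θ : V → ℤ) : Q.invariants rel →+* Q.semiInvariantGrading rel θ 0 where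
  toFun f := ⟨Q.homogeneous rel θ 0 ⟨f, Q.mem_semiInvariants_zero rel θ f⟩, _, rfl⟩
  map_one' := rfl
  map_mul' f g := Subtype.ext <|
    DirectSum.of_zero_mul (fun k => Q.semiInvariants rel θ k)
      ⟨f, Q.mem_semiInvariants_zero rel θ f⟩ ⟨g, Q.mem_semiInvariants_zero rel θ g⟩
  map_zero' := Subtype.ext <| map_zero (Q.homogeneous rel θ 0)
  map_add' f g := Subtype.ext <| map_add (Q.homogeneous rel θ 0)
    ⟨f, Q.mem_semiInvariants_zero rel θ f⟩ ⟨g, Q.mem_semiInvariants_zero rel θ g⟩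

/-- The canonical morphism `Rep(A,(1,…,1)) //_θ GL ⟶ Rep(A,(1,…,1)) // GL`. -/
def gitToAffine (θ : V → ℤ) : Q.gitQuotient rel θ ⟶ Q.affineQuotient rel :=
  Proj.toSpecZero (Q.semiInvariantGrading rel θ) ≫
    Spec.map (CommRingCat.ofHom (Q.invariantsToZero rel θ))

end ArrowQuiver

/-! ### Hirzebruch–Jung continued fractions -/

/-- The continued fraction `[α₁,…,αₙ] = α₁ - 1/(α₂ - 1/(⋯ - 1/αₙ))`
(with value `0` for the empty list). -/
def hjValue : List ℕ → ℚ
  | [] => 0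
  | [x] => x
  | x :: y :: l => x - 1 / hjValue (y :: l)

/-- `α = (α₁,…,αₙ)` is the Hirzebruch–Jung continued fraction expansion of `r / a`;
`αᵢ` is stored at the index `i - 1`. -/
def IsHJExpansion (r a : ℕ) {n : ℕ} (α : Fin n → ℕ) : Prop :=
  (∀ i, 2 ≤ α i) ∧ hjValue (List.ofFn α) = (r : ℚ) / (a : ℚ)

/-! ### The deformed reconstruction algebra -/

namespace Recon

/-- The number `∑ (αᵢ - 2)` of extra arrows. -/
def numExtra {n : ℕ} (α : Fin n → ℕ) : ℕ := ∑ i, (α i - 2)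

/-- The arrows of the quiver, whose vertices are `0,…,n`, labelled by `Fin (n + 1)` and read
cyclically: the clockwise arrow `c v` from `v` to `v - 1`, the anticlockwise arrow `a v` from `v` to
`v + 1`, and the extra arrows `k_{j+1} = k j`. -/
inductive Arrow (n ℓ : ℕ) : Type
  | c (v : Fin (n + 1))
  | a (v : Fin (n + 1))
  | k (j : Fin ℓ)

variable {n : ℕ} (α : Fin n → ℕ)

/-- The tails of the extra arrows `k₁, k₂, …` in this order: `αᵢ - 2` of them start at the
vertex `i`. -/
def extraTails : List (Fin (n + 1)) :=
  (List.finRange n).flatMap fun i => List.replicate (α i - 2) i.succ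

/-- The tail `l_h` of the arrow `k_h`, for `0 ≤ h ≤ 1 + ∑ (αᵢ - 2)`; here `l_0 = 1`, and
`l_h = n` for the last `h`. -/
def kTail (h : ℕ) : Fin (n + 1) :=
  if h = 0 then 1 else (extraTails α).getD (h - 1) (Fin.last n)

/-- The quiver `Q` of the reconstruction algebra. -/
def quiver : ArrowQuiver (Fin (n + 1)) (Arrow n (numExtra α)) where
  tail
    | .c v => v
    | .a v => v
    | .k j => kTail α (j + 1)
  head
    | .c v => v - 1
    | .a v => v + 1
    | .k _ => 0

/-- The arrow `k_h`, for `0 ≤ h ≤ 1 + ∑ (αᵢ - 2)`; here `k_0 = c_{10}`, and `k_h = a_{n0}` for the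
last `h`. -/
def kArrow (h : ℕ) : Arrow n (numExtra α) :=
  if h = 0 then .c 1
  else if hh : h - 1 < numExtra α then .k ⟨h - 1, hh⟩
  else .a (Fin.last n)

/-- The path `c_{v,v-1}` in the path algebra. -/
def cPath (v : Fin (n + 1)) : (quiver α).PathAlgebra := (quiver α).arrow (.c v)

/-- The path `a_{v,v+1}` in the path algebra. -/
def aPath (v : Fin (n + 1)) : (quiver α).PathAlgebra := (quiver α).arrow (.a v)

/-- The path `k_h` in the path algebra. -/
def kPath (h : ℕ) : (quiver α).PathAlgebra := (quiver α).arrow (kArrow α h)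

/-- The clockwise path `C_{0v} = c_{0n} c_{n,n-1} ⋯ c_{v+1,v}`. -/
def clockwise (v : Fin (n + 1)) : (quiver α).PathAlgebra :=
  cPath α 0 * (((List.finRange (n + 1)).filter (v < ·)).reverse.map (cPath α)).prod

/-- The anticlockwise path `A_{0v} = a_{01} a_{12} ⋯ a_{v-1,v}`, for `v ≠ 0`. -/
def anticlockwise (v : Fin (n + 1)) : (quiver α).PathAlgebra :=
  (((List.finRange (n + 1)).filter (· < v)).map (aPath α)).prod

/-- The first cycle at `v` in the step `i` relations, `l_{i-1} ≤ v ≤ l_i`: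
`k_i C_{0 l_i}` if `v = l_i`, and `a_{v,v+1} c_{v+1,v}` otherwise. -/
def upperCycle (i : ℕ) (v : Fin (n + 1)) : (quiver α).PathAlgebra :=
  if v = kTail α i then kPath α i * clockwise α v else aPath α v * cPath α (v + 1)

/-- The second cycle at `v` in the step `i` relations, `l_{i-1} ≤ v ≤ l_i`:
`k_{i-1} A_{0 l_{i-1}}` if `v = l_{i-1}`, and `c_{v,v-1} a_{v-1,v}` otherwise. -/
def lowerCycle (i : ℕ) (v : Fin (n + 1)) : (quiver α).PathAlgebra :=
  if v = kTail α (i - 1) then kPath α (i - 1) * anticlockwise α v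
  else cPath α v * aPath α (v - 1)

/-- The step `i` relations, `1 ≤ i ≤ e - 2 = 1 + ∑ (αᵢ - 2)`, of the deformed reconstruction
algebra with parameters `λ_{i,j} = lam i j`. The relations at the vertices `v = l_i,…,l_{i-1}` have
the parameters `λ_{i,βᵢ-1},…,λ_{i,1}`, and the relation at the vertex `0` has the
parameter `λ_{i,0}`. -/
inductive StepRel (lam : ℕ → ℕ → ℂ) : (quiver α).PathAlgebra → (quiver α).PathAlgebra → Prop
  | cycle (i : ℕ) (h1 : 1 ≤ i) (hi : i ≤ 1 + numExtra α) (v : Fin (n + 1))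
      (hl : kTail α (i - 1) ≤ v) (hu : v ≤ kTail α i) :
      StepRel lam (upperCycle α i v - lowerCycle α i v)
        (lam i ((v : ℕ) - (kTail α (i - 1) : ℕ) + 1) • (quiver α).vertex v)
  | zero (i : ℕ) (h1 : 1 ≤ i) (hi : i ≤ 1 + numExtra α) :
      StepRel lam
        (anticlockwise α (kTail α (i - 1)) * kPath α (i - 1)
          - clockwise α (kTail α i) * kPath α i)
        (lam i 0 • (quiver α).vertex 0)

/-- The deformed reconstruction algebra with parameters `λ_{i,j} = lam i j`. -/
abbrev DeformedReconAlgebra (lam : ℕ → ℕ → ℂ) : Type :=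
  (quiver α).QuotAlgebra (StepRel α lam)

/-- The parameter space `Δ`: `∑_{0 ≤ j < βᵢ} λ_{i,j} = 0` for all `1 ≤ i ≤ e - 2`, where
`β = (β₁,…,β_{e-2})`. Of `lam`, only the `λ_{i,j} = lam i j` with `1 ≤ i ≤ e - 2` and
`0 ≤ j < βᵢ` matter. -/
def InDelta {m : ℕ} (β : Fin m → ℕ) (lam : ℕ → ℕ → ℂ) : Prop :=
  ∀ i : Fin m, ∑ j ∈ Finset.range (β i), lam ((i : ℕ) + 1) j = 0

/-- The stability condition `(-n,1,…,1)`. -/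
def stability (n : ℕ) (v : Fin (n + 1)) : ℤ := if v = 0 then -(n : ℤ) else 1

/-- The canonical morphism from the moduli space `Rep(A_{r,a,λ},(1,…,1)) //_θ GL`, for
`θ = (-n,1,…,1)`, to the affine quotient `Rep(A_{r,a,λ},(1,…,1)) // GL`. -/
def resolutionMap (lam : ℕ → ℕ → ℂ) :
    (quiver α).gitQuotient (StepRel α lam) (stability n) ⟶
      (quiver α).affineQuotient (StepRel α lam) :=
  (quiver α).gitToAffine (StepRel α lam) (stability n)

end Recon

end

set_option linter.unusedSectionVars false

/-! ### Fixed points of recursions along a rank function -/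

/-! A representation of dimension vector `(1,…,1)` assigns a scalar to each arrow. The relations of
one step say that its cycles differ from a single invariant by explicit constants: with `m = e - 2`,
the relations at the nonzero vertices become `k_j A_{0l_j} = z_{j+1}`, `k_j C_{0l_j} = z_j + ε_j`
and `a_u c_u = z_{ι u} + η_u` (`IsZigzag`). The relation at the vertex `0` then reads `ε_i =
-λ_{i,0}`, which is exactly the condition defining `Δ`. Nothing else about the parameters is used,
so all of `Δ` is treated uniformly.

Generators. Semi-invariants of the torus are spanned by monomials, that is, by flows on the quiver.
A circulation is a sum of cycles, so the invariants are the polynomials in `z_0,…,z_{m+1}`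
(`mon_mem_cycleAlgebra`). A flow of weight `kθ` is a circulation plus paths out of `0`, and
uncrossing these paths leaves only products of the `n + 1` sections `f_s = ∏_{v ≤ s} A_{0v} ∏_{v >
s} C_{0v}` (`adjoin_chartSection`). Hence the source is proper over the target and is covered by the
loci where some `f_s` does not vanish.

Charts. Where `f_s` is invertible, the torus normalizes `a_u = 1` for `u < s` and `c_u = 1` for `u >
s`. All remaining values are then determined by `x = a_s` and `y = c_s`, through a recursion that
runs outward from one known invariant (`isZigzag_chart`, `IsZigzag.eq_chart`). So each chart is an
affine plane, and the source is regular.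

Target and birationality. The zigzag equations imply `(z_i + ε_i) z_{j+1} = z_{i+1} (z_j + ε_j) ∏
(z_{ι u} + η_u)`, the deformed equations of a cyclic quotient singularity. They reduce polynomials
in the invariants to monomials in two consecutive ones. In the chart `0` these monomials have
distinct leading exponents, because consecutive exponents span the cones of a fan
(`linearIndepOn_chart_zero`). Hence the invariants embed into `ℂ[x,y]` and form a domain. Over `z_0
≠ 0` only the chart `0` remains, where `y = z_0` and `x = z_1 / z_0`, so the morphism is an
isomorphism there. Since `z_0` is nonzero on every chart, the source is irreducible.

Finally, Riemenschneider duality (`hjValue_gapList`) identifies `β_i` with `l_i - l_{i-1} + 2`,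
which turns the hypothesis on `β` into a condition on the quiver. -/

theorem exists_recursive_fix {B : Type*} [Inhabited B] (r : ℕ → ℕ) (F : (ℕ → B) → ℕ → B)
    (hF : ∀ f g j, (∀ i, r i < r j → f i = g i) → F f j = F g j) :
    ∃ f : ℕ → B, ∀ j, f j = F f j := by
  have key : ∀ N, ∃ f : ℕ → B, ∀ j, r j < N → f j = F f j := by
    intro N
    induction N with
    | zero => exact ⟨fun _ => default, fun j hj => absurd hj (Nat.not_lt_zero _)⟩
    | succ N ih =>
      obtain ⟨f, hf⟩ := ih
      -- `F` at rank `N` reads only values of smaller rank, which are already correct, so one more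
      -- application of `F` settles rank `N`.
      refine ⟨fun j => if r j < N then f j else F f j, fun j hj => ?_⟩
      have : F (fun j => if r j < N then f j else F f j) j = F f j := by
        refine hF _ _ _ fun i hi => ?_
        simp [show r i < N by omega]
      rw [this]
      by_cases h : r j < N
      · simp only [h, if_true]
        exact hf j h
      · simp only [h, if_false]
  choose f hf using key
  have huniq : ∀ N M, ∀ K j, r j < K → r j < N → r j < M → f N j = f M j := by
    intro N M K
    induction K with
    | zero => intro j hj; exact absurd hj (Nat.not_lt_zero _)
    | succ K ih =>
      intro j hK hN hM
      rw [hf N j hN, hf M j hM]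
      exact hF _ _ _ fun i hi => ih i (by omega) (by omega) (by omega)
  -- Diagonal choice: the value at `j` is taken from an approximation that is correct up to the rank
  -- of `j`.
  refine ⟨fun j => f (r j + 1) j, fun j => (hf (r j + 1) j (Nat.lt_succ_self _)).trans ?_⟩
  exact hF _ _ _ fun i hi =>
    huniq _ _ (r i + 1) i (Nat.lt_succ_self _) (by omega) (Nat.lt_succ_self _)

theorem recursive_fix_unique {B : Type*} (r : ℕ → ℕ) (F : (ℕ → B) → ℕ → B)
    (hF : ∀ f g j, (∀ i, r i < r j → f i = g i) → F f j = F g j) {f g : ℕ → B}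
    (hf : ∀ j, f j = F f j) (hg : ∀ j, g j = F g j) : f = g := by
  have : ∀ K j, r j < K → f j = g j := by
    intro K
    induction K with
    | zero => intro j hj; exact absurd hj (Nat.not_lt_zero _)
    | succ K ih =>
      intro j hK
      rw [hf, hg]
      exact hF _ _ _ fun i hi => ih i (by omega)
  funext j
  exact this (r j + 1) j (Nat.lt_succ_self _)

/-! ### Zigzags -/

/-- The combinatorial data and the parameters of a deformed reconstruction algebra: `l j` is the
tail of `k_j`, and `ι u` is the number of the step that contains the `2`-cycle at `u`, `u + 1`. -/
structure ZigzagData where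
  n : ℕ
  m : ℕ
  l : ℕ → ℕ
  ι : ℕ → ℕ
  η : ℕ → ℂ
  ε : ℕ → ℂ
  l_zero : l 0 = 1
  l_last : l m = n
  l_mono : Monotone l
  l_le : ∀ j, l j ≤ n
  ι_pos : ∀ u ≤ n, 1 ≤ ι u
  ι_le : ∀ u ≤ n, ι u ≤ m
  ι_zero : ι 0 = 1
  ι_last : ι n = m
  -- So `ι u` is the least `j ≥ 1` with `u < l j`. No such `j` exists for `u = n`, whence the
  -- separate field `ι_last`.
  lt_l_iff : ∀ u < n, ∀ j, 1 ≤ j → (u < l j ↔ ι u ≤ j)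
  η_zero : η 0 = 0
  ε_zero : ε 0 = 0
  -- Since `k_m = a_n` and `l m = n`, the pair at `n` and the clockwise cycle through `k_m` are the
  -- same product.
  η_last : η n = ε m

namespace ZigzagData

variable (D : ZigzagData)

theorem n_pos : 1 ≤ D.n := by
  have := D.l_le 0
  rwa [D.l_zero] at this

theorem m_pos : 1 ≤ D.m := by
  rw [← D.ι_last]
  exact D.ι_pos _ le_rfl

theorem one_le_l (j : ℕ) : 1 ≤ D.l j := by
  rw [← D.l_zero]
  exact D.l_mono (Nat.zero_le j)

theorem ι_mono {u v : ℕ} (huv : u ≤ v) (hv : v ≤ D.n) : D.ι u ≤ D.ι v := by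
  rcases hv.eq_or_lt with rfl | hv
  · rw [D.ι_last]
    exact D.ι_le _ huv
  · have h1 := (D.lt_l_iff v hv (D.ι v) (D.ι_pos v hv.le)).2 le_rfl
    exact (D.lt_l_iff u (by omega) (D.ι v) (D.ι_pos v hv.le)).1 (by omega)

theorem ι_le_of_lt_l {u j : ℕ} (hj : 1 ≤ j) (h : u < D.l j) : D.ι u ≤ j :=
  (D.lt_l_iff u (h.trans_le (D.l_le j)) j hj).1 h

theorem lt_ι_of_l_le {u j : ℕ} (hu : u < D.n) (h : D.l j ≤ u) : j < D.ι u := by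
  rcases Nat.eq_zero_or_pos j with rfl | hj
  · exact D.ι_pos u hu.le
  · by_contra! hc
    have := (D.lt_l_iff u hu j hj).2 hc
    omega

end ZigzagData

/-- A representation of a deformed reconstruction algebra of dimension vector `(1,…,1)` with
values in `B`: `a u` and `c u` are the arrows `u ⟶ u + 1` and `u + 1 ⟶ u`, read cyclically, and
`z j` are the values of the cycles through the vertex `0`. -/
structure IsZigzag (D : ZigzagData) {B : Type*} [CommRing B] [Algebra ℂ B]
    (a c k z : ℕ → B) : Prop where
  k_zero : k 0 = c 0
  k_last : k D.m = a D.n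
  clockwise : ∀ j ≤ D.m, k j * ∏ u ∈ Finset.Ico (D.l j) (D.n + 1), c u =
    z j + algebraMap ℂ B (D.ε j)
  anticlockwise : ∀ j ≤ D.m, k j * ∏ u ∈ Finset.range (D.l j), a u = z (j + 1)
  pair : ∀ u ≤ D.n, a u * c u = z (D.ι u) + algebraMap ℂ B (D.η u)
  -- Fixes the meaningless indices, so that a recursion can determine `z` as a function on all of
  -- `ℕ`.
  z_gt : ∀ j, D.m + 1 < j → z j = 0

namespace IsZigzag

variable {D : ZigzagData} {B B' : Type*} [CommRing B] [Algebra ℂ B] [CommRing B'] [Algebra ℂ B']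
  {a c k z : ℕ → B}

theorem map (h : IsZigzag D a c k z) (f : B →ₐ[ℂ] B') :
    IsZigzag D (fun u => f (a u)) (fun u => f (c u)) (fun j => f (k j)) (fun j => f (z j)) where
  k_zero := by rw [h.k_zero]
  k_last := by rw [h.k_last]
  clockwise j hj := by rw [← map_prod, ← map_mul, h.clockwise j hj, map_add, AlgHom.commutes]
  anticlockwise j hj := by rw [← map_prod, ← map_mul, h.anticlockwise j hj]
  pair u hu := by rw [← map_mul, h.pair u hu, map_add, AlgHom.commutes]
  z_gt j hj := by rw [h.z_gt j hj, map_zero]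

theorem prod_c (h : IsZigzag D a c k z) : ∏ u ∈ Finset.range (D.n + 1), c u = z 0 := by
  have h0 := h.clockwise 0 (Nat.zero_le _)
  rw [D.l_zero, D.ε_zero, map_zero, add_zero, h.k_zero] at h0
  rw [← h0, Finset.range_eq_Ico, Finset.prod_eq_prod_Ico_succ_bot (Nat.succ_pos _)]

theorem prod_a (h : IsZigzag D a c k z) : ∏ u ∈ Finset.range (D.n + 1), a u = z (D.m + 1) := by
  rw [← h.anticlockwise D.m le_rfl, D.l_last, h.k_last, Finset.prod_range_succ, mul_comm]

/-- Both sides are `k i * k j` times the same arrows: the clockwise path to `l i` and the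
anticlockwise path to `l j` overlap in the `2`-cycles between `l i` and `l j`. These are the
deformed equations of the cyclic quotient singularity. -/
theorem mul_eq (h : IsZigzag D a c k z) {i j : ℕ} (hij : i < j) (hj : j ≤ D.m) :
    (z i + algebraMap ℂ B (D.ε i)) * z (j + 1) =
      z (i + 1) * (z j + algebraMap ℂ B (D.ε j)) *
        ∏ u ∈ Finset.Ico (D.l i) (D.l j), (z (D.ι u) + algebraMap ℂ B (D.η u)) := by
  have hl : D.l i ≤ D.l j := D.l_mono hij.le
  have hl' : D.l j ≤ D.n + 1 := (D.l_le j).trans (Nat.le_succ _)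
  rw [← h.clockwise i (hij.le.trans hj), ← h.anticlockwise j hj,
    ← h.anticlockwise i (hij.le.trans hj), ← h.clockwise j hj]
  have : ∏ u ∈ Finset.Ico (D.l i) (D.l j), (z (D.ι u) + algebraMap ℂ B (D.η u)) =
      ∏ u ∈ Finset.Ico (D.l i) (D.l j), (a u * c u) := by
    refine Finset.prod_congr rfl fun u hu => (h.pair u ?_).symm
    have := (Finset.mem_Ico.1 hu).2
    have := D.l_le j
    omega
  rw [this, Finset.prod_mul_distrib, ← Finset.prod_Ico_consecutive c hl hl',
    ← Finset.prod_range_mul_prod_Ico a hl]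
  ring

/-- The torus acts on zigzags. -/
theorem twist (h : IsZigzag D a c k z) (G : ℕ → Bˣ) (h0 : G 0 = 1) (hn : G (D.n + 1) = 1) :
    IsZigzag D (fun u => G u * a u * (↑(G (u + 1))⁻¹ : B))
      (fun u => G (u + 1) * c u * (↑(G u)⁻¹ : B)) (fun j => G (D.l j) * k j) z := by
  -- The gauge factors telescope along a path. Only the one at the end `v` survives, since `0` and
  -- `n + 1` denote the same vertex, where `G` is `1`.
  have hA : ∀ v, ∏ u ∈ Finset.range v, (G u * a u * (↑(G (u + 1))⁻¹ : B)) =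
      (∏ u ∈ Finset.range v, a u) * (↑(G v)⁻¹ : B) := by
    intro v
    induction v with
    | zero => simp [h0]
    | succ v ih =>
      rw [Finset.prod_range_succ, Finset.prod_range_succ, ih]
      have := (G v).inv_mul
      linear_combination (∏ u ∈ Finset.range v, a u) * a v * (↑(G (v + 1))⁻¹ : B) * this
  have hC : ∀ v, v ≤ D.n + 1 → ∏ u ∈ Finset.Ico v (D.n + 1), (G (u + 1) * c u * (↑(G u)⁻¹ : B)) =
      (∏ u ∈ Finset.Ico v (D.n + 1), c u) * (↑(G v)⁻¹ : B) := by
    intro v hv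
    induction hv using Nat.decreasingInduction with
    | self => simp [hn]
    | of_succ v hv ih =>
      rw [Finset.prod_eq_prod_Ico_succ_bot hv, ih, Finset.prod_eq_prod_Ico_succ_bot hv c]
      have := (G (v + 1)).mul_inv
      linear_combination (∏ u ∈ Finset.Ico (v + 1) (D.n + 1), c u) * c v * (↑(G v)⁻¹ : B) * this
  refine ⟨?_, ?_, fun j hj => ?_, fun j hj => ?_, fun u hu => ?_, h.z_gt⟩
  · simp [D.l_zero, h0, h.k_zero]
  · simp [D.l_last, hn, h.k_last]
  · rw [hC _ ((D.l_le j).trans (Nat.le_succ _)), ← h.clockwise j hj]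
    have := (G (D.l j)).mul_inv
    linear_combination (∏ u ∈ Finset.Ico (D.l j) (D.n + 1), c u) * k j * this
  · rw [hA, ← h.anticlockwise j hj]
    have := (G (D.l j)).mul_inv
    linear_combination (∏ u ∈ Finset.range (D.l j), a u) * k j * this
  · rw [← h.pair u hu]
    have h1 := (G u).mul_inv
    have h2 := (G (u + 1)).inv_mul
    linear_combination a u * c u * (G (u + 1) : B) * (↑(G (u + 1))⁻¹ : B) * h1 + a u * c u * h2

end IsZigzag

/-! ### Zigzags in a chart -/

namespace ZigzagData

variable (D : ZigzagData) {B : Type*} [CommRing B] [Algebra ℂ B] (s : ℕ) (x y : B)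

/-- The index of the first of the invariants `z` to be determined in the chart `s`. -/
def center : ℕ := if s = 0 then 0 else if s = D.n then D.m + 1 else D.ι s

/-- The arrows `a u` in the chart `s`, in terms of the invariants. -/
noncomputable def chartA (z : ℕ → B) (u : ℕ) : B :=
  if u < s then 1 else if u = s then x else z (D.ι u) + algebraMap ℂ B (D.η u)

/-- The arrows `c u` in the chart `s`, in terms of the invariants. -/
noncomputable def chartC (z : ℕ → B) (u : ℕ) : B :=
  if s < u then 1 else if u = s then y else z (D.ι u) + algebraMap ℂ B (D.η u)

/-- The arrows `k j` in the chart `s`, in terms of the invariants. -/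
noncomputable def chartK (z : ℕ → B) (j : ℕ) : B :=
  if D.center s ≤ j then z j + algebraMap ℂ B (D.ε j) else z (j + 1)

/-- The recursion for the invariants in the chart `s`. -/
noncomputable def chartZ (z : ℕ → B) (j : ℕ) : B :=
  if D.m + 1 < j then 0
  else if j = D.center s then
    -- In the two end charts a full cycle reduces to one coordinate: `z 0 = ∏ c = y` for `s = 0`,
    -- and `z (m + 1) = ∏ a = x` for `s = n`.
    if s = 0 then y else if s = D.n then x else x * y - algebraMap ℂ B (D.η s)
  else if D.center s < j then
    (z (j - 1) + algebraMap ℂ B (D.ε (j - 1))) * ∏ u ∈ Finset.range (D.l (j - 1)), D.chartA s x z u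
  else z (j + 1) * ∏ u ∈ Finset.Ico (D.l j) (D.n + 1), D.chartC s y z u - algebraMap ℂ B (D.ε j)

/-- The distance to the center of the chart. -/
def chartRank (j : ℕ) : ℕ := if D.center s ≤ j then j - D.center s else D.center s - j

theorem center_le (hs : s ≤ D.n) : D.center s ≤ D.m + 1 := by
  unfold center
  have := D.ι_le s hs
  split_ifs <;> omega

variable {s} in
theorem center_le_ι {u : ℕ} (hu : u < D.n) (h : s < u) : D.center s ≤ D.ι u := by
  have := D.ι_mono h.le hu.le
  unfold center
  split_ifs <;> omega

variable {s} in
theorem ι_le_center {u : ℕ} (hs : s ≤ D.n) (h : u < s) : D.ι u ≤ D.center s := by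
  have := D.ι_mono h.le hs
  have := D.ι_le u (by omega)
  unfold center
  split_ifs <;> omega

variable {s} in
-- From the center upward, the clockwise path to `l j` uses only arrows normalized to `1`, so `k j`
-- is `z j + ε j`. Below the center the same holds for the anticlockwise path, by
-- `l_le_of_lt_center`, and `k j` is `z (j + 1)`.
theorem lt_l_of_center_le {j : ℕ} (hs : s ≤ D.n) (hj : j ≤ D.m) (h : D.center s ≤ j) :
    s < D.l j := by
  have h1 := D.one_le_l j
  unfold center at h
  split_ifs at h
  · omega
  · omega
  · have := D.ι_pos s hs
    exact (D.lt_l_iff s (by omega) j (by omega)).2 h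

variable {s} in
theorem l_le_of_lt_center {j : ℕ} (hs : s ≤ D.n) (h : j < D.center s) : D.l j ≤ s := by
  unfold center at h
  split_ifs at h with h0 h1
  · omega
  · exact h1 ▸ D.l_le j
  · by_contra! hc
    rcases Nat.eq_zero_or_pos j with rfl | hj
    · rw [D.l_zero] at hc
      omega
    · have := D.ι_le_of_lt_l hj hc
      omega

/-- The recursion is well founded along the distance to the center. Above it, the arrows `a u` with
`s < u < l (j - 1)` involve only `z (ι u)` with `center ≤ ι u ≤ j - 1`; below it, the arrows `c u`
involve indices between `j + 1` and the center. -/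
theorem chartZ_congr (hs : s ≤ D.n) (z z' : ℕ → B) (j : ℕ)
    (h : ∀ i, D.chartRank s i < D.chartRank s j → z i = z' i) :
    D.chartZ s x y z j = D.chartZ s x y z' j := by
  unfold chartZ
  split_ifs with h1 h2 h3 h4 h5
  · rfl
  · rfl
  · rfl
  · rfl
  · rw [h (j - 1) (by unfold chartRank; split_ifs <;> omega)]
    congr 1
    refine Finset.prod_congr rfl fun u hu => ?_
    rw [Finset.mem_range] at hu
    unfold chartA
    split_ifs with h6 h7
    · rfl
    · rfl
    · have hun := hu.trans_le (D.l_le (j - 1))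
      have h8 := D.center_le_ι hun (show s < u by omega)
      have h9 : D.ι u ≤ j - 1 := by
        refine D.ι_le_of_lt_l ?_ hu
        by_contra! hc
        rw [show j - 1 = 0 by omega, D.l_zero] at hu
        omega
      rw [h (D.ι u) (by unfold chartRank; split_ifs <;> omega)]
  · rw [h (j + 1) (by unfold chartRank; split_ifs <;> omega)]
    congr 2
    refine Finset.prod_congr rfl fun u hu => ?_
    rw [Finset.mem_Ico] at hu
    unfold chartC
    split_ifs with h6 h7
    · rfl
    · rfl
    · have h8 := D.ι_le_center hs (show u < s by omega)
      have h9 := D.lt_ι_of_l_le (show u < D.n by omega) hu.1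
      rw [h (D.ι u) (by unfold chartRank; split_ifs <;> omega)]

theorem exists_chartZ (hs : s ≤ D.n) : ∃ z : ℕ → B, ∀ j, z j = D.chartZ s x y z j :=
  haveI : Inhabited B := ⟨0⟩
  exists_recursive_fix (D.chartRank s) _ (D.chartZ_congr s x y hs)

variable {s x y} in
theorem prod_chartC_of_center_le {j : ℕ} (hs : s ≤ D.n) (hj : j ≤ D.m) (h : D.center s ≤ j)
    (z : ℕ → B) : ∏ u ∈ Finset.Ico (D.l j) (D.n + 1), D.chartC s y z u = 1 := by
  refine Finset.prod_eq_one fun u hu => if_pos ?_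
  have := D.lt_l_of_center_le hs hj h
  rw [Finset.mem_Ico] at hu
  omega

variable {s x y} in
theorem prod_chartA_of_lt_center {j : ℕ} (hs : s ≤ D.n) (h : j < D.center s)
    (z : ℕ → B) : ∏ u ∈ Finset.range (D.l j), D.chartA s x z u = 1 := by
  refine Finset.prod_eq_one fun u hu => if_pos ?_
  have := D.l_le_of_lt_center hs h
  rw [Finset.mem_range] at hu
  omega

variable {s x y} in
/-- The recursion produces a zigzag. -/
theorem isZigzag_chart (hs : s ≤ D.n) {z : ℕ → B} (hz : ∀ j, z j = D.chartZ s x y z j) :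
    IsZigzag D (D.chartA s x z) (D.chartC s y z) (D.chartK s z) z := by
  have hn := D.n_pos
  have hm := D.m_pos
  have up : ∀ j ≤ D.m, D.center s ≤ j → z (j + 1) = (z j + algebraMap ℂ B (D.ε j)) *
      ∏ u ∈ Finset.range (D.l j), D.chartA s x z u := by
    intro j hj hc
    conv_lhs => rw [hz, chartZ, if_neg (by omega), if_neg (by omega), if_pos (by omega)]
    rfl
  have down : ∀ j ≤ D.m, j < D.center s → z j = z (j + 1) *
      ∏ u ∈ Finset.Ico (D.l j) (D.n + 1), D.chartC s y z u - algebraMap ℂ B (D.ε j) := by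
    intro j hj hc
    conv_lhs => rw [hz, chartZ, if_neg (by omega), if_neg (by omega), if_neg (by omega)]
  have mid := hz (D.center s)
  rw [chartZ, if_neg (by have := D.center_le s hs; omega), if_pos rfl] at mid
  refine ⟨?_, ?_, fun j hj => ?_, fun j hj => ?_, fun u hu => ?_, fun j hj => ?_⟩
  · rcases Nat.eq_zero_or_pos s with rfl | hs0
    · simp only [center, if_true] at mid
      simp [chartK, chartC, center, D.ε_zero, mid]
    · have h1 : 0 < D.center s := (D.ι_pos 0 (Nat.zero_le _)).trans (D.ι_le_center hs hs0)
      simp [chartK, chartC, h1.ne', hs0.ne, D.ι_zero, D.η_zero]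
  · rcases hs.eq_or_lt with rfl | hsn
    · have : D.center D.n = D.m + 1 := by simp [center, show D.n ≠ 0 by omega]
      rw [this, if_neg (by omega), if_pos rfl] at mid
      simp [chartK, chartA, this, mid]
    · have h1 : D.center s ≤ D.m := by
        unfold center
        have := D.ι_le s hs
        split_ifs <;> omega
      simp only [chartK, chartA]
      rw [if_pos h1, if_neg (by omega), if_neg (by omega), D.ι_last, D.η_last]
  · rcases lt_or_ge j (D.center s) with h | h
    · rw [chartK, if_neg (by omega)]
      conv_rhs => rw [down j hj h]
      ring
    · rw [chartK, if_pos h, D.prod_chartC_of_center_le hs hj h, mul_one]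
  · rcases lt_or_ge j (D.center s) with h | h
    · rw [chartK, if_neg (by omega), D.prod_chartA_of_lt_center hs h, mul_one]
    · rw [chartK, if_pos h, up j hj h]
  · rcases lt_trichotomy u s with h | rfl | h
    · rw [chartA, chartC, if_pos h, if_neg (by omega), if_neg (by omega), one_mul]
    · rw [chartA, chartC, if_neg (lt_irrefl _), if_pos rfl, if_neg (lt_irrefl _), if_pos rfl]
      -- In an end chart the center prescribes a full cycle instead of the `2`-cycle at `s`. The
      -- pair relation is then the first step of the recursion away from the center.
      rcases Nat.eq_zero_or_pos u with rfl | hu0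
      · have h1 : D.center 0 = 0 := by simp [center]
        rw [h1, if_pos rfl] at mid
        have h2 := up 0 (Nat.zero_le _) h1.le
        rw [D.l_zero, Finset.prod_range_one, chartA, if_neg (lt_irrefl _), if_pos rfl, D.ε_zero,
          map_zero, add_zero, mid] at h2
        rw [D.ι_zero, D.η_zero, map_zero, add_zero, h2, mul_comm]
      · rcases hu.eq_or_lt with rfl | hun
        · have h1 : D.center D.n = D.m + 1 := by simp [center, show D.n ≠ 0 by omega]
          rw [h1, if_neg (by omega), if_pos rfl] at mid
          have h2 := down D.m le_rfl (by omega)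
          rw [D.l_last, Nat.Ico_succ_singleton, Finset.prod_singleton, chartC,
            if_neg (lt_irrefl _), if_pos rfl, mid] at h2
          rw [D.ι_last, D.η_last, h2]
          ring
        · have h1 : D.center u = D.ι u := by
            rw [center, if_neg (by omega), if_neg (by omega)]
          rw [h1, if_neg (by omega), if_neg (by omega)] at mid
          rw [mid]
          ring
    · rw [chartA, chartC, if_neg (by omega), if_neg (by omega), if_pos h, mul_one]
  · rw [hz, chartZ, if_pos hj]

variable {s x y} in
/-- A zigzag in the gauge of the chart `s` is determined by `a s` and `c s`. -/
theorem _root_.IsZigzag.eq_chart {a c k z : ℕ → B} (h : IsZigzag D a c k z) (hs : s ≤ D.n)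
    (ha : ∀ u < s, a u = 1) (has : a s = x) (hc : ∀ u, s < u → u ≤ D.n → c u = 1)
    (hcs : c s = y) :
    (∀ u ≤ D.n, a u = D.chartA s x z u) ∧ (∀ u ≤ D.n, c u = D.chartC s y z u) ∧
      (∀ j ≤ D.m, k j = D.chartK s z j) ∧ ∀ j, z j = D.chartZ s x y z j := by
  have hA : ∀ u ≤ D.n, a u = D.chartA s x z u := by
    intro u hu
    unfold chartA
    split_ifs with h1 h2
    · exact ha u h1
    · rw [h2, has]
    · rw [← h.pair u hu, hc u (by omega) hu, mul_one]
  have hC : ∀ u ≤ D.n, c u = D.chartC s y z u := by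
    intro u hu
    unfold chartC
    split_ifs with h1 h2
    · exact hc u h1 hu
    · rw [h2, hcs]
    · rw [← h.pair u hu, ha u (by omega), one_mul]
  have hpA : ∀ j, ∏ u ∈ Finset.range (D.l j), a u =
      ∏ u ∈ Finset.range (D.l j), D.chartA s x z u := fun j =>
    Finset.prod_congr rfl fun u hu => hA u (by
      have := Finset.mem_range.1 hu
      have := D.l_le j
      omega)
  have hpC : ∀ j, ∏ u ∈ Finset.Ico (D.l j) (D.n + 1), c u =
      ∏ u ∈ Finset.Ico (D.l j) (D.n + 1), D.chartC s y z u := fun j =>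
    Finset.prod_congr rfl fun u hu => hC u (by
      have := Finset.mem_Ico.1 hu
      omega)
  have hK : ∀ j ≤ D.m, k j = D.chartK s z j := by
    intro j hj
    unfold chartK
    split_ifs with h1
    · rw [← h.clockwise j hj, hpC, D.prod_chartC_of_center_le hs hj h1, mul_one]
    · rw [← h.anticlockwise j hj, hpA, D.prod_chartA_of_lt_center hs (by omega), mul_one]
  refine ⟨hA, hC, hK, fun j => ?_⟩
  unfold chartZ
  split_ifs with h1 h2 h3 h4 h5
  · exact h.z_gt j h1
  · subst h3
    rw [center, if_pos rfl] at h2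
    rw [h2, ← hcs, ← h.k_zero]
    have h4 := h.clockwise 0 (Nat.zero_le _)
    rw [hpC, D.prod_chartC_of_center_le hs (Nat.zero_le _) (by simp [center]), D.ε_zero, map_zero,
      add_zero, mul_one] at h4
    exact h4.symm
  · rw [center, if_neg h3, if_pos h4] at h2
    rw [h2, ← has, h4, ← h.k_last, ← h.anticlockwise D.m le_rfl, hpA,
      D.prod_chartA_of_lt_center hs (by rw [center, if_neg h3, if_pos h4]; omega), mul_one]
  · rw [center, if_neg h3, if_neg h4] at h2
    rw [h2, ← has, ← hcs, h.pair s hs]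
    ring
  · obtain ⟨i, rfl⟩ : ∃ i, j = i + 1 := ⟨j - 1, by omega⟩
    rw [Nat.add_sub_cancel, ← h.anticlockwise i (by omega), hpA, hK i (by omega), chartK,
      if_pos (by omega)]
  · have hj : j ≤ D.m := by
      have := D.center_le s hs
      omega
    have h6 := h.clockwise j hj
    rw [hpC, hK j hj, chartK, if_neg (by omega)] at h6
    rw [h6]
    ring

end ZigzagData

/-- Two zigzags in the gauge of the chart `s` with the same `a s` and `c s` agree. -/
theorem IsZigzag.chart_unique {D : ZigzagData} {B : Type*} [CommRing B] [Algebra ℂ B]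
    {s : ℕ} (hs : s ≤ D.n) {a c k z a' c' k' z' : ℕ → B}
    (h : IsZigzag D a c k z) (h' : IsZigzag D a' c' k' z')
    (ha : ∀ u < s, a u = 1) (hc : ∀ u, s < u → u ≤ D.n → c u = 1)
    (ha' : ∀ u < s, a' u = 1) (hc' : ∀ u, s < u → u ≤ D.n → c' u = 1)
    (has : a s = a' s) (hcs : c s = c' s) :
    (∀ u ≤ D.n, a u = a' u) ∧ (∀ u ≤ D.n, c u = c' u) ∧ (∀ j ≤ D.m, k j = k' j) ∧ z = z' := by
  obtain ⟨h1, h2, h3, h4⟩ := IsZigzag.eq_chart D h hs ha has hc hcs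
  obtain ⟨h1', h2', h3', h4'⟩ := IsZigzag.eq_chart D h' hs ha' rfl hc' rfl
  obtain rfl : z = z' := recursive_fix_unique (D.chartRank s) _ (D.chartZ_congr s _ _ hs) h4 h4'
  exact ⟨fun u hu => (h1 u hu).trans (h1' u hu).symm, fun u hu => (h2 u hu).trans (h2' u hu).symm,
    fun j hj => (h3 j hj).trans (h3' j hj).symm, rfl⟩

/-! ### Normal forms for polynomials in the invariants -/

/-- Bounds a subalgebra by a subspace that need not be closed under products: stability under the
generators is enough. -/
theorem Algebra.toSubmodule_adjoin_le {B : Type*} [CommRing B] [Algebra ℂ B] {S : Set B}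
    {W : Submodule ℂ B} (h1 : 1 ∈ W) (hS : ∀ x ∈ S, ∀ w ∈ W, x * w ∈ W) :
    Subalgebra.toSubmodule (Algebra.adjoin ℂ S) ≤ W := by
  rw [Algebra.adjoin_eq_span, Submodule.span_le]
  intro x hx
  induction hx using Submonoid.closure_induction_left with
  | one => exact h1
  | mul_left x hx y _ hy => exact hS x hx y hy

/-- Among the terms with nonzero coefficient, the one of largest degree has a leading monomial that
nothing else can cancel. -/
theorem MonomialOrder.linearIndepOn_of_injOn_degree {σ I : Type*} (mo : MonomialOrder σ)
    (v : I → MvPolynomial σ ℂ) (T : Set I) (h0 : ∀ i ∈ T, v i ≠ 0)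
    (hinj : Set.InjOn (fun i => mo.degree (v i)) T) : LinearIndepOn ℂ v T := by
  rw [linearIndepOn_iff']
  intro s g hs hg
  by_contra! hc
  obtain ⟨i, hi, hgi⟩ := hc
  obtain ⟨j, hj, hmax⟩ := (s.filter (g · ≠ 0)).exists_max_image
    (fun i => mo.toSyn (mo.degree (v i))) ⟨i, Finset.mem_filter.2 ⟨hi, hgi⟩⟩
  rw [Finset.mem_filter] at hj
  have h := congrArg (MvPolynomial.coeff (mo.degree (v j))) hg
  rw [MvPolynomial.coeff_sum, Finset.sum_eq_single j, MvPolynomial.coeff_smul,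
    MvPolynomial.coeff_zero, smul_eq_mul, mul_eq_zero] at h
  · exact h.elim hj.2 (mo.coeff_degree_ne_zero_iff.2 (h0 j (hs hj.1)))
  · intro i hi hij
    rw [MvPolynomial.coeff_smul, smul_eq_mul]
    by_cases hgi : g i = 0
    · rw [hgi, zero_mul]
    · rw [mo.coeff_eq_zero_of_lt, mul_zero]
      refine (hmax i (Finset.mem_filter.2 ⟨hi, hgi⟩)).lt_of_ne fun h => hij ?_
      exact hinj (hs hi) (hs hj.1) (mo.toSyn.injective h)
  · exact fun h => absurd hj.1 h

/-- The exponents of the monomials in two consecutive invariants. -/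
def normalExponents (m : ℕ) : Set (ℕ →₀ ℕ) :=
  {e | ∃ i ≤ m, ∃ p q, e = Finsupp.single i p + Finsupp.single (i + 1) q}

namespace IsZigzag

variable {D : ZigzagData} {B : Type*} [CommRing B] [Algebra ℂ B] {a c k z : ℕ → B}

/-- The span of the monomials in two consecutive invariants. -/
def normalSpan (z : ℕ → B) (m : ℕ) : Submodule ℂ B :=
  Submodule.span ℂ ((fun e : ℕ →₀ ℕ => e.prod fun j p => z j ^ p) '' normalExponents m)

theorem normal_monomial {B : Type*} [CommRing B] (z : ℕ → B) (i p q : ℕ) :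
    ((Finsupp.single i p + Finsupp.single (i + 1) q).prod fun j p => z j ^ p) =
      z i ^ p * z (i + 1) ^ q := by
  rw [Finsupp.prod_add_index' (h := fun j p => z j ^ p) (fun _ => pow_zero _)
    (fun _ _ _ => pow_add _ _ _), Finsupp.prod_single_index (h := fun j p => z j ^ p) (pow_zero _),
    Finsupp.prod_single_index (h := fun j p => z j ^ p) (pow_zero _)]

theorem mul_mem_normalSpan (z : ℕ → B) {i m : ℕ} (hi : i ≤ m) (p q : ℕ) :
    z i ^ p * z (i + 1) ^ q ∈ normalSpan z m := by
  rw [← normal_monomial]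
  exact Submodule.subset_span ⟨_, ⟨i, hi, p, q, rfl⟩, rfl⟩

theorem adjoin_pair_le_normalSpan (z : ℕ → B) {i m : ℕ} (hi : i ≤ m) :
    Subalgebra.toSubmodule (Algebra.adjoin ℂ (z '' Set.Icc i (i + 1))) ≤ normalSpan z m := by
  refine le_trans (b := Submodule.span ℂ
    (Set.range fun pq : ℕ × ℕ => z i ^ pq.1 * z (i + 1) ^ pq.2)) ?_ ?_
  · refine Algebra.toSubmodule_adjoin_le (Submodule.subset_span ⟨(0, 0), by simp⟩) ?_
    rintro _ ⟨j, hj, rfl⟩ w hw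
    induction hw using Submodule.span_induction with
    | mem w hw =>
      obtain ⟨⟨p, q⟩, rfl⟩ := hw
      obtain rfl | rfl : j = i ∨ j = i + 1 := by
        have := hj.1
        have := hj.2
        omega
      · exact Submodule.subset_span ⟨(p + 1, q), by simp only; ring⟩
      · exact Submodule.subset_span ⟨(p, q + 1), by simp only; ring⟩
    | zero => rw [mul_zero]; exact zero_mem _
    | add x y _ _ hx hy => rw [mul_add]; exact add_mem hx hy
    | smul t x _ hx => rw [mul_smul_comm]; exact Submodule.smul_mem _ _ hx
  · rw [Submodule.span_le]
    rintro _ ⟨⟨p, q⟩, rfl⟩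
    exact mul_mem_normalSpan z hi p q

/-- The straightening rule: a product of two non-adjacent invariants is replaced by invariants
strictly between them, up to a multiple of `z j` caused by `ε i`. It is `mul_eq` for `i` and `j -
1`, where `l i ≤ u < l (j - 1)` forces `i + 1 ≤ ι u ≤ j - 1`. -/
theorem exists_mul_eq (h : IsZigzag D a c k z) {i j : ℕ} (hij : i + 2 ≤ j) (hj : j ≤ D.m + 1) :
    ∃ t : ℂ, ∃ g ∈ Algebra.adjoin ℂ (z '' Set.Icc (i + 1) (j - 1)),
      z i * z j = t • z j + g := by
  obtain ⟨j, rfl⟩ : ∃ j', j = j' + 1 := ⟨j - 1, by omega⟩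
  have hz : ∀ v, i + 1 ≤ v → v ≤ j → z v ∈ Algebra.adjoin ℂ (z '' Set.Icc (i + 1) j) :=
    fun v h1 h2 => Algebra.subset_adjoin ⟨v, ⟨h1, h2⟩, rfl⟩
  refine ⟨-D.ε i, z (i + 1) * (z j + algebraMap ℂ B (D.ε j)) *
    ∏ u ∈ Finset.Ico (D.l i) (D.l j), (z (D.ι u) + algebraMap ℂ B (D.η u)), ?_, ?_⟩
  rotate_left
  · rw [← h.mul_eq (show i < j by omega) (by omega), neg_smul, Algebra.smul_def]
    ring
  · refine mul_mem (mul_mem (hz _ le_rfl (by omega)) (add_mem (hz _ (by omega) le_rfl)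
      (Subalgebra.algebraMap_mem _ _))) (prod_mem fun u hu => ?_)
    rw [Finset.mem_Ico] at hu
    have h1 := D.l_le j
    have h2 := D.lt_ι_of_l_le (show u < D.n by omega) hu.1
    have h3 := D.ι_le_of_lt_l (show 1 ≤ j by omega) hu.2
    exact add_mem (hz _ (by omega) h3) (Subalgebra.algebraMap_mem _ _)

/-- The sum on the right is stable under every `z v`: the only products not obviously in it are `z
j` times a polynomial containing `z i`, and `z i` times a polynomial containing `z j`. Straightening
removes these mixed terms. -/
theorem adjoin_le_sup (h : IsZigzag D a c k z) {i j : ℕ} (hij : i + 2 ≤ j) (hj : j ≤ D.m + 1) :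
    Subalgebra.toSubmodule (Algebra.adjoin ℂ (z '' Set.Icc i j)) ≤
      Subalgebra.toSubmodule (Algebra.adjoin ℂ (z '' Set.Icc i (j - 1))) ⊔
        Subalgebra.toSubmodule (Algebra.adjoin ℂ (z '' Set.Icc (i + 1) j)) := by
  obtain ⟨t, h', hh', hrel⟩ := h.exists_mul_eq hij hj
  set L := Algebra.adjoin ℂ (z '' Set.Icc i (j - 1)) with hL
  set R := Algebra.adjoin ℂ (z '' Set.Icc (i + 1) j) with hR
  set M := Algebra.adjoin ℂ (z '' Set.Icc (i + 1) (j - 1)) with hM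
  have hML : M ≤ L := Algebra.adjoin_mono (Set.image_mono (Set.Icc_subset_Icc (by omega) le_rfl))
  have hMR : M ≤ R := Algebra.adjoin_mono (Set.image_mono (Set.Icc_subset_Icc le_rfl (by omega)))
  have hziL : z i ∈ L := Algebra.subset_adjoin ⟨i, ⟨le_rfl, by omega⟩, rfl⟩
  have hzjR : z j ∈ R := Algebra.subset_adjoin ⟨j, ⟨by omega, le_rfl⟩, rfl⟩
  have hLW : ∀ w ∈ L, w ∈ Subalgebra.toSubmodule L ⊔ Subalgebra.toSubmodule R :=
    fun w hw => Submodule.mem_sup_left hw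
  have hRW : ∀ w ∈ R, w ∈ Subalgebra.toSubmodule L ⊔ Subalgebra.toSubmodule R :=
    fun w hw => Submodule.mem_sup_right hw
  -- `L` and `R` are spanned by the products of powers of `z i` and `z j` with elements of `M`.
  have span_pow : ∀ (v : ℕ) (S : Set ℕ), S ⊆ insert v (Set.Icc (i + 1) (j - 1)) →
      ∀ w ∈ Algebra.adjoin ℂ (z '' S),
        w ∈ Submodule.span ℂ {f | ∃ p : ℕ, ∃ g ∈ M, f = z v ^ p * g} := by
    intro v S hS
    refine Algebra.toSubmodule_adjoin_le
      (Submodule.subset_span ⟨0, 1, one_mem _, by simp⟩) ?_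
    rintro _ ⟨u, hu, rfl⟩ w hw
    induction hw using Submodule.span_induction with
    | mem w hw =>
      obtain ⟨p, g, hg, rfl⟩ := hw
      rcases hS hu with rfl | hu
      · exact Submodule.subset_span ⟨p + 1, g, hg, by ring⟩
      · exact Submodule.subset_span ⟨p, z u * g,
          mul_mem (Algebra.subset_adjoin ⟨u, hu, rfl⟩) hg, by ring⟩
    | zero => rw [mul_zero]; exact zero_mem _
    | add x y _ _ hx hy => rw [mul_add]; exact add_mem hx hy
    | smul t x _ hx => rw [mul_smul_comm]; exact Submodule.smul_mem _ _ hx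
  -- The linear term `t • z j` of the relation still multiplies the remaining powers of `z i`, so an
  -- induction on `p` is needed.
  have hj1 : ∀ p : ℕ, ∀ g ∈ M, z j * (z i ^ p * g) ∈
      Subalgebra.toSubmodule L ⊔ Subalgebra.toSubmodule R := by
    intro p
    induction p with
    | zero =>
      intro g hg
      rw [pow_zero, one_mul]
      exact hRW _ (mul_mem hzjR (hMR hg))
    | succ p ih =>
      intro g hg
      have : z j * (z i ^ (p + 1) * g) = t • (z j * (z i ^ p * g)) + z i ^ p * (h' * g) := by
        rw [Algebra.smul_def] at hrel ⊢
        linear_combination z i ^ p * g * hrel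
      rw [this]
      exact add_mem (Submodule.smul_mem _ _ (ih g hg))
        (hLW _ (mul_mem (pow_mem hziL _) (hML (mul_mem hh' hg))))
  -- No induction here: after one use of the relation no `z i` is left.
  have hi1 : ∀ p : ℕ, ∀ g ∈ M, z i * (z j ^ p * g) ∈
      Subalgebra.toSubmodule L ⊔ Subalgebra.toSubmodule R := by
    intro p g hg
    cases p with
    | zero =>
      rw [pow_zero, one_mul]
      exact hLW _ (mul_mem hziL (hML hg))
    | succ p =>
      have : z i * (z j ^ (p + 1) * g) = t • (z j ^ (p + 1) * g) + z j ^ p * (h' * g) := by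
        rw [Algebra.smul_def] at hrel ⊢
        linear_combination z j ^ p * g * hrel
      rw [this]
      exact add_mem (Submodule.smul_mem _ _ (hRW _ (mul_mem (pow_mem hzjR _) (hMR hg))))
        (hRW _ (mul_mem (pow_mem hzjR _) (hMR (mul_mem hh' hg))))
  have lin : ∀ (x : B) (s : Set B),
      (∀ w ∈ s, x * w ∈ Subalgebra.toSubmodule L ⊔ Subalgebra.toSubmodule R) →
      ∀ w ∈ Submodule.span ℂ s, x * w ∈ Subalgebra.toSubmodule L ⊔ Subalgebra.toSubmodule R := by
    intro x s hs w hw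
    induction hw using Submodule.span_induction with
    | mem w hw => exact hs w hw
    | zero => rw [mul_zero]; exact zero_mem _
    | add x y _ _ hx hy => rw [mul_add]; exact add_mem hx hy
    | smul t x _ hx => rw [mul_smul_comm]; exact Submodule.smul_mem _ _ hx
  refine Algebra.toSubmodule_adjoin_le (hLW _ (one_mem _)) ?_
  rintro _ ⟨v, hv, rfl⟩ w hw
  obtain ⟨w1, hw1, w2, hw2, rfl⟩ := Submodule.mem_sup.1 hw
  rw [mul_add]
  refine add_mem ?_ ?_
  · rcases hv.2.eq_or_lt with rfl | hvj
    · refine lin _ _ ?_ w1 (span_pow i _ ?_ w1 hw1)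
      · rintro _ ⟨p, g, hg, rfl⟩
        exact hj1 p g hg
      · intro u hu
        rcases hu.1.eq_or_lt with rfl | hu'
        · exact Set.mem_insert _ _
        · exact Set.mem_insert_of_mem _ ⟨hu', hu.2⟩
    · exact hLW _ (mul_mem (Algebra.subset_adjoin ⟨v, ⟨hv.1, by omega⟩, rfl⟩) hw1)
  · rcases hv.1.eq_or_lt with rfl | hvi
    · refine lin _ _ ?_ w2 (span_pow j _ ?_ w2 hw2)
      · rintro _ ⟨p, g, hg, rfl⟩
        exact hi1 p g hg
      · intro u hu
        rcases hu.2.eq_or_lt with rfl | hu'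
        · exact Set.mem_insert _ _
        · exact Set.mem_insert_of_mem _ ⟨hu.1, by omega⟩
    · exact hRW _ (mul_mem (Algebra.subset_adjoin ⟨v, ⟨hvi, hv.2⟩, rfl⟩) hw2)

/-- Splitting an interval of indices repeatedly into the two intervals shorter by one ends at pairs
of neighbours. -/
theorem adjoin_le_normalSpan (h : IsZigzag D a c k z) :
    Subalgebra.toSubmodule (Algebra.adjoin ℂ (z '' Set.Icc 0 (D.m + 1))) ≤
      normalSpan z D.m := by
  have : ∀ d i, i + 1 + d ≤ D.m + 1 →
      Subalgebra.toSubmodule (Algebra.adjoin ℂ (z '' Set.Icc i (i + 1 + d))) ≤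
        normalSpan z D.m := by
    intro d
    induction d with
    | zero => intro i hi; exact adjoin_pair_le_normalSpan z (by omega)
    | succ d ih =>
      intro i hi
      refine (h.adjoin_le_sup (by omega) hi).trans (sup_le ?_ ?_)
      · exact ih i (by omega)
      · rw [show i + 1 + (d + 1) = i + 1 + 1 + d by omega]
        exact ih (i + 1) (by omega)
  have h1 := this D.m 0 (by omega)
  rwa [show 0 + 1 + D.m = D.m + 1 by omega] at h1

end IsZigzag

/-! ### Leading exponents in the chart `0` -/

namespace ZigzagData

variable (D : ZigzagData)

/-- The leading exponents of `z j` and of `∏ u < l j, a u` in the chart `0`. -/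
noncomputable def leadExp : ℕ → (Fin 2 →₀ ℕ) × (Fin 2 →₀ ℕ)
  | 0 => (Finsupp.single 1 1, Finsupp.single 0 1)
  -- Up to constants, `z (j + 1)` is `z j` times the path to `l j`, and the path to `l (j + 1)` has
  -- `l (j + 1) - l j` further factors `z (j + 1)`.
  | j + 1 => ((leadExp j).1 + (leadExp j).2,
      (leadExp j).2 + (D.l (j + 1) - D.l j) • ((leadExp j).1 + (leadExp j).2))

/-- The determinant of two vectors. -/
def expDet (v w : Fin 2 →₀ ℕ) : ℤ := (v 0 : ℤ) * w 1 - (v 1 : ℤ) * w 0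

theorem expDet_add (v w w' : Fin 2 →₀ ℕ) : expDet v (w + w') = expDet v w + expDet v w' := by
  simp only [expDet, Finsupp.add_apply]
  push_cast
  ring

theorem expDet_nsmul (v w : Fin 2 →₀ ℕ) (N : ℕ) : expDet v (N • w) = N * expDet v w := by
  simp only [expDet, Finsupp.smul_apply, smul_eq_mul]
  push_cast
  ring

theorem expDet_self (v : Fin 2 →₀ ℕ) : expDet v v = 0 := by
  simp only [expDet]
  ring

theorem expDet_swap (v w : Fin 2 →₀ ℕ) : expDet v w = -expDet w v := by
  simp only [expDet]
  ring

/-- Each step of the recursion composes two shears, so the two exponents remain a basis of the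
lattice. -/
theorem expDet_leadExp (j : ℕ) : expDet (D.leadExp j).1 (D.leadExp j).2 = -1 := by
  induction j with
  | zero => simp [leadExp, expDet]
  | succ j ih =>
    rw [leadExp, expDet_add, expDet_nsmul, expDet_self, expDet_swap, expDet_add, expDet_self,
      expDet_swap, ih]
    simp

/-- The leading exponents always turn in the same sense. The two components are carried along
together, since each new vector is a nonnegative combination of the previous pair. -/
theorem expDet_leadExp_lt {i j : ℕ} (hij : i < j) :
    expDet (D.leadExp i).1 (D.leadExp j).1 < 0 ∧ expDet (D.leadExp i).1 (D.leadExp j).2 < 0 := by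
  induction j, hij using Nat.le_induction with
  | base =>
    have h := D.expDet_leadExp i
    have h1 : expDet (D.leadExp i).1 (D.leadExp (i + 1)).1 = -1 := by
      rw [leadExp, expDet_add, expDet_self, h, zero_add]
    refine ⟨by rw [h1]; norm_num, ?_⟩
    rw [leadExp] at h1
    rw [leadExp, expDet_add, expDet_nsmul, h1, h]
    have : (0 : ℤ) ≤ ((D.l (i + 1) - D.l i : ℕ) : ℤ) := Int.natCast_nonneg _
    linarith
  | succ j hij ih =>
    have h1 : expDet (D.leadExp i).1 (D.leadExp (j + 1)).1 < 0 := by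
      rw [leadExp, expDet_add]
      linarith [ih.1, ih.2]
    refine ⟨h1, ?_⟩
    rw [leadExp] at h1
    rw [leadExp, expDet_add, expDet_nsmul]
    have : (0 : ℤ) ≤ ((D.l (j + 1) - D.l j : ℕ) : ℤ) := Int.natCast_nonneg _
    nlinarith [ih.2]

theorem sum_leadExp (i p q : ℕ) :
    (Finsupp.sum (Finsupp.single i p + Finsupp.single (i + 1) q)
      fun j p => p • (D.leadExp j).1) = p • (D.leadExp i).1 + q • (D.leadExp (i + 1)).1 := by
  rw [Finsupp.sum_add_index' (h := fun j p => p • (D.leadExp j).1) (fun _ => zero_smul _ _)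
      (fun _ _ _ => add_smul _ _ _),
    Finsupp.sum_single_index (h := fun j p => p • (D.leadExp j).1) (zero_smul _ _),
    Finsupp.sum_single_index (h := fun j p => p • (D.leadExp j).1) (zero_smul _ _)]

/-- Cones spanned by consecutive leading exponents form a fan. For `i < j`, pairing an equality of
two combinations with the exponent of `z (i + 1)` gives a nonnegative number on one side and a
nonpositive one on the other. So all coefficients off a common ray vanish. -/
theorem leadExp_injOn (m : ℕ) : Set.InjOn
    (fun e : ℕ →₀ ℕ => e.sum fun j p => p • (D.leadExp j).1) (normalExponents m) := by
  have key : ∀ i j p q p' q' : ℕ, i ≤ j →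
      p • (D.leadExp i).1 + q • (D.leadExp (i + 1)).1 =
        p' • (D.leadExp j).1 + q' • (D.leadExp (j + 1)).1 →
      Finsupp.single i p + Finsupp.single (i + 1) q =
        Finsupp.single j p' + Finsupp.single (j + 1) q' := by
    intro i j p q p' q' hij h
    have hd : ∀ v, (p : ℤ) * expDet v (D.leadExp i).1 + q * expDet v (D.leadExp (i + 1)).1 =
        p' * expDet v (D.leadExp j).1 + q' * expDet v (D.leadExp (j + 1)).1 := by
      intro v
      have := congrArg (expDet v) h
      simpa only [expDet_add, expDet_nsmul] using this
    have hlt := fun {i j : ℕ} (hij : i < j) => (D.expDet_leadExp_lt hij).1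
    have hgt : ∀ {i j : ℕ}, i < j → 0 < expDet (D.leadExp j).1 (D.leadExp i).1 := by
      intro i j hij
      rw [expDet_swap]
      linarith [hlt hij]
    rcases hij.eq_or_lt with rfl | hij
    · have h1 := hd (D.leadExp i).1
      have h2 := hd (D.leadExp (i + 1)).1
      rw [expDet_self, mul_zero, mul_zero, zero_add, zero_add] at h1
      rw [expDet_self, mul_zero, mul_zero, add_zero, add_zero] at h2
      have hq := mul_right_cancel₀ (hlt (Nat.lt_succ_self i)).ne h1
      have hp := mul_right_cancel₀ (hgt (Nat.lt_succ_self i)).ne' h2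
      rw [Nat.cast_inj.1 hp, Nat.cast_inj.1 hq]
    · have h1 := hd (D.leadExp (i + 1)).1
      rw [expDet_self, mul_zero, add_zero] at h1
      have h2 := hgt (Nat.lt_succ_self i)
      have h3 := hlt (show i + 1 < j + 1 by omega)
      have hp0 := Int.natCast_nonneg p
      have hp0' := Int.natCast_nonneg p'
      have hq0' := Int.natCast_nonneg q'
      rcases (Nat.succ_le_of_lt hij).eq_or_lt with rfl | hij'
      · rw [Nat.succ_eq_add_one, expDet_self, mul_zero, zero_add] at h1
        have hp : (p : ℤ) = 0 := by nlinarith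
        have hq' : (q' : ℤ) = 0 := by nlinarith
        have h5 := hd (D.leadExp i).1
        rw [hp, hq', zero_mul, zero_mul, zero_add, add_zero] at h5
        have h6 := mul_right_cancel₀ (hlt (Nat.lt_succ_self i)).ne h5
        rw [Nat.cast_eq_zero.1 hp, Nat.cast_eq_zero.1 hq', Nat.cast_inj.1 h6]
        simp
      · have h4 := hlt (show i + 1 < j from hij')
        have hp : (p : ℤ) = 0 := by nlinarith
        have hq' : (q' : ℤ) = 0 := by nlinarith
        have hp' : (p' : ℤ) = 0 := by nlinarith
        have h5 := hd (D.leadExp i).1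
        rw [hp, hq', hp', zero_mul, zero_mul, zero_mul, zero_add, add_zero] at h5
        have h6 : (q : ℤ) = 0 := by
          have := hlt (Nat.lt_succ_self i)
          rcases mul_eq_zero.1 h5 with h | h
          · exact h
          · exact absurd h this.ne
        rw [Nat.cast_eq_zero.1 hp, Nat.cast_eq_zero.1 hq', Nat.cast_eq_zero.1 hp',
          Nat.cast_eq_zero.1 h6]
        simp
  rintro _ ⟨i, hi, p, q, rfl⟩ _ ⟨j, hj, p', q', rfl⟩ h
  simp only [sum_leadExp] at h
  rcases le_total i j with hij | hij
  · exact key _ _ _ _ _ _ hij h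
  · exact (key _ _ _ _ _ _ hij h.symm).symm

variable {z : ℕ → MvPolynomial (Fin 2) ℂ}

open MvPolynomial in
-- In the chart `0` the recursion only climbs, and every `z j` is built by products and by adding
-- constants. All leading exponents are nonzero, so the constants do not change them: the answer is
-- independent of the parameters.
theorem degree_chart_zero (hz : ∀ j, z j = D.chartZ 0 (X 0) (X 1) z j) (j : ℕ) (hj : j ≤ D.m + 1) :
    z j ≠ 0 ∧ MonomialOrder.lex.degree (z j) = (D.leadExp j).1 := by
  set mo : MonomialOrder (Fin 2) := MonomialOrder.lex
  have hcenter : D.center 0 = 0 := by simp [center]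
  have hz0 : z 0 = X 1 := by
    rw [hz, chartZ, if_neg (by omega), hcenter, if_pos rfl, if_pos rfl]
  have hstep : ∀ j ≤ D.m, z (j + 1) = (z j + C (D.ε j)) *
      ∏ u ∈ Finset.range (D.l j), D.chartA 0 (X 0) z u := by
    intro j hj
    conv_lhs => rw [hz, chartZ, if_neg (by omega), hcenter, if_neg (by omega), if_pos (by omega)]
    rfl
  have hconst : ∀ (f : MvPolynomial (Fin 2) ℂ) (t : ℂ), mo.degree f ≠ 0 →
      f + C t ≠ 0 ∧ mo.degree (f + C t) = mo.degree f := by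
    intro f t hf
    have h1 : mo.degree (f + C t) = mo.degree f := by
      refine mo.degree_add_of_lt ?_
      rw [mo.degree_C]
      exact (mo.toSyn_lt_iff_ne_zero).2 hf
    exact ⟨mo.ne_zero_of_degree_ne_zero (h1 ▸ hf), h1⟩
  have hpos : ∀ j, (D.leadExp j).1 ≠ 0 := by
    intro j h
    have := D.expDet_leadExp j
    rw [h] at this
    simp [expDet] at this
  have main : ∀ j ≤ D.m, (z j ≠ 0 ∧ mo.degree (z j) = (D.leadExp j).1) ∧
      (∏ u ∈ Finset.range (D.l j), D.chartA 0 (X 0) z u ≠ 0 ∧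
        mo.degree (∏ u ∈ Finset.range (D.l j), D.chartA 0 (X 0) z u) = (D.leadExp j).2) := by
    have next : ∀ j ≤ D.m, (z j ≠ 0 ∧ mo.degree (z j) = (D.leadExp j).1) ∧
      (∏ u ∈ Finset.range (D.l j), D.chartA 0 (X 0) z u ≠ 0 ∧
        mo.degree (∏ u ∈ Finset.range (D.l j), D.chartA 0 (X 0) z u) = (D.leadExp j).2) →
      z (j + 1) ≠ 0 ∧ mo.degree (z (j + 1)) = (D.leadExp (j + 1)).1 := by
      intro j hj ih
      obtain ⟨h1, h2⟩ := hconst (z j) (D.ε j) (by rw [ih.1.2]; exact hpos j)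
      rw [hstep j hj, mo.degree_mul h1 ih.2.1, h2, ih.1.2, ih.2.2]
      exact ⟨mul_ne_zero h1 ih.2.1, rfl⟩
    intro j
    induction j with
    | zero =>
      intro _
      rw [D.l_zero, Finset.prod_range_one, hz0, chartA, if_neg (lt_irrefl _), if_pos rfl,
        mo.degree_X, mo.degree_X]
      exact ⟨⟨X_ne_zero _, rfl⟩, X_ne_zero _, rfl⟩
    | succ j ih =>
      intro hj
      have ih := ih (by omega)
      have hj1 := next j (by omega) ih
      refine ⟨hj1, ?_⟩
      have hu : ∀ u ∈ Finset.Ico (D.l j) (D.l (j + 1)),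
          D.chartA 0 (X 0) z u = z (j + 1) + C (D.η u) := by
        intro u hu
        rw [Finset.mem_Ico] at hu
        have h1 := D.one_le_l j
        have h2 := D.lt_ι_of_l_le (hu.2.trans_le (D.l_le _)) hu.1
        have h3 := D.ι_le_of_lt_l (Nat.succ_pos j) hu.2
        rw [chartA, if_neg (by omega), if_neg (by omega), show D.ι u = j + 1 by omega]
        rfl
      have hne : ∀ u ∈ Finset.Ico (D.l j) (D.l (j + 1)), D.chartA 0 (X 0) z u ≠ 0 := by
        intro u hu'
        rw [hu u hu']
        exact (hconst _ _ (by rw [hj1.2]; exact hpos _)).1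
      rw [← Finset.prod_range_mul_prod_Ico _ (D.l_mono (Nat.le_succ j))]
      have hprod := Finset.prod_ne_zero_iff.2 hne
      refine ⟨mul_ne_zero ih.2.1 hprod, ?_⟩
      rw [mo.degree_mul ih.2.1 hprod, ih.2.2, mo.degree_prod hne, leadExp]
      congr 1
      rw [Finset.sum_congr rfl fun u hu' => by
        rw [hu u hu', (hconst _ (D.η u) (by rw [hj1.2]; exact hpos _)).2, hj1.2],
        Finset.sum_const, Nat.card_Ico, leadExp]
  rcases hj.lt_or_eq with hj | rfl
  · exact (main j (by omega)).1
  · obtain ⟨ih1, ih2⟩ := main D.m le_rfl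
    obtain ⟨h1, h2⟩ := hconst (z D.m) (D.ε D.m) (by rw [ih1.2]; exact hpos _)
    rw [hstep D.m le_rfl, mo.degree_mul h1 ih2.1, h2, ih1.2, ih2.2]
    exact ⟨mul_ne_zero h1 ih2.1, rfl⟩

open MvPolynomial in
theorem linearIndepOn_chart_zero (hz : ∀ j, z j = D.chartZ 0 (X 0) (X 1) z j) :
    LinearIndepOn ℂ (fun e : ℕ →₀ ℕ => e.prod fun j p => z j ^ p) (normalExponents D.m) := by
  have h0 : ∀ e ∈ normalExponents D.m, (e.prod fun j p => z j ^ p) ≠ 0 ∧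
      MonomialOrder.lex.degree (e.prod fun j p => z j ^ p) =
        e.sum fun j p => p • (D.leadExp j).1 := by
    rintro _ ⟨i, hi, p, q, rfl⟩
    obtain ⟨h1, h2⟩ := D.degree_chart_zero hz i (by omega)
    obtain ⟨h3, h4⟩ := D.degree_chart_zero hz (i + 1) (by omega)
    rw [IsZigzag.normal_monomial]
    refine ⟨mul_ne_zero (pow_ne_zero _ h1) (pow_ne_zero _ h3), ?_⟩
    rw [MonomialOrder.degree_mul (pow_ne_zero _ h1) (pow_ne_zero _ h3), MonomialOrder.degree_pow,
      MonomialOrder.degree_pow, h2, h4, sum_leadExp]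
  refine MonomialOrder.lex.linearIndepOn_of_injOn_degree _ _ (fun e he => (h0 e he).1) ?_
  intro e he e' he' h
  simp only [(h0 e he).2, (h0 e' he').2] at h
  exact D.leadExp_injOn D.m he he' h

/-- The polynomials in the invariants of a zigzag embed into the coordinate ring of the chart `0`. -/
theorem _root_.IsZigzag.eq_zero_of_chart_zero {D : ZigzagData} {B : Type*} [CommRing B]
    [Algebra ℂ B] {a c k z : ℕ → B} (h : IsZigzag D a c k z)
    (φ : B →ₐ[ℂ] MvPolynomial (Fin 2) ℂ)
    (hz : ∀ j, φ (z j) =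
      D.chartZ 0 (MvPolynomial.X 0) (MvPolynomial.X 1) (fun j => φ (z j)) j)
    {f : B} (hf : f ∈ Algebra.adjoin ℂ (z '' Set.Icc 0 (D.m + 1))) (h0 : φ f = 0) : f = 0 := by
  have h1 := h.adjoin_le_normalSpan hf
  rw [IsZigzag.normalSpan, Finsupp.mem_span_image_iff_linearCombination] at h1
  obtain ⟨g, hg, rfl⟩ := h1
  have h2 := linearIndepOn_iff.1 (D.linearIndepOn_chart_zero hz) g hg ?_
  · rw [h2, map_zero]
  · rw [← h0, Finsupp.linearCombination_apply, Finsupp.linearCombination_apply, Finsupp.sum,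
      Finsupp.sum, map_sum]
    refine Finset.sum_congr rfl fun e _ => ?_
    rw [map_smul, Finsupp.prod, Finsupp.prod, map_prod]
    simp only [map_pow]

/-! ### The full cycle does not vanish on any chart -/

open Polynomial in
-- With both coordinates set equal to one variable, degrees add under products and ignore constants.
-- This gives one argument for all charts, although the recursion runs in two directions.
theorem natDegree_chartZ_pos {s : ℕ} (hs : s ≤ D.n) {z : ℕ → ℂ[X]}
    (hz : ∀ j, z j = D.chartZ s X X z j) (j : ℕ) (hj : j ≤ D.m + 1) : 0 < (z j).natDegree := by
  have hadd : ∀ (f : ℂ[X]) (t : ℂ), 0 < f.natDegree → 0 < (f + algebraMap ℂ ℂ[X] t).natDegree := by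
    intro f t hf
    change 0 < (f + C t).natDegree
    rwa [natDegree_add_C]
  have hmul : ∀ f g : ℂ[X], 0 < f.natDegree → g ≠ 0 → 0 < (f * g).natDegree := by
    intro f g hf hg
    rw [natDegree_mul (by rintro rfl; simp at hf) hg]
    omega
  have hne : ∀ f : ℂ[X], 0 < f.natDegree → f ≠ 0 := by
    rintro f hf rfl
    simp at hf
  have key : ∀ N j, D.chartRank s j < N → j ≤ D.m + 1 → 0 < (z j).natDegree := by
    intro N
    induction N with
    | zero => intro j hj; exact absurd hj (Nat.not_lt_zero _)
    | succ N ih =>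
      intro j hN hj
      rw [hz, chartZ, if_neg (by omega)]
      split_ifs with h1 h2 h3 h4
      · simp
      · simp
      · rw [sub_eq_add_neg, ← map_neg]
        refine hadd _ _ ?_
        rw [natDegree_mul X_ne_zero X_ne_zero]
        simp
      · refine hmul _ _ (hadd _ _ (ih _ ?_ (by omega))) (Finset.prod_ne_zero_iff.2 fun u hu => ?_)
        · unfold chartRank at hN ⊢
          split_ifs at hN ⊢ <;> omega
        · rw [Finset.mem_range] at hu
          unfold chartA
          split_ifs with h6 h7
          · exact one_ne_zero
          · exact X_ne_zero
          · have hun := hu.trans_le (D.l_le (j - 1))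
            have h8 := D.center_le_ι hun (show s < u by omega)
            have h9 : D.ι u ≤ j - 1 := by
              refine D.ι_le_of_lt_l ?_ hu
              by_contra! hc
              rw [show j - 1 = 0 by omega, D.l_zero] at hu
              omega
            refine hne _ (hadd _ _ (ih _ ?_ (by omega)))
            unfold chartRank at hN ⊢
            split_ifs at hN ⊢ <;> omega
      · have hc := D.center_le s hs
        rw [sub_eq_add_neg, ← map_neg]
        refine hadd _ _ (hmul _ _ (ih _ ?_ (by omega)) (Finset.prod_ne_zero_iff.2 fun u hu => ?_))
        · unfold chartRank at hN ⊢
          split_ifs at hN ⊢ <;> omega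
        · rw [Finset.mem_Ico] at hu
          unfold chartC
          split_ifs with h6 h7
          · exact one_ne_zero
          · exact X_ne_zero
          · have h8 := D.ι_le_center hs (show u < s by omega)
            have h9 := D.lt_ι_of_l_le (show u < D.n by omega) hu.1
            refine hne _ (hadd _ _ (ih _ ?_ (by omega)))
            unfold chartRank at hN ⊢
            split_ifs at hN ⊢ <;> omega
  exact key _ j (Nat.lt_succ_self _) hj

open MvPolynomial in
-- This makes every chart meet the locus `z 0 ≠ 0`, which is what connects the charts to an
-- irreducible space. Setting both coordinates equal already detects it.
theorem chart_z_zero_ne_zero {s : ℕ} (hs : s ≤ D.n)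
    (hz : ∀ j, z j = D.chartZ s (X 0) (X 1) z j) : z 0 ≠ 0 := by
  intro h0
  let φ : MvPolynomial (Fin 2) ℂ →ₐ[ℂ] Polynomial ℂ := aeval fun _ => Polynomial.X
  have h1 := (D.isZigzag_chart hs hz).map φ
  have h2 := (IsZigzag.eq_chart D (x := Polynomial.X) (y := Polynomial.X) h1 hs
    (fun u hu => by simp [chartA, hu]) (by simp [chartA, φ])
    (fun u hu _ => by simp [chartC, hu]) (by simp [chartC, φ])).2.2.2
  have h3 := D.natDegree_chartZ_pos hs h2 0 (Nat.zero_le _)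
  simp [h0] at h3

end ZigzagData

namespace ArrowQuiver

variable {V E : Type} [Fintype V] [DecidableEq V] (Q : ArrowQuiver V E)

/-! ### Evaluating representations -/

section Eval

variable {B : Type*} [CommRing B] [Algebra ℂ B] (q : E → B)

/-- The representation of dimension vector `(1,…,1)` with values in `B` given by a family of
scalars. -/
noncomputable def repHom : Q.PathAlgebra →ₐ[ℂ] Matrix V V B :=
  (MvPolynomial.aeval q).mapMatrix.comp Q.univRep

theorem repHom_apply (x : Q.PathAlgebra) (i j : V) :
    Q.repHom q x i j = MvPolynomial.aeval q (Q.univRep x i j) := rfl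

theorem repHom_vertex (v : V) : Q.repHom q (Q.vertex v) = Matrix.single v v 1 := by
  ext i j
  simp only [repHom_apply, univRep, vertex, RingQuot.liftAlgHom_mkAlgHom_apply, univRepAux,
    FreeAlgebra.lift_ι_apply, Sum.elim_inl, Matrix.single_apply]
  split_ifs <;> simp

theorem repHom_arrow (p : E) :
    Q.repHom q (Q.arrow p) = Matrix.single (Q.tail p) (Q.head p) (q p) := by
  ext i j
  simp only [repHom_apply, univRep, arrow, RingQuot.liftAlgHom_mkAlgHom_apply, univRepAux,
    FreeAlgebra.lift_ι_apply, Sum.elim_inr, Matrix.single_apply]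
  split_ifs <;> simp

variable (rel : Q.PathAlgebra → Q.PathAlgebra → Prop)

/-- A representation that respects the relations factors through the quotient algebra, so it kills
every element that vanishes there, not just the generating relations. -/
theorem aeval_eq_zero_of_mem_repIdeal (hq : ∀ x y, rel x y → Q.repHom q x = Q.repHom q y)
    (f : MvPolynomial E ℂ) (hf : f ∈ Q.repIdeal rel) : MvPolynomial.aeval q f = 0 := by
  have : Q.repIdeal rel ≤ RingHom.ker (MvPolynomial.aeval q : MvPolynomial E ℂ →ₐ[ℂ] B) := by
    refine Ideal.span_le.2 ?_
    rintro _ ⟨x, i, j, hx, rfl⟩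
    have h1 : Q.repHom q x = RingQuot.liftAlgHom ℂ (s := rel) ⟨Q.repHom q, @hq⟩
        (RingQuot.mkAlgHom ℂ rel x) := by
      rw [RingQuot.liftAlgHom_mkAlgHom_apply]
    rw [hx, map_zero] at h1
    change MvPolynomial.aeval q (Q.univRep x i j) = 0
    rw [← repHom_apply, h1, Matrix.zero_apply]
  exact this hf

/-- The homomorphism out of `ℂ[Rep(A,(1,…,1))]` given by a representation. -/
noncomputable def repLift (hq : ∀ x y, rel x y → Q.repHom q x = Q.repHom q y) :
    Q.RepRing rel →ₐ[ℂ] B :=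
  Ideal.Quotient.liftₐ (Q.repIdeal rel) (MvPolynomial.aeval q)
    (Q.aeval_eq_zero_of_mem_repIdeal q rel hq)

end Eval

variable (rel : Q.PathAlgebra → Q.PathAlgebra → Prop)

/-- The coordinate functions of the universal representation. -/
noncomputable def coord (p : E) : Q.RepRing rel :=
  Ideal.Quotient.mkₐ ℂ (Q.repIdeal rel) (MvPolynomial.X p)

theorem repLift_coord {B : Type*} [CommRing B] [Algebra ℂ B] (q : E → B)
    (hq : ∀ x y, rel x y → Q.repHom q x = Q.repHom q y) (p : E) :
    Q.repLift q rel hq (Q.coord rel p) = q p := by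
  change MvPolynomial.aeval q (MvPolynomial.X p) = q p
  rw [MvPolynomial.aeval_X]

theorem mk_eq_aeval_coord (f : MvPolynomial E ℂ) :
    Ideal.Quotient.mkₐ ℂ (Q.repIdeal rel) f = MvPolynomial.aeval (Q.coord rel) f := by
  have : Ideal.Quotient.mkₐ ℂ (Q.repIdeal rel) = MvPolynomial.aeval (Q.coord rel) :=
    MvPolynomial.algHom_ext fun p => by simp [coord]
  rw [this]

/-- The matrix entries of `x - y` are among the generators of the ideal. -/
theorem repHom_coord_rel {x y : Q.PathAlgebra} (h : rel x y) :
    Q.repHom (Q.coord rel) x = Q.repHom (Q.coord rel) y := by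
  ext i j
  rw [repHom_apply, repHom_apply, ← mk_eq_aeval_coord, ← mk_eq_aeval_coord, ← sub_eq_zero,
    ← map_sub]
  refine Ideal.Quotient.eq_zero_iff_mem.2 (Ideal.subset_span ⟨x - y, i, j, ?_, ?_⟩)
  · rw [map_sub, RingQuot.mkAlgHom_rel ℂ h, sub_self]
  · rw [map_sub, Matrix.sub_apply]

/-! ### Weights of monomials -/

/-- The weight of a monomial in the arrows: its net flow into each vertex. -/
def weight : (E →₀ ℕ) →+ (V → ℤ) where
  toFun d v := d.sum fun e k =>
    (k : ℤ) * ((if Q.head e = v then 1 else 0) - (if Q.tail e = v then 1 else 0))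
  map_zero' := by
    funext v
    rw [Finsupp.sum_zero_index, Pi.zero_apply]
  map_add' d d' := by
    funext v
    rw [Pi.add_apply]
    refine Finsupp.sum_add_index' (fun e => ?_) fun e k k' => ?_
    · simp
    · push_cast
      ring

theorem weight_single (e : E) (k : ℕ) (v : V) : Q.weight (Finsupp.single e k) v =
    k * ((if Q.head e = v then 1 else 0) - (if Q.tail e = v then 1 else 0)) := by
  simp only [weight, AddMonoidHom.coe_mk, ZeroHom.coe_mk]
  rw [Finsupp.sum_single_index (by simp)]

theorem prod_zpow_weight {M : Type*} [CommGroup M] (g : V → M) (d : E →₀ ℕ) :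
    ∏ v, g v ^ Q.weight d v = d.prod fun e k => ((g (Q.tail e))⁻¹ * g (Q.head e)) ^ k := by
  induction d using Finsupp.induction_linear with
  | zero => simp
  | add d d' h h' =>
    rw [Finsupp.prod_add_index' (by simp) fun e k k' => pow_add _ _ _, ← h, ← h',
      ← Finset.prod_mul_distrib]
    exact Finset.prod_congr rfl fun v _ => by rw [map_add, Pi.add_apply, zpow_add]
  | single e k =>
    rw [Finsupp.prod_single_index (by simp)]
    have : ∀ v, g v ^ Q.weight (Finsupp.single e k) v =
        (if Q.head e = v then g v ^ k else 1) * (if Q.tail e = v then (g v ^ k)⁻¹ else 1) := by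
      intro v
      rw [weight_single, mul_sub, sub_eq_add_neg, zpow_add]
      congr 1 <;> split_ifs <;> simp
    rw [Finset.prod_congr rfl fun v _ => this v, Finset.prod_mul_distrib, Finset.prod_ite_eq,
      Finset.prod_ite_eq]
    simp [mul_pow, mul_comm]

/-- A change of basis at the vertices multiplies a monomial by a character of its net flow. Over the
polynomial ring this computes the group action; over other rings it compares a representation with
its normal form in a chart. -/
theorem aeval_twist {B : Type*} [CommRing B] [Algebra ℂ B] (q : E → B) (G : V → Bˣ)
    (d : E →₀ ℕ) (t : ℂ) :
    MvPolynomial.aeval (fun e => G (Q.tail e) * q e * (↑(G (Q.head e))⁻¹ : B))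
      (MvPolynomial.monomial d t) =
    ((∏ v, G v ^ Q.weight d v : Bˣ)⁻¹ : Bˣ) * MvPolynomial.aeval q (MvPolynomial.monomial d t) := by
  rw [prod_zpow_weight, MvPolynomial.aeval_monomial, MvPolynomial.aeval_monomial, Finsupp.prod,
    Finsupp.prod, Finsupp.prod, ← Finset.prod_inv_distrib, Units.coe_prod, mul_left_comm,
    ← Finset.prod_mul_distrib]
  congr 1
  refine Finset.prod_congr rfl fun e _ => ?_
  rw [← inv_pow, mul_inv, inv_inv, Units.val_pow_eq_pow_val, ← mul_pow, Units.val_mul]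
  congr 1
  ring

theorem polyAct_monomial (μ : V → ℂˣ) (d : E →₀ ℕ) (t : ℂ) :
    Q.polyAct μ (MvPolynomial.monomial d t) =
      (character (Q.weight d) μ : ℂ) • MvPolynomial.monomial d t := by
  have h := Q.aeval_twist (B := MvPolynomial E ℂ) (MvPolynomial.X)
    (fun v => Units.map MvPolynomial.C.toMonoidHom (μ v)⁻¹) d t
  have h1 : (fun e => ((Units.map MvPolynomial.C.toMonoidHom (μ (Q.tail e))⁻¹ :
        (MvPolynomial E ℂ)ˣ) : MvPolynomial E ℂ) * MvPolynomial.X e *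
      (↑(Units.map MvPolynomial.C.toMonoidHom (μ (Q.head e))⁻¹ : (MvPolynomial E ℂ)ˣ)⁻¹ :
        MvPolynomial E ℂ)) = fun p =>
      MvPolynomial.C (((μ (Q.tail p))⁻¹ * μ (Q.head p) : ℂˣ) : ℂ) * MvPolynomial.X p := by
    funext e
    rw [← map_inv, inv_inv, Units.val_mul, MvPolynomial.C_mul]
    simp only [Units.coe_map]
    change MvPolynomial.C _ * _ * MvPolynomial.C _ = _
    ring
  rw [h1, MvPolynomial.aeval_X_left, AlgHom.id_apply] at h
  change MvPolynomial.aeval _ _ = _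
  rw [h, MvPolynomial.smul_eq_C_mul]
  congr 1
  simp only [character, ← map_zpow, ← map_prod, ← map_inv]
  simp only [inv_zpow, Finset.prod_inv_distrib, inv_inv]
  rfl

theorem act_monomial (μ : V → ℂˣ) (d : E →₀ ℕ) (t : ℂ) :
    Q.act rel μ (Ideal.Quotient.mkₐ ℂ (Q.repIdeal rel) (MvPolynomial.monomial d t)) =
      (character (Q.weight d) μ : ℂ) •
        Ideal.Quotient.mkₐ ℂ (Q.repIdeal rel) (MvPolynomial.monomial d t) := by
  rw [← map_smul, ← polyAct_monomial]
  rfl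

/-- The characters of the torus, with values in `ℂ`. -/
noncomputable def characterHom (w : V → ℤ) : (V → ℂˣ) →* ℂ :=
  (Units.coeHom ℂ).comp
    { toFun := character w
      map_one' := by simp [character]
      map_mul' := fun μ ν => by simp [character, mul_zpow, Finset.prod_mul_distrib] }

theorem characterHom_apply (w : V → ℤ) (μ : V → ℂˣ) : characterHom w μ = (character w μ : ℂ) := rfl

theorem characterHom_injective : Function.Injective (characterHom (V := V)) := by
  intro w w' h
  funext v
  -- The torus element that is `2` at `v` and `1` elsewhere reads off the exponent `w v`.
  have h1 := DFunLike.congr_fun h (Pi.mulSingle v (Units.mk0 2 two_ne_zero))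
  simp only [characterHom_apply, character] at h1
  rw [Finset.prod_eq_single v, Finset.prod_eq_single v] at h1
  · simp only [Pi.mulSingle_eq_same, Units.val_zpow_eq_zpow_val, Units.val_mk0] at h1
    have h2 : ((2 : ℝ) ^ w v) = 2 ^ w' v := by
      have e : ∀ N : ℤ, ((2 : ℂ) ^ N) = (((2 : ℝ) ^ N : ℝ) : ℂ) := by
        intro N
        push_cast
        rfl
      rw [e, e] at h1
      exact_mod_cast h1
    exact zpow_right_injective₀ (by norm_num) (by norm_num) h2
  · intro u _ hu
    simp [hu]
  · simp
  · intro u _ hu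
    simp [hu]
  · simp

/-- An eigenvector of the torus is a combination of monomials of the right weight. -/
theorem mem_span_of_act_eq {w : V → ℤ} {f : Q.RepRing rel}
    (hf : ∀ μ, Q.act rel μ f = (character w μ : ℂ) • f) :
    f ∈ Submodule.span ℂ {g | ∃ d, Q.weight d = w ∧
      g = Ideal.Quotient.mkₐ ℂ (Q.repIdeal rel) (MvPolynomial.monomial d 1)} := by
  classical
  obtain ⟨P, rfl⟩ := Ideal.Quotient.mkₐ_surjective ℂ (Q.repIdeal rel) f
  set mk := Ideal.Quotient.mkₐ ℂ (Q.repIdeal rel)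
  let F : (V → ℤ) → Q.RepRing rel := fun w' => ∑ d ∈ P.support with Q.weight d = w',
    mk (MvPolynomial.monomial d (P.coeff d))
  have hP : mk P = ∑ d ∈ P.support, mk (MvPolynomial.monomial d (P.coeff d)) := by
    rw [← map_sum]
    congr 1
    exact P.as_sum
  have hact : ∀ (d : E →₀ ℕ) (μ), Q.act rel μ (mk (MvPolynomial.monomial d (P.coeff d))) =
      (character (Q.weight d) μ : ℂ) • mk (MvPolynomial.monomial d (P.coeff d)) :=
    fun d μ => Q.act_monomial rel μ d _
  have hF : F w = mk P := by
    -- Monomials may be linearly dependent modulo the ideal, so coefficients cannot be compared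
    -- directly. A linear functional turns the eigenvector equation into a relation between
    -- characters of the torus, which are linearly independent.
    rw [← sub_eq_zero, ← Module.forall_dual_apply_eq_zero_iff ℂ]
    intro φ
    let W : Finset (V → ℤ) := insert w (P.support.image Q.weight)
    let t : (V → ℤ) → ℂ := fun w' => φ (F w') - if w' = w then φ (mk P) else 0
    have ht : ∑ w' ∈ W, t w' • (characterHom w' : (V → ℂˣ) → ℂ) = 0 := by
      funext μ
      have h1 : ∑ w' ∈ W, φ (F w') * (character w' μ : ℂ) = φ (Q.act rel μ (mk P)) := by
        rw [hP, map_sum, map_sum,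
          ← Finset.sum_fiberwise_of_maps_to (s := P.support) (t := W) (g := Q.weight)
            fun d hd => Finset.mem_insert_of_mem (Finset.mem_image_of_mem _ hd)]
        refine Finset.sum_congr rfl fun w' _ => ?_
        rw [map_sum, Finset.sum_mul]
        refine Finset.sum_congr rfl fun d hd => ?_
        rw [hact, map_smul, (Finset.mem_filter.1 hd).2, smul_eq_mul, mul_comm]
      rw [Finset.sum_apply]
      simp only [Pi.smul_apply, smul_eq_mul, Pi.zero_apply, characterHom_apply, t, sub_mul,
        Finset.sum_sub_distrib]
      rw [h1, hf, map_smul, smul_eq_mul, sub_eq_zero, Finset.sum_eq_single w]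
      · rw [if_pos rfl, mul_comm]
      · intro w' _ hw'
        rw [if_neg hw', zero_mul]
      · intro h
        exact absurd (Finset.mem_insert_self _ _) h
    have hli : LinearIndependent ℂ fun w : V → ℤ => (characterHom w : (V → ℂˣ) → ℂ) :=
      (linearIndependent_monoidHom (V → ℂˣ) ℂ).comp _ characterHom_injective
    have := linearIndependent_iff'.1 hli W t ht w (Finset.mem_insert_self _ _)
    simp only [t, if_true] at this
    rw [map_sub, this]
  rw [← hF]
  refine Submodule.sum_mem _ fun d hd => ?_
  have : MvPolynomial.monomial d (P.coeff d) = P.coeff d • MvPolynomial.monomial d (1 : ℂ) := by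
    rw [MvPolynomial.smul_monomial, smul_eq_mul, mul_one]
  rw [this, map_smul]
  exact Submodule.smul_mem _ _ (Submodule.subset_span ⟨d, (Finset.mem_filter.1 hd).2, rfl⟩)

theorem character_nsmul (θ : V → ℤ) (k : ℕ) (μ : V → ℂˣ) :
    character (k • θ) μ = character θ μ ^ k := by
  simp only [character, ← Finset.prod_pow]
  refine Finset.prod_congr rfl fun v _ => ?_
  rw [Pi.smul_apply, nsmul_eq_mul, mul_comm, zpow_mul, zpow_natCast]

theorem character_zero (μ : V → ℂˣ) : character (0 : V → ℤ) μ = 1 := by simp [character]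

theorem semiInvariants_eq_span (θ : V → ℤ) (k : ℕ) : Q.semiInvariants rel θ k =
    Submodule.span ℂ {g | ∃ d, Q.weight d = k • θ ∧
      g = Ideal.Quotient.mkₐ ℂ (Q.repIdeal rel) (MvPolynomial.monomial d 1)} := by
  apply le_antisymm
  · intro f hf
    refine Q.mem_span_of_act_eq rel fun μ => ?_
    rw [character_nsmul]
    exact hf μ
  · rw [Submodule.span_le]
    rintro _ ⟨d, hd, rfl⟩ μ
    rw [act_monomial, hd, character_nsmul]

theorem mem_invariants_iff (f : Q.RepRing rel) : f ∈ Q.invariants rel ↔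
    f ∈ Submodule.span ℂ {g | ∃ d, Q.weight d = 0 ∧
      g = Ideal.Quotient.mkₐ ℂ (Q.repIdeal rel) (MvPolynomial.monomial d 1)} := by
  constructor
  · intro hf
    refine Q.mem_span_of_act_eq rel fun μ => ?_
    rw [character_zero, Units.val_one, one_smul]
    exact hf μ
  · intro hf
    induction hf using Submodule.span_induction with
    | mem f hf =>
      obtain ⟨d, hd, rfl⟩ := hf
      intro μ
      rw [act_monomial, hd, character_zero, Units.val_one, one_smul]
    | zero => exact zero_mem _
    | add x y _ _ hx hy => exact add_mem hx hy
    | smul t x _ hx => exact Subalgebra.smul_mem _ hx t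

end ArrowQuiver

theorem IsZigzag.congr {D : ZigzagData} {B : Type*} [CommRing B] [Algebra ℂ B]
    {a c k z a' c' k' : ℕ → B} (h : IsZigzag D a c k z) (ha : ∀ u ≤ D.n, a' u = a u)
    (hc : ∀ u ≤ D.n, c' u = c u) (hk : ∀ j ≤ D.m, k' j = k j) : IsZigzag D a' c' k' z where
  k_zero := by rw [hk 0 (Nat.zero_le _), hc 0 (Nat.zero_le _), h.k_zero]
  k_last := by rw [hk _ le_rfl, ha _ le_rfl, h.k_last]
  clockwise j hj := by
    rw [hk j hj, ← h.clockwise j hj]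
    congr 1
    exact Finset.prod_congr rfl fun u hu => hc u (by have := Finset.mem_Ico.1 hu; omega)
  anticlockwise j hj := by
    rw [hk j hj, ← h.anticlockwise j hj]
    congr 1
    refine Finset.prod_congr rfl fun u hu => ha u ?_
    have := Finset.mem_range.1 hu
    have := D.l_le j
    omega
  pair u hu := by rw [ha u hu, hc u hu, h.pair u hu]
  z_gt := h.z_gt

namespace Recon

variable {n : ℕ} (α : Fin n → ℕ)

/-! ### The tails of the arrows `k` -/

theorem length_extraTails : (extraTails α).length = numExtra α := by
  simp [extraTails, numExtra, List.length_flatMap, ← List.ofFn_eq_map, List.sum_ofFn]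

theorem one_le_of_mem_extraTails {v : Fin (n + 1)} (hv : v ∈ extraTails α) : 1 ≤ (v : ℕ) := by
  obtain ⟨i, _, hi⟩ := List.mem_flatMap.1 hv
  rw [List.eq_of_mem_replicate hi]
  simp

theorem pairwise_extraTails : (extraTails α).Pairwise (· ≤ ·) := by
  rw [extraTails, List.pairwise_flatMap]
  refine ⟨fun i _ => List.pairwise_replicate.2 (Or.inr le_rfl), ?_⟩
  refine (List.pairwise_lt_finRange n).imp ?_
  intro i j hij x hx y hy
  rw [List.eq_of_mem_replicate hx, List.eq_of_mem_replicate hy]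
  exact Fin.succ_le_succ_iff.2 hij.le

theorem one_le_kTail (hn : 1 ≤ n) (h : ℕ) : 1 ≤ (kTail α h : ℕ) := by
  unfold kTail
  split_ifs with h0
  · obtain ⟨n, rfl⟩ : ∃ n', n = n' + 1 := ⟨n - 1, by omega⟩
    simp
  · rcases lt_or_ge (h - 1) (extraTails α).length with hl | hl
    · rw [List.getD_eq_getElem _ _ hl]
      exact one_le_of_mem_extraTails α (List.getElem_mem hl)
    · rw [List.getD_eq_default _ _ hl]
      simpa using hn

theorem kTail_zero (hn : 1 ≤ n) : (kTail α 0 : ℕ) = 1 := by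
  obtain ⟨n, rfl⟩ : ∃ n', n = n' + 1 := ⟨n - 1, by omega⟩
  simp [kTail]

theorem kTail_of_numExtra_lt {h : ℕ} (hh : numExtra α < h) : kTail α h = Fin.last n := by
  rw [kTail, if_neg (by omega), List.getD_eq_default]
  rw [length_extraTails]
  omega

theorem kTail_mono (hn : 1 ≤ n) : Monotone fun h => (kTail α h : ℕ) := by
  intro h h' hh
  rcases Nat.eq_zero_or_pos h with rfl | h0
  · simp only [kTail_zero α hn]
    exact one_le_kTail α hn h'
  · simp only [kTail]
    rw [if_neg (by omega), if_neg (by omega)]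
    rcases lt_or_ge (h' - 1) (extraTails α).length with hl | hl
    · rw [List.getD_eq_getElem _ _ hl, List.getD_eq_getElem _ _ (by omega)]
      rcases (show h - 1 ≤ h' - 1 by omega).eq_or_lt with he | he
      · simp [he]
      · exact List.pairwise_iff_getElem.1 (pairwise_extraTails α) _ _ _ _ he
    · rw [List.getD_eq_default _ _ hl]
      exact Nat.lt_succ_iff.1 (Fin.is_lt _)

/-- The sum of the first parameters of the step `i`, up to the vertex `v`. -/
noncomputable def partialSum (lam : ℕ → ℕ → ℂ) (i v : ℕ) : ℂ :=
  ∑ t ∈ Finset.range (v + 1 - kTail α (i - 1)), lam i (t + 1)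

theorem exists_lt_kTail {u : ℕ} (hu : u < n) : ∃ j, u < (kTail α j : ℕ) :=
  ⟨numExtra α + 1, by rw [kTail_of_numExtra_lt α (Nat.lt_succ_self _)]; simpa using hu⟩

/-- The number of the step that contains the `2`-cycle at `u`, `u + 1`. -/
noncomputable def stepIndex (u : ℕ) : ℕ :=
  -- For `u = 0` the search stops at `j = 0`, because `l_0 = 1`; the maximum puts this `2`-cycle
  -- into the step `1`.
  if hu : u < n then max 1 (Nat.find (exists_lt_kTail α hu)) else 1 + numExtra α

theorem lt_kTail_iff (hn : 1 ≤ n) {u : ℕ} (hu : u < n) {j : ℕ} (hj : 1 ≤ j) :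
    u < (kTail α j : ℕ) ↔ stepIndex α u ≤ j := by
  rw [stepIndex, dif_pos hu, max_le_iff, Nat.find_le_iff]
  constructor
  · exact fun h => ⟨hj, j, le_rfl, h⟩
  · rintro ⟨_, i, hi, h⟩
    exact h.trans_le (kTail_mono α hn hi)

/-- The zigzag data of a deformed reconstruction algebra. -/
noncomputable def zigzagData (hn : 1 ≤ n) (lam : ℕ → ℕ → ℂ) : ZigzagData where
  n := n
  m := 1 + numExtra α
  l h := kTail α h
  ι := stepIndex α
  η u := if u = 0 then 0 else partialSum α lam (stepIndex α u) u
  -- There is no step `0`: `k_0 C_{01}` is the full clockwise cycle `z 0` itself.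
  ε j := if j = 0 then 0 else partialSum α lam j (kTail α j)
  l_zero := kTail_zero α hn
  l_last := by rw [kTail_of_numExtra_lt α (by omega), Fin.val_last]
  l_mono := kTail_mono α hn
  l_le j := Nat.lt_succ_iff.1 (Fin.is_lt _)
  ι_pos u _ := by
    unfold stepIndex
    split_ifs <;> omega
  ι_le u _ := by
    rcases lt_or_ge u n with h | h
    · rw [← lt_kTail_iff α hn h (by omega), kTail_of_numExtra_lt α (by omega)]
      simpa using h
    · rw [stepIndex, dif_neg (by omega)]
  ι_zero := by
    apply le_antisymm
    · rw [← lt_kTail_iff α hn (by omega) le_rfl]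
      exact one_le_kTail α hn 1
    · rw [stepIndex, dif_pos (by omega)]
      exact le_max_left _ _
  ι_last := by rw [stepIndex, dif_neg (lt_irrefl _)]
  lt_l_iff u hu j hj := lt_kTail_iff α hn hu hj
  η_zero := if_pos rfl
  ε_zero := if_pos rfl
  η_last := by
    rw [if_neg (by omega), if_neg (by omega), stepIndex, dif_neg (lt_irrefl _),
      kTail_of_numExtra_lt α (by omega), Fin.val_last]

/-! ### The relations in terms of the values of the arrows -/

section Values

variable {B : Type*} [CommRing B] [Algebra ℂ B] (q : Arrow n (numExtra α) → B)

/-- The value of the arrow `u ⟶ u + 1`. -/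
def aVal (u : ℕ) : B := q (.a (Fin.ofNat (n + 1) u))

/-- The value of the arrow `u + 1 ⟶ u`. -/
def cVal (u : ℕ) : B := q (.c (Fin.ofNat (n + 1) (u + 1)))

/-- The value of the arrow `k_j`. -/
def kVal (j : ℕ) : B := q (kArrow α j)

/-- The values of the cycles through the vertex `0`. -/
def zVal (j : ℕ) : B :=
  if j = 0 then ∏ u ∈ Finset.range (n + 1), cVal α q u
  else if j ≤ 1 + numExtra α + 1 then
    kVal α q (j - 1) * ∏ u ∈ Finset.range (kTail α (j - 1)), aVal α q u
  else 0

theorem ofNat_add_one (u : ℕ) : Fin.ofNat (n + 1) u + 1 = Fin.ofNat (n + 1) (u + 1) := by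
  ext
  simp [Fin.val_add]

theorem ofNat_val (v : Fin (n + 1)) : Fin.ofNat (n + 1) v = v := by
  ext
  simp

theorem ofNat_zero : Fin.ofNat (n + 1) 0 = 0 := rfl

theorem ofNat_succ_self : Fin.ofNat (n + 1) (n + 1) = 0 := by
  ext
  simp

theorem tail_kArrow {h : ℕ} (hh : h ≤ 1 + numExtra α) :
    (quiver α).tail (kArrow α h) = kTail α h := by
  unfold kArrow
  split_ifs with h0 h1
  · subst h0
    simp [quiver, kTail]
  · simp only [quiver]
    rw [Nat.sub_add_cancel (by omega)]
  · simp only [quiver]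
    rw [kTail_of_numExtra_lt α (by omega)]

theorem head_kArrow (h : ℕ) : (quiver α).head (kArrow α h) = 0 := by
  unfold kArrow
  split_ifs with h0 h1
  · simp [quiver]
  · rfl
  · simp [quiver]

theorem repHom_aPath (u : ℕ) : (quiver α).repHom q (aPath α (Fin.ofNat (n + 1) u)) =
    Matrix.single (Fin.ofNat (n + 1) u) (Fin.ofNat (n + 1) (u + 1)) (aVal α q u) := by
  rw [aPath, ArrowQuiver.repHom_arrow, ← ofNat_add_one]
  rfl

theorem repHom_cPath (u : ℕ) : (quiver α).repHom q (cPath α (Fin.ofNat (n + 1) (u + 1))) =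
    Matrix.single (Fin.ofNat (n + 1) (u + 1)) (Fin.ofNat (n + 1) u) (cVal α q u) := by
  rw [cPath, ArrowQuiver.repHom_arrow]
  refine congrArg (fun j => Matrix.single _ j _) ?_
  change Fin.ofNat (n + 1) (u + 1) - 1 = _
  rw [← ofNat_add_one, add_sub_cancel_right]

theorem repHom_kPath {h : ℕ} (hh : h ≤ 1 + numExtra α) :
    (quiver α).repHom q (kPath α h) = Matrix.single (kTail α h) 0 (kVal α q h) := by
  rw [kPath, ArrowQuiver.repHom_arrow, tail_kArrow α hh, head_kArrow]
  rfl

theorem finRange_eq : List.finRange (n + 1) = (List.range (n + 1)).map (Fin.ofNat (n + 1)) := by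
  apply List.ext_getElem
  · simp
  · intro i h1 h2
    ext
    simp only [List.length_finRange] at h1
    simp [Nat.mod_eq_of_lt h1]

theorem range_eq_append {w N : ℕ} (h : w ≤ N) :
    List.range N = List.range w ++ List.range' w (N - w) := by
  have := List.range'_append_1 (s := 0) (m := w) (n := N - w)
  rw [zero_add, Nat.add_sub_cancel' h] at this
  rw [List.range_eq_range', List.range_eq_range', this]

theorem filter_lt_finRange (v : Fin (n + 1)) : (List.finRange (n + 1)).filter (· < v) =
    (List.range v).map (Fin.ofNat (n + 1)) := by
  have hv := v.is_lt
  rw [finRange_eq, List.filter_map, range_eq_append hv.le, List.filter_append,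
    List.filter_eq_self.2, List.filter_eq_nil_iff.2, List.append_nil]
  · intro x hx
    simp only [List.mem_range'_1] at hx
    simp only [Function.comp_apply, Fin.lt_def, Fin.val_ofNat, Nat.mod_eq_of_lt
      (show x < n + 1 by omega), decide_eq_true_eq]
    omega
  · intro x hx
    simp only [List.mem_range] at hx
    simp only [Function.comp_apply, Fin.lt_def, Fin.val_ofNat, Nat.mod_eq_of_lt
      (show x < n + 1 by omega), decide_eq_true_eq]
    omega

theorem filter_gt_finRange (v : Fin (n + 1)) : (List.finRange (n + 1)).filter (v < ·) =
    (List.range' (v + 1) (n - v)).map (Fin.ofNat (n + 1)) := by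
  have hv := v.is_lt
  rw [finRange_eq, List.filter_map, range_eq_append (Nat.succ_le_of_lt hv), Nat.succ_eq_add_one,
    Nat.add_sub_add_right, List.filter_append, List.filter_eq_nil_iff.2,
    List.filter_eq_self.2, List.nil_append]
  · intro x hx
    simp only [List.mem_range'_1] at hx
    simp only [Function.comp_apply, Fin.lt_def, Fin.val_ofNat, Nat.mod_eq_of_lt
      (show x < n + 1 by omega), decide_eq_true_eq]
    omega
  · intro x hx
    simp only [List.mem_range] at hx
    simp only [Function.comp_apply, Fin.lt_def, Fin.val_ofNat, Nat.mod_eq_of_lt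
      (show x < n + 1 by omega), decide_eq_true_eq]
    omega

theorem repHom_anticlockwise {v : Fin (n + 1)} (hv : 1 ≤ (v : ℕ)) :
    (quiver α).repHom q (anticlockwise α v) =
      Matrix.single 0 v (∏ u ∈ Finset.range v, aVal α q u) := by
  have key : ∀ t : ℕ, (quiver α).repHom q
      (((List.range (t + 1)).map (aPath α ∘ Fin.ofNat (n + 1))).prod) =
        Matrix.single 0 (Fin.ofNat (n + 1) (t + 1)) (∏ u ∈ Finset.range (t + 1), aVal α q u) := by
    intro t
    induction t with
    | zero =>
      simp only [zero_add, List.range_one, List.map_cons, List.map_nil, List.prod_singleton,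
        Function.comp_apply, Finset.prod_range_one]
      exact repHom_aPath α q 0
    | succ t ih =>
      rw [List.range_succ, List.map_append, List.prod_append, map_mul, ih, List.map_singleton,
        List.prod_singleton, Function.comp_apply, repHom_aPath, Matrix.single_mul_single_same,
        ← Finset.prod_range_succ]
  rw [anticlockwise, filter_lt_finRange, List.map_map]
  obtain ⟨t, ht⟩ : ∃ t, (v : ℕ) = t + 1 := ⟨v - 1, by omega⟩
  have := key t
  rw [← ht, ofNat_val] at this
  exact this

theorem repHom_clockwise (v : Fin (n + 1)) :
    (quiver α).repHom q (clockwise α v) =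
      Matrix.single 0 v (∏ u ∈ Finset.Ico (v : ℕ) (n + 1), cVal α q u) := by
  have key : ∀ t v : ℕ, v + t = n → (quiver α).repHom q (cPath α 0 *
      ((List.range' (v + 1) t).reverse.map (cPath α ∘ Fin.ofNat (n + 1))).prod) =
        Matrix.single 0 (Fin.ofNat (n + 1) v) (∏ u ∈ Finset.Ico v (n + 1), cVal α q u) := by
    intro t
    induction t with
    | zero =>
      intro v hv
      have := repHom_cPath α q n
      rw [ofNat_succ_self] at this
      rw [show v = n by omega]
      simpa using this
    | succ t ih =>
      intro v hv
      rw [List.range'_succ, List.reverse_cons, List.map_append, List.prod_append, ← mul_assoc,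
        map_mul, ih (v + 1) (by omega), List.map_singleton, List.prod_singleton,
        Function.comp_apply, repHom_cPath, Matrix.single_mul_single_same, mul_comm,
        ← Finset.prod_eq_prod_Ico_succ_bot (by omega)]
  have h1 := key (n - v) v (by omega)
  rw [ofNat_val] at h1
  rw [← h1, clockwise, filter_gt_finRange, ← List.map_reverse, List.map_map]

/-- The values of the first cycles. -/
def upperVal (i v : ℕ) : B :=
  if v = kTail α i then kVal α q i * ∏ u ∈ Finset.Ico v (n + 1), cVal α q u
  else aVal α q v * cVal α q v

/-- The values of the second cycles. -/
def lowerVal (i v : ℕ) : B :=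
  if v = kTail α (i - 1) then kVal α q (i - 1) * ∏ u ∈ Finset.range v, aVal α q u
  else cVal α q (v - 1) * aVal α q (v - 1)

theorem repHom_upperCycle {i : ℕ} (hi : i ≤ 1 + numExtra α) (v : Fin (n + 1)) :
    (quiver α).repHom q (upperCycle α i v) = Matrix.single v v (upperVal α q i v) := by
  unfold upperCycle upperVal
  by_cases h : v = kTail α i
  · rw [if_pos h, if_pos (congrArg Fin.val h), map_mul, repHom_kPath α q hi, repHom_clockwise,
      Matrix.single_mul_single_same, h]
  · rw [if_neg h, if_neg fun h' => h (Fin.ext h'), map_mul]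
    have h1 := repHom_aPath α q v
    have h2 := repHom_cPath α q v
    rw [← ofNat_add_one, ofNat_val] at h1 h2
    rw [h1, h2, Matrix.single_mul_single_same]

theorem repHom_lowerCycle (hn : 1 ≤ n) {i : ℕ} (h1 : 1 ≤ i) (hi : i ≤ 1 + numExtra α)
    {v : Fin (n + 1)} (hv : kTail α (i - 1) ≤ v) :
    (quiver α).repHom q (lowerCycle α i v) = Matrix.single v v (lowerVal α q i v) := by
  have hv1 : 1 ≤ (v : ℕ) := (one_le_kTail α hn (i - 1)).trans (Fin.le_def.1 hv)
  unfold lowerCycle lowerVal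
  by_cases h : v = kTail α (i - 1)
  · rw [if_pos h, if_pos (congrArg Fin.val h), map_mul, repHom_kPath α q (by omega),
      repHom_anticlockwise α q hv1, Matrix.single_mul_single_same, h]
  · rw [if_neg h, if_neg fun h' => h (Fin.ext h'), map_mul]
    have h2 := repHom_aPath α q (v - 1)
    have h3 := repHom_cPath α q (v - 1)
    have h4 : Fin.ofNat (n + 1) ((v : ℕ) - 1) = v - 1 := by
      rw [eq_sub_iff_add_eq, ofNat_add_one, Nat.sub_add_cancel hv1, ofNat_val]
    rw [Nat.sub_add_cancel hv1, ofNat_val, h4] at h2 h3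
    rw [h2, h3, Matrix.single_mul_single_same]

variable (lam : ℕ → ℕ → ℂ)

theorem single_sub_single_eq_iff {ι R : Type*} [DecidableEq ι] [AddGroup R] (v : ι) (x y t : R) :
    Matrix.single v v x - Matrix.single v v y = Matrix.single v v t ↔ x - y = t := by
  constructor
  · intro h
    have := congrFun (congrFun h v) v
    simpa using this
  · rintro rfl
    ext i j
    simp only [Matrix.sub_apply, Matrix.single_apply]
    split_ifs <;> simp

theorem repHom_smul_vertex (t : ℂ) (v : Fin (n + 1)) :
    (quiver α).repHom q (t • (quiver α).vertex v) = Matrix.single v v (algebraMap ℂ B t) := by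
  rw [map_smul, ArrowQuiver.repHom_vertex, Matrix.smul_single, Algebra.algebraMap_eq_smul_one]

theorem stepRel_iff (hn : 1 ≤ n) :
    (∀ x y, StepRel α lam x y → (quiver α).repHom q x = (quiver α).repHom q y) ↔
      (∀ i, 1 ≤ i → i ≤ 1 + numExtra α → ∀ v : ℕ, (kTail α (i - 1) : ℕ) ≤ v → v ≤ kTail α i →
        upperVal α q i v - lowerVal α q i v =
          algebraMap ℂ B (lam i (v - kTail α (i - 1) + 1))) ∧
      ∀ i, 1 ≤ i → i ≤ 1 + numExtra α →
        (∏ u ∈ Finset.range (kTail α (i - 1)), aVal α q u) * kVal α q (i - 1) -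
          (∏ u ∈ Finset.Ico (kTail α i : ℕ) (n + 1), cVal α q u) * kVal α q i =
            algebraMap ℂ B (lam i 0) := by
  have hcyc : ∀ i, 1 ≤ i → i ≤ 1 + numExtra α → ∀ v : Fin (n + 1), kTail α (i - 1) ≤ v →
      ((quiver α).repHom q (upperCycle α i v - lowerCycle α i v) = (quiver α).repHom q
        (lam i ((v : ℕ) - (kTail α (i - 1) : ℕ) + 1) • (quiver α).vertex v) ↔
      upperVal α q i v - lowerVal α q i v =
          algebraMap ℂ B (lam i (v - kTail α (i - 1) + 1))) := by
    intro i h1 hi v hl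
    rw [map_sub, repHom_upperCycle α q hi, repHom_lowerCycle α q hn h1 hi hl,
      repHom_smul_vertex, single_sub_single_eq_iff]
  have hzero : ∀ i, 1 ≤ i → i ≤ 1 + numExtra α →
      ((quiver α).repHom q (anticlockwise α (kTail α (i - 1)) * kPath α (i - 1)
          - clockwise α (kTail α i) * kPath α i) =
        (quiver α).repHom q (lam i 0 • (quiver α).vertex 0) ↔
      (∏ u ∈ Finset.range (kTail α (i - 1)), aVal α q u) * kVal α q (i - 1) -
          (∏ u ∈ Finset.Ico (kTail α i : ℕ) (n + 1), cVal α q u) * kVal α q i =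
            algebraMap ℂ B (lam i 0)) := by
    intro i h1 hi
    rw [map_sub, map_mul, map_mul, repHom_anticlockwise α q (one_le_kTail α hn _),
      repHom_clockwise, repHom_kPath α q (by omega), repHom_kPath α q hi,
      Matrix.single_mul_single_same, Matrix.single_mul_single_same, repHom_smul_vertex,
      single_sub_single_eq_iff]
  constructor
  · refine fun h => ⟨fun i h1 hi v hl hu => ?_, fun i h1 hi =>
      (hzero i h1 hi).1 (h _ _ (.zero i h1 hi))⟩
    exact (hcyc i h1 hi ⟨v, hu.trans_lt (Fin.is_lt _)⟩ hl).1 (h _ _ (.cycle i h1 hi _ hl hu))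
  · rintro ⟨h1, h2⟩ x y (⟨i, hi1, hi, v, hl, hu⟩ | ⟨i, hi1, hi⟩)
    · exact (hcyc i hi1 hi v hl).2 (h1 i hi1 hi v hl hu)
    · exact (hzero i hi1 hi).2 (h2 i hi1 hi)

theorem kVal_zero : kVal α q 0 = cVal α q 0 := by
  simp only [kVal, cVal, kArrow, if_true]
  congr 2

theorem kVal_last : kVal α q (1 + numExtra α) = aVal α q n := by
  rw [kVal, aVal, kArrow, if_neg (by omega), dif_neg (by omega)]
  congr 2
  ext
  simp

theorem partialSum_succ {i v : ℕ} (hv : (kTail α (i - 1) : ℕ) ≤ v) :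
    partialSum α lam i v = partialSum α lam i (v - 1) + lam i (v - kTail α (i - 1) + 1) ∨ v = 0 := by
  rcases Nat.eq_zero_or_pos v with h | h
  · exact Or.inr h
  · left
    rw [partialSum, partialSum, show v + 1 - (kTail α (i - 1) : ℕ) = v - kTail α (i - 1) + 1 by omega,
      Finset.sum_range_succ, Nat.sub_add_cancel h]

/-- The representations of a deformed reconstruction algebra are zigzags. -/
theorem isZigzag_of_stepRel (hn : 1 ≤ n)
    (h : ∀ x y, StepRel α lam x y → (quiver α).repHom q x = (quiver α).repHom q y) :
    IsZigzag (zigzagData α hn lam) (aVal α q) (cVal α q) (kVal α q) (zVal α q) := by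
  obtain ⟨h1, -⟩ := (stepRel_iff α q lam hn).1 h
  have hz : ∀ j ≤ 1 + numExtra α, zVal α q (j + 1) =
      kVal α q j * ∏ u ∈ Finset.range (kTail α j), aVal α q u := by
    intro j hj
    rw [zVal, if_neg (by omega), if_pos (by omega), Nat.add_sub_cancel]
  -- Within one step each relation adds one parameter to the preceding cycle, starting from `k_j
  -- A_{0l_j} = z_{j+1}` at the vertex `l_j`. So the constants are partial sums.
  have key : ∀ j < 1 + numExtra α, ∀ v, (kTail α j : ℕ) ≤ v → v ≤ kTail α (j + 1) →
      upperVal α q (j + 1) v = zVal α q (j + 1) + algebraMap ℂ B (partialSum α lam (j + 1) v) := by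
    intro j hj v hl
    induction v, hl using Nat.le_induction with
    | base =>
      intro hu
      have h2 := h1 (j + 1) (by omega) (by omega) _ le_rfl hu
      rw [lowerVal, if_pos rfl, Nat.add_sub_cancel, ← hz j hj.le] at h2
      rw [eq_add_of_sub_eq' h2, partialSum, Nat.add_sub_cancel, Nat.add_sub_cancel_left,
        Finset.sum_range_one, Nat.sub_self]
    | succ v hl ih =>
      intro hu
      have h2 := h1 (j + 1) (by omega) (by omega) (v + 1) (by rw [Nat.add_sub_cancel]; omega) hu
      have h3 := ih (by omega)
      rw [upperVal, if_neg (by omega)] at h3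
      rw [lowerVal, Nat.add_sub_cancel, Nat.add_sub_cancel, if_neg (by omega),
        mul_comm, h3] at h2
      rw [eq_add_of_sub_eq' h2]
      have h4 := (partialSum_succ α lam (i := j + 1) (v := v + 1)
        (by rw [Nat.add_sub_cancel]; omega)).resolve_right (by omega)
      rw [h4, Nat.add_sub_cancel, Nat.add_sub_cancel, map_add, add_assoc]
  have hclock : ∀ j ≤ 1 + numExtra α,
      kVal α q j * ∏ u ∈ Finset.Ico (kTail α j : ℕ) (n + 1), cVal α q u =
        zVal α q j + algebraMap ℂ B ((zigzagData α hn lam).ε j) := by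
    intro j hj
    cases j with
    | zero =>
      rw [ZigzagData.ε_zero, map_zero, add_zero, kTail_zero α hn, zVal, if_pos rfl, kVal_zero,
        Finset.range_eq_Ico, Finset.prod_eq_prod_Ico_succ_bot (Nat.succ_pos _)]
    | succ j =>
      have h2 := key j (by omega) _ (kTail_mono α hn (Nat.le_succ j)) le_rfl
      rw [upperVal, if_pos rfl] at h2
      rw [h2]
      rfl
  refine ⟨kVal_zero α q, kVal_last α q, hclock, fun j hj => (hz j hj).symm, fun u hu => ?_,
    fun j hj => ?_⟩
  · rcases Nat.eq_zero_or_pos u with rfl | hu0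
    · rw [ZigzagData.ι_zero, ZigzagData.η_zero, map_zero, add_zero, hz 0 (Nat.zero_le _),
        kTail_zero α hn, Finset.prod_range_one, kVal_zero, mul_comm]
    · rcases (show u ≤ n from hu).eq_or_lt with hun | hun
      · have h2 := hclock _ le_rfl
        rw [hun, show (zigzagData α hn lam).ι n = _ from ZigzagData.ι_last _,
          show (zigzagData α hn lam).η n = _ from ZigzagData.η_last _]
        refine Eq.trans ?_ h2
        rw [kVal_last, kTail_of_numExtra_lt α (by omega), Fin.val_last]
        rw [Nat.Ico_succ_singleton, Finset.prod_singleton]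
      · set D := zigzagData α hn lam with hD
        have h3 := D.ι_pos u hun.le
        obtain ⟨j, hj⟩ : ∃ j, D.ι u = j + 1 := ⟨D.ι u - 1, by omega⟩
        have h4 : u < D.l (j + 1) := (D.lt_l_iff u hun (j + 1) (by omega)).2 hj.le
        have h5 : D.l j ≤ u := by
          rcases Nat.eq_zero_or_pos j with rfl | hj0
          · rw [D.l_zero]
            exact hu0
          · by_contra! hc
            have := D.ι_le_of_lt_l hj0 hc
            omega
        have h6 : j + 1 ≤ D.m := hj ▸ D.ι_le u hun.le
        have h7 := key j (Nat.lt_of_succ_le h6) u h5 h4.le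
        rw [upperVal, if_neg (show u ≠ kTail α (j + 1) from ne_of_lt h4)] at h7
        have h8 : D.η u = partialSum α lam (j + 1) u := by
          rw [← hj]
          exact if_neg (by omega)
        rw [h7, hj, h8]
  · rw [zVal, if_neg (by omega), if_neg (by
      change 1 + numExtra α + 1 < j at hj
      omega)]

/-- A zigzag is a representation of the deformed reconstruction algebra. -/
theorem stepRel_of_isZigzag (hn : 1 ≤ n)
    (hΔ : ∀ j ≤ numExtra α,
      ∑ t ∈ Finset.range ((kTail α (j + 1) : ℕ) - kTail α j + 2), lam (j + 1) t = 0)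
    {z : ℕ → B}
    (h : IsZigzag (zigzagData α hn lam) (aVal α q) (cVal α q) (kVal α q) z) :
    ∀ x y, StepRel α lam x y → (quiver α).repHom q x = (quiver α).repHom q y := by
  rw [stepRel_iff α q lam hn]
  set D := zigzagData α hn lam with hD
  have hA : ∀ j ≤ 1 + numExtra α,
      kVal α q j * ∏ u ∈ Finset.range (kTail α j), aVal α q u = z (j + 1) := h.anticlockwise
  have hC : ∀ j < 1 + numExtra α,
      kVal α q (j + 1) * ∏ u ∈ Finset.Ico (kTail α (j + 1) : ℕ) (n + 1), cVal α q u =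
        z (j + 1) + algebraMap ℂ B (partialSum α lam (j + 1) (kTail α (j + 1))) :=
    fun j hj => h.clockwise (j + 1) hj
  have hp : ∀ j < 1 + numExtra α, ∀ v, (kTail α j : ℕ) ≤ v → v < kTail α (j + 1) →
      aVal α q v * cVal α q v = z (j + 1) + algebraMap ℂ B (partialSum α lam (j + 1) v) := by
    intro j hj v hl hu
    have hvn : v < n := hu.trans_le (D.l_le (j + 1))
    have hv1 := one_le_kTail α hn j
    have h1 : D.ι v = j + 1 := by
      have h1 := D.lt_ι_of_l_le hvn hl
      have h2 := D.ι_le_of_lt_l (Nat.succ_pos j) hu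
      omega
    have h2 : D.η v = partialSum α lam (D.ι v) v := if_neg (by omega)
    rw [← h1, ← h2]
    exact h.pair v hvn.le
  refine ⟨fun i h1 hi v hl hu => ?_, fun i h1 hi => ?_⟩
  · obtain ⟨j, rfl⟩ : ∃ j, i = j + 1 := ⟨i - 1, by omega⟩
    rw [Nat.add_sub_cancel] at hl ⊢
    have hv1 := (one_le_kTail α hn j).trans hl
    have hU : upperVal α q (j + 1) v =
        z (j + 1) + algebraMap ℂ B (partialSum α lam (j + 1) v) := by
      unfold upperVal
      split_ifs with h2
      · rw [h2]
        exact hC j (by omega)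
      · exact hp j (by omega) v hl (by omega)
    have hL : lowerVal α q (j + 1) v =
        z (j + 1) + algebraMap ℂ B (partialSum α lam (j + 1) (v - 1)) := by
      unfold lowerVal
      rw [Nat.add_sub_cancel]
      split_ifs with h2
      · rw [h2, hA j (by omega), partialSum, Nat.add_sub_cancel,
          Nat.sub_add_cancel (one_le_kTail α hn j), Nat.sub_self, Finset.sum_range_zero, map_zero,
          add_zero]
      · rw [mul_comm]
        exact hp j (by omega) (v - 1) (by omega) (by omega)
    have h3 := (partialSum_succ α lam (i := j + 1) (v := v)
      (by rwa [Nat.add_sub_cancel])).resolve_right (by omega)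
    rw [Nat.add_sub_cancel] at h3
    rw [hU, hL, h3, map_add]
    ring
  · obtain ⟨j, rfl⟩ : ∃ j, i = j + 1 := ⟨i - 1, by omega⟩
    rw [Nat.add_sub_cancel, mul_comm, hA j (by omega), mul_comm, hC j (by omega)]
    -- With `λ_{i,0}` split off, the vanishing sum says that the last partial sum of the step is
    -- `-λ_{i,0}`, which is the relation at the vertex `0`.
    have h2 := hΔ j (by omega)
    have h3 := kTail_mono α hn (Nat.le_succ j)
    simp only [Nat.succ_eq_add_one] at h3
    rw [Finset.sum_range_succ'] at h2
    rw [partialSum, Nat.add_sub_cancel, show (kTail α (j + 1) : ℕ) + 1 - kTail α j =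
      kTail α (j + 1) - kTail α j + 1 by omega, eq_neg_of_add_eq_zero_left h2, map_neg]
    ring

/-! ### The representation of a zigzag -/

variable (a c k : ℕ → B)

/-- The family of scalars given by the sequences of values of the arrows. -/
def arrowVal : Arrow n (numExtra α) → B
  | .a v => a v
  -- The index of the arrow `v ⟶ v - 1` is its head: `n` for `v = 0`, and `v - 1` otherwise.
  | .c v => c ((v : ℕ) + n - if (v : ℕ) = 0 then 0 else n + 1)
  | .k j => k (j + 1)

theorem aVal_arrowVal {u : ℕ} (hu : u ≤ n) : aVal α (arrowVal α a c k) u = a u := by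
  simp [aVal, arrowVal, Nat.mod_eq_of_lt (Nat.lt_succ_of_le hu)]

theorem cVal_arrowVal {u : ℕ} (hu : u ≤ n) : cVal α (arrowVal α a c k) u = c u := by
  simp only [cVal, arrowVal, Fin.val_ofNat]
  congr 1
  rcases hu.eq_or_lt with rfl | hu
  · simp
  · simp only [Nat.mod_eq_of_lt (show u + 1 < n + 1 by omega), Nat.succ_ne_zero, if_false]
    omega

theorem kVal_arrowVal (h0 : k 0 = c 0) (hm : k (1 + numExtra α) = a n) {j : ℕ}
    (hj : j ≤ 1 + numExtra α) : kVal α (arrowVal α a c k) j = k j := by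
  rcases Nat.eq_zero_or_pos j with rfl | h1
  · rw [kVal_zero, cVal_arrowVal α a c k (Nat.zero_le _), h0]
  · rcases hj.eq_or_lt with rfl | h2
    · rw [kVal_last, aVal_arrowVal α a c k le_rfl, hm]
    · rw [kVal, kArrow, if_neg (by omega), dif_pos (by omega)]
      simp only [arrowVal]
      rw [Nat.sub_add_cancel h1]

end Values

end Recon

/-! ### Monomials in the coordinate ring and the cut inequality for flows. -/

namespace ArrowQuiver

variable {V E : Type} [Fintype V] [DecidableEq V] (Q : ArrowQuiver V E)
  (rel : Q.PathAlgebra → Q.PathAlgebra → Prop)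

/-- The class of a monomial in the coordinate ring of the representation scheme. -/
noncomputable def mon (d : E →₀ ℕ) : Q.RepRing rel :=
  Ideal.Quotient.mkₐ ℂ (Q.repIdeal rel) (MvPolynomial.monomial d 1)

theorem mon_add (d d' : E →₀ ℕ) : Q.mon rel (d + d') = Q.mon rel d * Q.mon rel d' := by
  rw [mon, mon, mon, ← map_mul, MvPolynomial.monomial_mul, one_mul]

theorem mon_zero : Q.mon rel 0 = 1 := map_one _

theorem mon_single (e : E) : Q.mon rel (Finsupp.single e 1) = Q.coord rel e := rfl

theorem mon_sum {I : Type*} (s : Finset I) (d : I → E →₀ ℕ) :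
    Q.mon rel (∑ i ∈ s, d i) = ∏ i ∈ s, Q.mon rel (d i) := by
  classical
  induction s using Finset.induction_on with
  | empty => rw [Finset.sum_empty, mon_zero, Finset.prod_empty]
  | insert i s hi ih => rw [Finset.sum_insert hi, mon_add, ih, Finset.prod_insert hi]

theorem sum_weight (S : Finset V) (d : E →₀ ℕ) : ∑ v ∈ S, Q.weight d v =
    d.sum fun e k =>
      (k : ℤ) * ((if Q.head e ∈ S then 1 else 0) - (if Q.tail e ∈ S then 1 else 0)) := by
  simp only [weight, AddMonoidHom.coe_mk, ZeroHom.coe_mk, Finsupp.sum]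
  rw [Finset.sum_comm]
  refine Finset.sum_congr rfl fun e _ => ?_
  rw [← Finset.mul_sum, Finset.sum_sub_distrib, Finset.sum_ite_eq, Finset.sum_ite_eq]

theorem sum_weight_univ (d : E →₀ ℕ) : ∑ v, Q.weight d v = 0 := by
  rw [sum_weight]
  simp

/-- If no arrow of the support enters `S`, then the net flow into `S` is not positive. -/
theorem sum_weight_nonpos (S : Finset V) (d : E →₀ ℕ)
    (h : ∀ e, d e ≠ 0 → Q.head e ∈ S → Q.tail e ∈ S) : ∑ v ∈ S, Q.weight d v ≤ 0 := by
  rw [sum_weight]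
  refine Finset.sum_nonpos fun e he => ?_
  have h1 := h e (Finsupp.mem_support_iff.1 he)
  beta_reduce
  split_ifs with h2 h3 h3
  · simp
  · exact absurd (h1 h2) h3
  · simp
  · simp

end ArrowQuiver

namespace Recon

variable {n : ℕ} (α : Fin n → ℕ)

/-! ### Decomposition of flows into paths -/

/-- The arrow `u ⟶ u + 1`. -/
def aArr (u : ℕ) : Arrow n (numExtra α) := .a (Fin.ofNat (n + 1) u)

/-- The arrow `u + 1 ⟶ u`. -/
def cArr (u : ℕ) : Arrow n (numExtra α) := .c (Fin.ofNat (n + 1) (u + 1))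

/-- The exponents of the path `A_{0v}`. -/
noncomputable def aExp (v : ℕ) : Arrow n (numExtra α) →₀ ℕ :=
  ∑ u ∈ Finset.range v, Finsupp.single (aArr α u) 1

/-- The exponents of the path `C_{0v}`. -/
noncomputable def cExp (v : ℕ) : Arrow n (numExtra α) →₀ ℕ :=
  ∑ u ∈ Finset.Ico v (n + 1), Finsupp.single (cArr α u) 1

theorem aArr_injOn : Set.InjOn (aArr α) (Set.Iio (n + 1)) := by
  intro u hu v hv h
  have := congrArg Fin.val (Arrow.a.inj h)
  simpa [Nat.mod_eq_of_lt hu, Nat.mod_eq_of_lt hv] using this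

theorem cArr_injOn : Set.InjOn (cArr α) (Set.Iio (n + 1)) := by
  intro u hu v hv h
  have h1 := Arrow.c.inj h
  rw [← ofNat_add_one, ← ofNat_add_one] at h1
  have := congrArg Fin.val (add_right_cancel h1)
  simpa [Nat.mod_eq_of_lt hu, Nat.mod_eq_of_lt hv] using this

theorem sum_single_le {E : Type*} (f : ℕ → E) (S : Finset ℕ) (hf : Set.InjOn f S) (d : E →₀ ℕ)
    (h : ∀ u ∈ S, d (f u) ≠ 0) : ∑ u ∈ S, Finsupp.single (f u) 1 ≤ d := by
  classical
  intro e
  rw [Finsupp.finsetSum_apply]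
  simp only [Finsupp.single_apply]
  by_cases he : ∃ u ∈ S, f u = e
  · obtain ⟨u, hu, rfl⟩ := he
    rw [Finset.sum_eq_single u]
    · rw [if_pos rfl]
      exact Nat.one_le_iff_ne_zero.2 (h u hu)
    · intro v hv hvu
      exact if_neg fun h => hvu (hf hv hu h)
    · exact fun h => absurd hu h
  · rw [Finset.sum_eq_zero]
    · exact Nat.zero_le _
    · intro u hu
      exact if_neg fun h => he ⟨u, hu, h⟩

theorem aExp_le {v : ℕ} (hv : v ≤ n + 1) (d : Arrow n (numExtra α) →₀ ℕ)
    (h : ∀ u < v, d (aArr α u) ≠ 0) : aExp α v ≤ d :=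
  sum_single_le _ _ ((aArr_injOn α).mono fun _ hu =>
    (Finset.mem_range.1 (Finset.mem_coe.1 hu)).trans_le hv) d fun u hu => h u (Finset.mem_range.1 hu)

theorem cExp_le {v : ℕ} (d : Arrow n (numExtra α) →₀ ℕ)
    (h : ∀ u, v ≤ u → u ≤ n → d (cArr α u) ≠ 0) : cExp α v ≤ d :=
  sum_single_le _ _ ((cArr_injOn α).mono fun _ hu =>
    (Finset.mem_Ico.1 (Finset.mem_coe.1 hu)).2) d fun u hu =>
      h u (Finset.mem_Ico.1 hu).1 (Nat.lt_succ_iff.1 (Finset.mem_Ico.1 hu).2)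

theorem weight_aArr (u : ℕ) (x : Fin (n + 1)) :
    (quiver α).weight (Finsupp.single (aArr α u) 1) x =
      (if Fin.ofNat (n + 1) (u + 1) = x then 1 else 0) -
        (if Fin.ofNat (n + 1) u = x then 1 else 0) := by
  rw [ArrowQuiver.weight_single, ← ofNat_add_one, Nat.cast_one, one_mul]
  rfl

theorem weight_cArr (u : ℕ) (x : Fin (n + 1)) :
    (quiver α).weight (Finsupp.single (cArr α u) 1) x =
      (if Fin.ofNat (n + 1) u = x then 1 else 0) -
        (if Fin.ofNat (n + 1) (u + 1) = x then 1 else 0) := by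
  have : (quiver α).head (cArr α u) = Fin.ofNat (n + 1) u := by
    change Fin.ofNat (n + 1) (u + 1) - 1 = _
    rw [← ofNat_add_one, add_sub_cancel_right]
  rw [ArrowQuiver.weight_single, Nat.cast_one, one_mul, this]
  rfl

theorem weight_aExp (v : ℕ) (x : Fin (n + 1)) : (quiver α).weight (aExp α v) x =
    (if Fin.ofNat (n + 1) v = x then 1 else 0) - (if 0 = x then 1 else 0) := by
  rw [aExp, map_sum, Finset.sum_apply, Finset.sum_congr rfl fun u _ => weight_aArr α u x,
    Finset.sum_range_sub fun u => if Fin.ofNat (n + 1) u = x then (1 : ℤ) else 0]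
  rfl

theorem weight_cExp {v : ℕ} (hv : v ≤ n + 1) (x : Fin (n + 1)) :
    (quiver α).weight (cExp α v) x =
      (if Fin.ofNat (n + 1) v = x then 1 else 0) - (if 0 = x then 1 else 0) := by
  rw [cExp, map_sum, Finset.sum_apply, Finset.sum_congr rfl fun u _ => weight_cArr α u x]
  have := Finset.sum_Ico_sub (fun u => if Fin.ofNat (n + 1) u = x then (1 : ℤ) else 0) hv
  rw [← neg_inj, ← Finset.sum_neg_distrib]
  simp only [neg_sub]
  rw [this, ofNat_succ_self]

theorem ofNat_ne_zero {v : ℕ} (h1 : 1 ≤ v) (hv : v ≤ n) : Fin.ofNat (n + 1) v ≠ 0 := by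
  intro h
  have := congrArg Fin.val h
  simp [Nat.mod_eq_of_lt (Nat.lt_succ_of_le hv)] at this
  omega

/-- A flow into `v` contains one of the two simple paths from `0` to `v`. -/
theorem exists_path_le (d : Arrow n (numExtra α) →₀ ℕ) {v : ℕ} (hv : v ≤ n)
    (h0 : ∀ x ≠ 0, 0 ≤ (quiver α).weight d x)
    (hpos : 0 < (quiver α).weight d (Fin.ofNat (n + 1) v)) : aExp α v ≤ d ∨ cExp α v ≤ d := by
  by_contra! hc
  obtain ⟨p, hp, hdp⟩ : ∃ p < v, d (aArr α p) = 0 := by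
    by_contra! h
    exact hc.1 (aExp_le α (by omega) d h)
  obtain ⟨q, hq, hqn, hdq⟩ : ∃ q, v ≤ q ∧ q ≤ n ∧ d (cArr α q) = 0 := by
    by_contra! h
    exact hc.2 (cExp_le α d h)
  -- The interval of vertices between the two missing arrows. It contains `v` but not `0`, so no
  -- extra arrow enters it. The only arrows entering it are `a p` and `c q`, which `d` does not use,
  -- contradicting the positive inflow.
  let S : Finset (Fin (n + 1)) := Finset.univ.filter fun x => p < (x : ℕ) ∧ (x : ℕ) ≤ q
  have hS : ∀ x : Fin (n + 1), x ∈ S ↔ p < (x : ℕ) ∧ (x : ℕ) ≤ q := fun x => by simp [S]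
  have hval : ∀ u ≤ n, ((Fin.ofNat (n + 1) u : Fin (n + 1)) : ℕ) = u := fun u hu => by
    simp [Nat.mod_eq_of_lt (Nat.lt_succ_of_le hu)]
  have hle : ∑ x ∈ S, (quiver α).weight d x ≤ 0 := by
    refine (quiver α).sum_weight_nonpos S d fun e he hh => ?_
    rcases e with y | y | j
    · obtain ⟨u, hu, rfl⟩ : ∃ u ≤ n, y = Fin.ofNat (n + 1) (u + 1) := by
        refine ⟨(y - 1 : Fin (n + 1)), Nat.lt_succ_iff.1 (Fin.is_lt _), ?_⟩
        rw [← ofNat_add_one, ofNat_val, sub_add_cancel]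
      have h2 : (quiver α).head (.c (Fin.ofNat (n + 1) (u + 1))) = Fin.ofNat (n + 1) u := by
        change Fin.ofNat (n + 1) (u + 1) - 1 = _
        rw [← ofNat_add_one, add_sub_cancel_right]
      rw [h2, hS, hval u hu] at hh
      have h3 : u ≠ q := by
        rintro rfl
        exact he hdq
      change Fin.ofNat (n + 1) (u + 1) ∈ S
      rw [hS, hval (u + 1) (by omega)]
      omega
    · obtain ⟨u, hu, rfl⟩ : ∃ u ≤ n, y = Fin.ofNat (n + 1) u :=
        ⟨y, Nat.lt_succ_iff.1 (Fin.is_lt _), (ofNat_val y).symm⟩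
      have h2 : (quiver α).head (.a (Fin.ofNat (n + 1) u)) = Fin.ofNat (n + 1) (u + 1) :=
        ofNat_add_one u
      rw [h2, hS] at hh
      have h3 : u ≠ p := by
        rintro rfl
        exact he hdp
      change Fin.ofNat (n + 1) u ∈ S
      rcases hu.eq_or_lt with rfl | hun
      · rw [ofNat_succ_self] at hh
        simp at hh
      · rw [hval (u + 1) (by omega)] at hh
        rw [hS, hval u hu]
        omega
    · have h2 : (quiver α).head (.k j) = 0 := rfl
      rw [h2, hS] at hh
      simp at hh
  have hmem : Fin.ofNat (n + 1) v ∈ S := by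
    rw [hS, hval v hv]
    omega
  have hlt : 0 < ∑ x ∈ S, (quiver α).weight d x := by
    refine Finset.sum_pos' (fun x hx => h0 x ?_) ⟨_, hmem, hpos⟩
    rintro rfl
    rw [hS] at hx
    simp at hx
  omega

theorem weight_eq_zero_of_off_zero {d : Arrow n (numExtra α) →₀ ℕ}
    (h : ∀ x ≠ 0, (quiver α).weight d x = 0) : (quiver α).weight d = 0 := by
  have h1 := (quiver α).sum_weight_univ d
  rw [Finset.sum_eq_single 0 (fun x _ hx => h x hx) (by simp)] at h1
  funext x
  by_cases hx : x = 0
  · rw [hx, h1, Pi.zero_apply]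
  · rw [h x hx, Pi.zero_apply]

theorem exists_eq_ofNat {x : Fin (n + 1)} (hx : x ≠ 0) :
    ∃ v, 1 ≤ v ∧ v ≤ n ∧ x = Fin.ofNat (n + 1) v :=
  ⟨x, Nat.one_le_iff_ne_zero.2 fun h => hx (Fin.ext h), Nat.lt_succ_iff.1 x.is_lt,
    (ofNat_val x).symm⟩

theorem ofNat_inj {u v : ℕ} (hu : u ≤ n) (hv : v ≤ n) :
    Fin.ofNat (n + 1) u = Fin.ofNat (n + 1) v ↔ u = v := by
  constructor
  · intro h
    have := congrArg Fin.val h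
    simpa [Nat.mod_eq_of_lt (Nat.lt_succ_of_le hu), Nat.mod_eq_of_lt (Nat.lt_succ_of_le hv)]
      using this
  · rintro rfl
    rfl

/-- A flow out of the vertex `0` is a sum of simple paths starting at `0` and a circulation. -/
theorem exists_flow_decomposition (d : Arrow n (numExtra α) →₀ ℕ)
    (h0 : ∀ x ≠ 0, 0 ≤ (quiver α).weight d x) :
    ∃ (p q : ℕ → ℕ) (d₀ : Arrow n (numExtra α) →₀ ℕ), (quiver α).weight d₀ = 0 ∧
      d = ∑ v ∈ Finset.Icc 1 n, (p v • aExp α v + q v • cExp α v) + d₀ ∧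
      ∀ v ∈ Finset.Icc 1 n, ((p v + q v : ℕ) : ℤ) =
        (quiver α).weight d (Fin.ofNat (n + 1) v) := by
  -- Induction on the total inflow at the nonzero vertices, splitting off one path at a time.
  obtain ⟨N, hN⟩ : ∃ N : ℕ, ∑ v ∈ Finset.Icc 1 n,
      (quiver α).weight d (Fin.ofNat (n + 1) v) = N := by
    refine ⟨(∑ v ∈ Finset.Icc 1 n, (quiver α).weight d (Fin.ofNat (n + 1) v)).toNat,
      (Int.toNat_of_nonneg (Finset.sum_nonneg fun v hv => h0 _ ?_)).symm⟩
    rw [Finset.mem_Icc] at hv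
    exact ofNat_ne_zero hv.1 hv.2
  induction N generalizing d with
  | zero =>
    have h1 : ∀ v ∈ Finset.Icc 1 n, (quiver α).weight d (Fin.ofNat (n + 1) v) = 0 :=
      (Finset.sum_eq_zero_iff_of_nonneg fun v hv => by
        rw [Finset.mem_Icc] at hv
        exact h0 _ (ofNat_ne_zero hv.1 hv.2)).1 (by simpa using hN)
    refine ⟨0, 0, d, weight_eq_zero_of_off_zero α fun x hx => ?_, by simp, fun v hv => ?_⟩
    · obtain ⟨v, hv1, hv, rfl⟩ := exists_eq_ofNat hx
      exact h1 v (Finset.mem_Icc.2 ⟨hv1, hv⟩)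
    · rw [h1 v hv]
      simp
  | succ N ih =>
    obtain ⟨v, hv, hpos⟩ : ∃ v ∈ Finset.Icc 1 n,
        0 < (quiver α).weight d (Fin.ofNat (n + 1) v) := by
      by_contra! h
      have := Finset.sum_nonpos h
      omega
    have hv' := Finset.mem_Icc.1 hv
    have step : ∀ g : Arrow n (numExtra α) →₀ ℕ, g ≤ d →
        (∀ x, (quiver α).weight g x =
          (if Fin.ofNat (n + 1) v = x then 1 else 0) - (if 0 = x then 1 else 0)) →
        ∃ (p q : ℕ → ℕ) (d₀ : Arrow n (numExtra α) →₀ ℕ), (quiver α).weight d₀ = 0 ∧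
          d = g + (∑ v ∈ Finset.Icc 1 n, (p v • aExp α v + q v • cExp α v) + d₀) ∧
          ∀ u ∈ Finset.Icc 1 n, ((p u + q u + (if u = v then 1 else 0) : ℕ) : ℤ) =
            (quiver α).weight d (Fin.ofNat (n + 1) u) := by
      intro g hg hgw
      obtain ⟨d', rfl⟩ := exists_add_of_le hg
      have hw : ∀ u ∈ Finset.Icc 1 n, (quiver α).weight (g + d') (Fin.ofNat (n + 1) u) =
          (quiver α).weight d' (Fin.ofNat (n + 1) u) + if u = v then 1 else 0 := by
        intro u hu
        rw [Finset.mem_Icc] at hu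
        rw [map_add, Pi.add_apply, hgw, if_neg (ofNat_ne_zero hu.1 hu.2).symm, sub_zero, add_comm]
        simp only [ofNat_inj hv'.2 hu.2, eq_comm]
      have h0' : ∀ x ≠ 0, 0 ≤ (quiver α).weight d' x := by
        intro x hx
        obtain ⟨u, hu1, hu, rfl⟩ := exists_eq_ofNat hx
        have h4 := hw u (Finset.mem_Icc.2 ⟨hu1, hu⟩)
        have h5 := h0 _ hx
        split_ifs at h4 with h6
        · subst h6
          omega
        · omega
      have hN' : ∑ u ∈ Finset.Icc 1 n, (quiver α).weight d' (Fin.ofNat (n + 1) u) = N := by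
        rw [Finset.sum_congr rfl hw, Finset.sum_add_distrib, Finset.sum_ite_eq', if_pos hv] at hN
        push_cast at hN
        omega
      obtain ⟨p, q, d₀, h1, h2, h3⟩ := ih d' h0' hN'
      refine ⟨p, q, d₀, h1, by rw [← h2], fun u hu => ?_⟩
      rw [hw u hu, Nat.cast_add, h3 u hu]
      split_ifs <;> simp
    have hsum : ∀ f : ℕ → Arrow n (numExtra α) →₀ ℕ,
        ∑ u ∈ Finset.Icc 1 n, (if u = v then 1 else 0) • f u = f v := by
      intro f
      rw [Finset.sum_eq_single v]
      · simp
      · intro u _ hu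
        rw [if_neg hu, zero_smul]
      · exact fun h => absurd hv h
    rcases exists_path_le α d hv'.2 h0 hpos with h | h
    · obtain ⟨p, q, d₀, h1, h2, h3⟩ := step _ h (weight_aExp α v)
      refine ⟨fun u => p u + if u = v then 1 else 0, q, d₀, h1, ?_, fun u hu => ?_⟩
      · rw [h2, ← add_assoc]
        congr 1
        simp only [add_smul, Finset.sum_add_distrib, hsum]
        abel
      · rw [← h3 u hu]
        push_cast
        ring
    · obtain ⟨p, q, d₀, h1, h2, h3⟩ := step _ h (weight_cExp α (by omega))
      refine ⟨p, fun u => q u + if u = v then 1 else 0, d₀, h1, ?_, fun u hu => ?_⟩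
      · rw [h2, ← add_assoc]
        congr 1
        simp only [add_smul, Finset.sum_add_distrib, hsum]
        abel
      · rw [← h3 u hu]
        push_cast
        ring

/-! ### Invariants -/

section Ring

variable (lam : ℕ → ℕ → ℂ)

/-- The coordinate functions of the universal representation. -/
noncomputable abbrev coordVal : Arrow n (numExtra α) → (quiver α).RepRing (StepRel α lam) :=
  (quiver α).coord (StepRel α lam)

theorem isZigzag_coord (hn : 1 ≤ n) : IsZigzag (zigzagData α hn lam) (aVal α (coordVal α lam))
    (cVal α (coordVal α lam)) (kVal α (coordVal α lam)) (zVal α (coordVal α lam)) :=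
  isZigzag_of_stepRel α _ lam hn fun _ _ h => (quiver α).repHom_coord_rel _ h

theorem mon_aExp (v : ℕ) : (quiver α).mon (StepRel α lam) (aExp α v) =
    ∏ u ∈ Finset.range v, aVal α (coordVal α lam) u := by
  rw [aExp, ArrowQuiver.mon_sum]
  rfl

theorem mon_cExp (v : ℕ) : (quiver α).mon (StepRel α lam) (cExp α v) =
    ∏ u ∈ Finset.Ico v (n + 1), cVal α (coordVal α lam) u := by
  rw [cExp, ArrowQuiver.mon_sum]
  rfl

theorem weight_kArrow {j : ℕ} (hj : j ≤ 1 + numExtra α) (x : Fin (n + 1)) :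
    (quiver α).weight (Finsupp.single (kArrow α j) 1) x =
      (if 0 = x then 1 else 0) - (if kTail α j = x then 1 else 0) := by
  rw [ArrowQuiver.weight_single, Nat.cast_one, one_mul, head_kArrow, tail_kArrow α hj]

theorem weight_of_k_eq_zero {d : Arrow n (numExtra α) →₀ ℕ} (hd : ∀ j, d (.k j) = 0) (v : ℕ) :
    (quiver α).weight d (Fin.ofNat (n + 1) (v + 1)) =
      d (aArr α v) - d (aArr α (v + 1)) + (d (cArr α (v + 1)) - d (cArr α v)) := by
  classical
  have h1 : d = ∑ x, Finsupp.single (.a x) (d (.a x)) + ∑ x, Finsupp.single (.c x) (d (.c x)) := by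
    ext e
    rw [Finsupp.add_apply, Finsupp.finsetSum_apply, Finsupp.finsetSum_apply]
    simp only [Finsupp.single_apply]
    rcases e with x | x | j
    · simp
    · simp
    · simp [hd]
  conv_lhs => rw [h1]
  rw [map_add, map_sum, map_sum, Pi.add_apply, Finset.sum_apply, Finset.sum_apply]
  simp only [ArrowQuiver.weight_single, mul_sub, Finset.sum_sub_distrib, mul_ite, mul_one, mul_zero]
  congr 1
  · congr 1
    · rw [Finset.sum_eq_single (Fin.ofNat (n + 1) v)]
      · exact if_pos (ofNat_add_one v)
      · intro x _ hx
        refine if_neg fun h => hx ?_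
        rw [← ofNat_add_one] at h
        exact add_right_cancel h
      · simp
    · exact (Finset.sum_ite_eq' _ _ _).trans (if_pos (Finset.mem_univ _))
  · congr 1
    · rw [Finset.sum_eq_single (Fin.ofNat (n + 1) (v + 1 + 1))]
      · refine if_pos ?_
        change Fin.ofNat (n + 1) (v + 1 + 1) - 1 = _
        rw [← ofNat_add_one (v + 1), add_sub_cancel_right]
      · intro x _ hx
        refine if_neg fun h => hx ?_
        rw [← ofNat_add_one (v + 1), ← h]
        exact (sub_add_cancel x 1).symm
      · simp
    · exact (Finset.sum_ite_eq' _ _ _).trans (if_pos (Finset.mem_univ _))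

/-- The polynomials in the basic cycles. -/
noncomputable abbrev cycleAlgebra : Subalgebra ℂ ((quiver α).RepRing (StepRel α lam)) :=
  Algebra.adjoin ℂ (zVal α (coordVal α lam) '' Set.Icc 0 (1 + numExtra α + 1))

theorem zVal_mem_cycleAlgebra {j : ℕ} (hj : j ≤ 1 + numExtra α + 1) :
    zVal α (coordVal α lam) j ∈ cycleAlgebra α lam :=
  Algebra.subset_adjoin ⟨j, ⟨Nat.zero_le _, hj⟩, rfl⟩

/-- A nontrivial circulation contains a cycle whose monomial is a polynomial in the basic cycles. -/
theorem exists_cycle_le (hn : 1 ≤ n) {d : Arrow n (numExtra α) →₀ ℕ}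
    (hw : (quiver α).weight d = 0) (hd : d ≠ 0) :
    ∃ g ≤ d, g ≠ 0 ∧ (quiver α).weight g = 0 ∧
      (quiver α).mon (StepRel α lam) g ∈ cycleAlgebra α lam := by
  have hz := isZigzag_coord α lam hn
  have hcyc : ∀ j ≤ 1 + numExtra α, kVal α (coordVal α lam) j * ∏ u ∈ Finset.range (kTail α j),
      aVal α (coordVal α lam) u ∈ cycleAlgebra α lam := by
    intro j hj
    have := hz.anticlockwise j hj
    rw [show kVal α (coordVal α lam) j * ∏ u ∈ Finset.range (kTail α j),
      aVal α (coordVal α lam) u = _ from this]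
    exact zVal_mem_cycleAlgebra α lam (by omega)
  have hcyc' : ∀ j ≤ 1 + numExtra α, kVal α (coordVal α lam) j *
      ∏ u ∈ Finset.Ico (kTail α j : ℕ) (n + 1), cVal α (coordVal α lam) u ∈
        cycleAlgebra α lam := by
    intro j hj
    have := hz.clockwise j hj
    rw [show kVal α (coordVal α lam) j * ∏ u ∈ Finset.Ico (kTail α j : ℕ) (n + 1),
      cVal α (coordVal α lam) u = _ from this]
    exact add_mem (zVal_mem_cycleAlgebra α lam (by omega)) (Subalgebra.algebraMap_mem _ _)
  -- If an extra arrow occurs, removing it leaves a unit flow from `0` to its tail, which contains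
  -- one of the two simple paths; together they form a basic cycle, up to a constant.
  by_cases hk : ∃ j, d (.k j) ≠ 0
  · obtain ⟨⟨j, hj⟩, hdj⟩ := hk
    have hkj : kArrow α (j + 1) = .k ⟨j, hj⟩ := by
      rw [kArrow, if_neg (by omega), dif_pos (by simpa using hj)]
      rfl
    rw [← hkj] at hdj
    have hle : Finsupp.single (kArrow α (j + 1)) 1 ≤ d := by
      rw [Finsupp.single_le_iff]
      exact Nat.one_le_iff_ne_zero.2 hdj
    obtain ⟨d', rfl⟩ := exists_add_of_le hle
    have hw' : ∀ x, (quiver α).weight d' x =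
        (if kTail α (j + 1) = x then 1 else 0) - (if 0 = x then 1 else 0) := by
      intro x
      have h1 := congrFun hw x
      rw [map_add, Pi.add_apply, weight_kArrow α (by omega), Pi.zero_apply] at h1
      linarith
    have hl1 := one_le_kTail α hn (j + 1)
    have hln : (kTail α (j + 1) : ℕ) ≤ n := Nat.lt_succ_iff.1 (Fin.is_lt _)
    have hl0 : kTail α (j + 1) ≠ 0 := by
      intro h
      rw [h] at hl1
      simp at hl1
    have hpath := exists_path_le α d' hln
      (fun x hx => by
        rw [hw', if_neg (Ne.symm hx), sub_zero]
        split_ifs <;> simp)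
      (by rw [ofNat_val, hw', if_pos rfl, if_neg hl0.symm]; simp)
    have hne : ∀ g : Arrow n (numExtra α) →₀ ℕ,
        Finsupp.single (kArrow α (j + 1)) 1 + g ≠ 0 := by
      intro g h
      have := DFunLike.congr_fun h (kArrow α (j + 1))
      simp at this
    rcases hpath with h | h
    · refine ⟨Finsupp.single (kArrow α (j + 1)) 1 + aExp α (kTail α (j + 1)), by gcongr, hne _,
        ?_, ?_⟩
      · funext x
        rw [map_add, Pi.add_apply, weight_kArrow α (by omega), weight_aExp, ofNat_val,
          Pi.zero_apply]
        ring
      · rw [ArrowQuiver.mon_add, ArrowQuiver.mon_single, mon_aExp]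
        exact hcyc (j + 1) (by omega)
    · refine ⟨Finsupp.single (kArrow α (j + 1)) 1 + cExp α (kTail α (j + 1)), by gcongr, hne _,
        ?_, ?_⟩
      · funext x
        rw [map_add, Pi.add_apply, weight_kArrow α (by omega), weight_cExp α (by omega), ofNat_val,
          Pi.zero_apply]
        ring
      · rw [ArrowQuiver.mon_add, ArrowQuiver.mon_single, mon_cExp]
        exact hcyc' (j + 1) (by omega)
  · push Not at hk
    have hne : ∀ (e : Arrow n (numExtra α)) (g : Arrow n (numExtra α) →₀ ℕ),
        Finsupp.single e 1 + g ≠ 0 := by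
      intro e g h
      have := DFunLike.congr_fun h e
      simp at this
    -- Without extra arrows, conservation makes `d (a u) - d (c u)` independent of `u`. So `d`
    -- contains a `2`-cycle, or else one of the two full cycles.
    have hcons : ∀ u ≤ n, d (aArr α u) + d (cArr α 0) = d (aArr α 0) + d (cArr α u) := by
      intro u
      induction u with
      | zero => intro _; rfl
      | succ u ih =>
        intro hu
        have h1 := ih (by omega)
        have h2 := weight_of_k_eq_zero α hk u
        rw [hw, Pi.zero_apply] at h2
        omega
    by_cases h2 : ∃ u ≤ n, d (aArr α u) ≠ 0 ∧ d (cArr α u) ≠ 0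
    · obtain ⟨u, hu, ha, hc⟩ := h2
      refine ⟨Finsupp.single (aArr α u) 1 + Finsupp.single (cArr α u) 1, ?_, hne _ _, ?_, ?_⟩
      · classical
        intro e
        rw [Finsupp.add_apply, Finsupp.single_apply, Finsupp.single_apply]
        by_cases h3 : aArr α u = e
        · subst h3
          rw [if_pos rfl, if_neg (by simp [aArr, cArr])]
          omega
        · rw [if_neg h3, zero_add]
          split_ifs with h4
          · subst h4
            omega
          · omega
      · funext x
        rw [map_add, Pi.add_apply, weight_aArr, weight_cArr, Pi.zero_apply]
        ring
      · rw [ArrowQuiver.mon_add, ArrowQuiver.mon_single, ArrowQuiver.mon_single]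
        have h3 := hz.pair u hu
        have h4 := (zigzagData α hn lam).ι_le u hu
        rw [show coordVal α lam (aArr α u) * coordVal α lam (cArr α u) = _ from h3]
        exact add_mem (zVal_mem_cycleAlgebra α lam (h4.trans (Nat.le_succ _)))
          (Subalgebra.algebraMap_mem _ _)
    · push Not at h2
      rcases Nat.eq_zero_or_pos (d (aArr α 0)) with ha0 | ha0
      · rcases Nat.eq_zero_or_pos (d (cArr α 0)) with hc0 | hc0
        · refine absurd ?_ hd
          have h3 : ∀ u ≤ n, d (aArr α u) = 0 ∧ d (cArr α u) = 0 := by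
            intro u hu
            have h3 := hcons u hu
            by_cases h4 : d (aArr α u) = 0
            · omega
            · have := h2 u hu h4
              omega
          ext e
          rcases e with x | x | j
          · have h4 := (h3 (x - 1 : Fin (n + 1)) (Nat.lt_succ_iff.1 (Fin.is_lt _))).2
            rw [cArr, ← ofNat_add_one, ofNat_val, sub_add_cancel] at h4
            exact h4
          · have h4 := (h3 x (Nat.lt_succ_iff.1 (Fin.is_lt _))).1
            rw [aArr, ofNat_val] at h4
            exact h4
          · exact hk j
        · refine ⟨cExp α 0, cExp_le α d fun u _ hu => ?_, ?_, ?_, ?_⟩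
          · have := hcons u hu
            omega
          · rw [cExp, ← Finset.range_eq_Ico, Finset.sum_range_succ', add_comm]
            exact hne _ _
          · funext x
            rw [weight_cExp α (Nat.zero_le _), ofNat_zero, sub_self, Pi.zero_apply]
          · rw [mon_cExp, ← Finset.range_eq_Ico]
            rw [show ∏ u ∈ Finset.range (n + 1), cVal α (coordVal α lam) u = _ from hz.prod_c]
            exact zVal_mem_cycleAlgebra α lam (Nat.zero_le _)
      · have hc0 : d (cArr α 0) = 0 := h2 0 (Nat.zero_le _) (by omega)
        refine ⟨aExp α (n + 1), aExp_le α le_rfl d fun u hu => ?_, ?_, ?_, ?_⟩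
        · have := hcons u (by omega)
          omega
        · rw [aExp, Finset.sum_range_succ', add_comm]
          exact hne _ _
        · funext x
          rw [weight_aExp, ofNat_succ_self, sub_self, Pi.zero_apply]
        · rw [mon_aExp]
          rw [show ∏ u ∈ Finset.range (n + 1), aVal α (coordVal α lam) u = _ from hz.prod_a]
          exact zVal_mem_cycleAlgebra α lam le_rfl

theorem mon_mem_cycleAlgebra (hn : 1 ≤ n) (d : Arrow n (numExtra α) →₀ ℕ)
    (hw : (quiver α).weight d = 0) :
    (quiver α).mon (StepRel α lam) d ∈ cycleAlgebra α lam := by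
  obtain ⟨N, hN⟩ : ∃ N, d.degree = N := ⟨_, rfl⟩
  induction N using Nat.strong_induction_on generalizing d with
  | _ N ih =>
    by_cases hd : d = 0
    · rw [hd, ArrowQuiver.mon_zero]
      exact one_mem _
    · obtain ⟨g, hg, hg0, hgw, hmem⟩ := exists_cycle_le α lam hn hw hd
      obtain ⟨d', rfl⟩ := exists_add_of_le hg
      rw [map_add, hgw, zero_add] at hw
      rw [ArrowQuiver.mon_add]
      refine mul_mem hmem (ih d'.degree ?_ d' hw rfl)
      rw [← hN, map_add]
      have : g.degree ≠ 0 := (Finsupp.degree_eq_zero_iff g).not.2 hg0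
      omega

theorem mem_cycleAlgebra_of_mem_invariants (hn : 1 ≤ n) {f : (quiver α).RepRing (StepRel α lam)}
    (hf : f ∈ (quiver α).invariants (StepRel α lam)) : f ∈ cycleAlgebra α lam := by
  rw [ArrowQuiver.mem_invariants_iff] at hf
  refine (Submodule.span_le (p := Subalgebra.toSubmodule (cycleAlgebra α lam))).2 ?_ hf
  rintro _ ⟨d, hd, rfl⟩
  exact mon_mem_cycleAlgebra α lam hn d hd

theorem mon_mem_invariants {d : Arrow n (numExtra α) →₀ ℕ} (hw : (quiver α).weight d = 0) :
    (quiver α).mon (StepRel α lam) d ∈ (quiver α).invariants (StepRel α lam) := by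
  rw [ArrowQuiver.mem_invariants_iff]
  exact Submodule.subset_span ⟨d, hw, rfl⟩

theorem zVal_mem_invariants {j : ℕ} (hj : j ≤ 1 + numExtra α + 1) :
    zVal α (coordVal α lam) j ∈ (quiver α).invariants (StepRel α lam) := by
  unfold zVal
  split_ifs with h0
  · rw [Finset.range_eq_Ico, ← mon_cExp]
    refine mon_mem_invariants α lam ?_
    funext x
    rw [weight_cExp α (Nat.zero_le _), ofNat_zero, sub_self, Pi.zero_apply]
  · have : kVal α (coordVal α lam) (j - 1) *
        ∏ u ∈ Finset.range (kTail α (j - 1)), aVal α (coordVal α lam) u =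
      (quiver α).mon (StepRel α lam)
        (Finsupp.single (kArrow α (j - 1)) 1 + aExp α (kTail α (j - 1))) := by
      rw [ArrowQuiver.mon_add, ArrowQuiver.mon_single, mon_aExp]
      rfl
    rw [this]
    refine mon_mem_invariants α lam ?_
    funext x
    rw [map_add, Pi.add_apply, weight_kArrow α (by omega), weight_aExp, ofNat_val, Pi.zero_apply]
    ring

/-! ### Semi-invariants -/

/-- The exponents of the product of the paths `A_{0v}`, for `v` in `S`, and `C_{0v}`, for `v` not in
`S`. -/
noncomputable def sectionExp (S : Finset ℕ) : Arrow n (numExtra α) →₀ ℕ :=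
  ∑ v ∈ Finset.Icc 1 n, if v ∈ S then aExp α v else cExp α v

theorem weight_sectionExp (S : Finset ℕ) : (quiver α).weight (sectionExp α S) = stability n := by
  funext x
  rw [sectionExp, map_sum, Finset.sum_apply]
  have : ∀ v ∈ Finset.Icc 1 n, (quiver α).weight (if v ∈ S then aExp α v else cExp α v) x =
      (if Fin.ofNat (n + 1) v = x then 1 else 0) - (if 0 = x then 1 else 0) := by
    intro v hv
    rw [Finset.mem_Icc] at hv
    split_ifs <;> simp_all [weight_aExp, weight_cExp α (show v ≤ n + 1 by omega)]
  rw [Finset.sum_congr rfl this, Finset.sum_sub_distrib, Finset.sum_const, Nat.card_Icc, stability]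
  by_cases hx : x = 0
  · subst hx
    rw [Finset.sum_eq_zero]
    · simp
    · intro v hv
      rw [Finset.mem_Icc] at hv
      exact if_neg (ofNat_ne_zero hv.1 hv.2)
  · rw [if_neg hx, if_neg (Ne.symm hx), smul_zero, sub_zero]
    obtain ⟨u, hu1, hu, rfl⟩ := exists_eq_ofNat hx
    rw [Finset.sum_eq_single u]
    · exact if_pos rfl
    · intro v hv hvu
      rw [Finset.mem_Icc] at hv
      exact if_neg fun h => hvu ((ofNat_inj hv.2 hu).1 h)
    · intro h
      exact absurd (Finset.mem_Icc.2 ⟨hu1, hu⟩) h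

/-- The product of the paths `A_{0v}`, for `v` in `S`, and `C_{0v}`, for `v` not in `S`. -/
noncomputable def sectionVal (S : Finset ℕ) : (quiver α).RepRing (StepRel α lam) :=
  (quiver α).mon (StepRel α lam) (sectionExp α S)

theorem sectionVal_mem (S : Finset ℕ) :
    sectionVal α lam S ∈ (quiver α).semiInvariants (StepRel α lam) (stability n) 1 := by
  rw [ArrowQuiver.semiInvariants_eq_span]
  exact Submodule.subset_span ⟨_, by rw [weight_sectionExp, one_smul], rfl⟩

theorem sectionVal_eq (S : Finset ℕ) : sectionVal α lam S = ∏ v ∈ Finset.Icc 1 n,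
    if v ∈ S then ∏ u ∈ Finset.range v, aVal α (coordVal α lam) u
      else ∏ u ∈ Finset.Ico v (n + 1), cVal α (coordVal α lam) u := by
  rw [sectionVal, sectionExp, ArrowQuiver.mon_sum]
  refine Finset.prod_congr rfl fun v _ => ?_
  split_ifs
  · rw [mon_aExp]
  · rw [mon_cExp]

/-- The paths `C_{0v}` and `A_{0,v+1}` overlap between `v` and `v + 1`. Uncrossing them splits off
the `2`-cycle there and leaves `A_{0v}` and `C_{0,v+1}`. -/
theorem sectionExp_swap {S : Finset ℕ} {v : ℕ} (hv : 1 ≤ v) (hvn : v + 1 ≤ n) (h1 : v ∉ S)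
    (h2 : v + 1 ∈ S) : sectionExp α S = Finsupp.single (aArr α v) 1 + Finsupp.single (cArr α v) 1 +
      sectionExp α (insert v (S.erase (v + 1))) := by
  have hmem : v ∈ Finset.Icc 1 n := Finset.mem_Icc.2 ⟨hv, by omega⟩
  have hmem' : v + 1 ∈ (Finset.Icc 1 n).erase v :=
    Finset.mem_erase.2 ⟨by omega, Finset.mem_Icc.2 ⟨by omega, hvn⟩⟩
  rw [sectionExp, sectionExp, ← Finset.add_sum_erase _ _ hmem, ← Finset.add_sum_erase _ _ hmem',
    ← Finset.add_sum_erase _ _ hmem, ← Finset.add_sum_erase _ _ hmem', if_neg h1, if_pos h2,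
    if_pos (Finset.mem_insert_self _ _), if_neg (by simp)]
  have hA : aExp α (v + 1) = aExp α v + Finsupp.single (aArr α v) 1 := by
    rw [aExp, aExp, Finset.sum_range_succ]
  have hC : cExp α v = Finsupp.single (cArr α v) 1 + cExp α (v + 1) := by
    rw [cExp, cExp, Finset.sum_eq_sum_Ico_succ_bot (by omega)]
  rw [hA, hC]
  have : ∑ u ∈ ((Finset.Icc 1 n).erase v).erase (v + 1),
      (if u ∈ insert v (S.erase (v + 1)) then aExp α u else cExp α u) =
      ∑ u ∈ ((Finset.Icc 1 n).erase v).erase (v + 1), if u ∈ S then aExp α u else cExp α u := by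
    refine Finset.sum_congr rfl fun u hu => ?_
    simp only [Finset.mem_erase] at hu
    simp [hu.1, hu.2.1]
  rw [this]
  abel

/-- Up to an invariant, the products of paths are those of the `n + 1` charts. -/
theorem exists_sectionExp_eq (S : Finset ℕ) (hS : S ⊆ Finset.Icc 1 n) : ∃ s ≤ n, ∃ d,
    (quiver α).weight d = 0 ∧ sectionExp α S = d + sectionExp α (Finset.Icc 1 s) := by
  -- Each uncrossing replaces `v + 1` by `v` in `S`, so the sum of the elements of `S` drops by one.
  obtain ⟨N, hN⟩ : ∃ N, ∑ v ∈ S, v = N := ⟨_, rfl⟩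
  induction N using Nat.strong_induction_on generalizing S with
  | _ N ih =>
    by_cases h : ∃ v, 1 ≤ v ∧ v ∉ S ∧ v + 1 ∈ S
    · obtain ⟨v, hv, h1, h2⟩ := h
      have hvn : v + 1 ≤ n := (Finset.mem_Icc.1 (hS h2)).2
      obtain ⟨s, hs, d, hd, he⟩ := ih (∑ u ∈ insert v (S.erase (v + 1)), u) (by
        rw [Finset.sum_insert (by simp [h1]), ← hN, ← Finset.add_sum_erase _ _ h2]
        omega) _ (by
          intro u hu
          rw [Finset.mem_insert, Finset.mem_erase] at hu
          rcases hu with rfl | hu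
          · exact Finset.mem_Icc.2 ⟨hv, by omega⟩
          · exact hS hu.2) rfl
      refine ⟨s, hs, Finsupp.single (aArr α v) 1 + Finsupp.single (cArr α v) 1 + d, ?_, ?_⟩
      · funext x
        rw [map_add, map_add, hd, Pi.add_apply, Pi.add_apply, weight_aArr, weight_cArr,
          Pi.zero_apply]
        ring
      · rw [sectionExp_swap α hv hvn h1 h2, he]
        abel
    · push Not at h
      -- With no crossing left, `S` is closed downward in the positive integers, hence an interval
      -- ending at its maximum.
      refine ⟨S.sup id, Finset.sup_le fun v hv => (Finset.mem_Icc.1 (hS hv)).2, 0, map_zero _, ?_⟩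
      rw [zero_add]
      congr 1
      apply Finset.Subset.antisymm
      · intro v hv
        exact Finset.mem_Icc.2 ⟨(Finset.mem_Icc.1 (hS hv)).1, Finset.le_sup (f := id) hv⟩
      · intro v hv
        rw [Finset.mem_Icc] at hv
        rcases S.eq_empty_or_nonempty with rfl | hne
        · simp at hv
          omega
        · obtain ⟨w, hw, hw'⟩ := Finset.exists_mem_eq_sup S hne id
          rw [hw', id] at hv
          obtain ⟨hv1, hv2⟩ := hv
          clear hw' hne
          induction w, hv2 using Nat.le_induction with
          | base => exact hw
          | succ w hvw ihw => 
            refine ihw ?_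
            by_contra hc
            exact h w (by omega) hc hw

/-- Every monomial of weight `k θ` is an invariant times a product of `k` of the sections that
define the charts. -/
theorem exists_mon_eq_of_weight {k : ℕ} {d : Arrow n (numExtra α) →₀ ℕ}
    (hd : (quiver α).weight d = k • stability n) : ∃ (d₀ : Arrow n (numExtra α) →₀ ℕ) (s : ℕ → ℕ),
      (quiver α).weight d₀ = 0 ∧ (∀ i, s i ≤ n) ∧
        d = d₀ + ∑ i ∈ Finset.range k, sectionExp α (Finset.Icc 1 (s i)) := by
  have hst : ∀ x : Fin (n + 1), x ≠ 0 → (quiver α).weight d x = k := by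
    intro x hx
    rw [hd, Pi.smul_apply, stability, if_neg hx]
    simp
  obtain ⟨p, q, d₀, h1, h2, h3⟩ := exists_flow_decomposition α d fun x hx => by
    rw [hst x hx]
    exact Int.natCast_nonneg _
  have hpq : ∀ v ∈ Finset.Icc 1 n, p v + q v = k := by
    intro v hv
    have h4 := h3 v hv
    rw [Finset.mem_Icc] at hv
    rw [hst _ (ofNat_ne_zero hv.1 hv.2)] at h4
    exact_mod_cast h4
  -- The flow is cut into `k` layers, each with one path to every vertex: of the `k` paths to `v`,
  -- the first `p v` layers take the anticlockwise ones.
  let S : ℕ → Finset ℕ := fun i => (Finset.Icc 1 n).filter fun v => i < p v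
  have hsum : ∑ v ∈ Finset.Icc 1 n, (p v • aExp α v + q v • cExp α v) =
      ∑ i ∈ Finset.range k, sectionExp α (S i) := by
    simp only [sectionExp]
    rw [Finset.sum_comm]
    refine Finset.sum_congr rfl fun v hv => ?_
    have h4 : ∀ i, (if v ∈ S i then aExp α v else cExp α v) =
        if i < p v then aExp α v else cExp α v := by
      intro i
      simp only [S, Finset.mem_filter, hv, true_and]
    simp only [h4]
    rw [Finset.sum_ite, Finset.sum_const, Finset.sum_const]
    have h5 := hpq v hv
    congr 2
    · have : (Finset.range k).filter (· < p v) = Finset.range (p v) := by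
        ext i
        simp only [Finset.mem_filter, Finset.mem_range]
        omega
      rw [this, Finset.card_range]
    · have : (Finset.range k).filter (¬ · < p v) = Finset.Ico (p v) k := by
        ext i
        simp only [Finset.mem_filter, Finset.mem_range, Finset.mem_Ico]
        omega
      rw [this, Nat.card_Ico]
      omega
  choose s hs e he hse using fun i => exists_sectionExp_eq α (S i) (Finset.filter_subset _ _)
  refine ⟨d₀ + ∑ i ∈ Finset.range k, e i, s, ?_, hs, ?_⟩
  · rw [map_add, h1, map_sum, Finset.sum_eq_zero fun i _ => he i, zero_add]
  · rw [h2, hsum, Finset.sum_congr rfl fun i _ => hse i, Finset.sum_add_distrib]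
    abel

end Ring

end Recon

/-! ### Charts of a moduli space -/

namespace ArrowQuiver

variable {V E : Type} [Fintype V] [DecidableEq V] (Q : ArrowQuiver V E)
  (rel : Q.PathAlgebra → Q.PathAlgebra → Prop) (θ : V → ℤ)

/-- The sum of the homogeneous parts, in the coordinate ring of the representation scheme. -/
noncomputable def total : Q.SemiInvariantRing rel θ →ₐ[ℂ] Q.RepRing rel :=
  DirectSum.coeAlgHom (Q.semiInvariants rel θ)

theorem total_homogeneous (k : ℕ) (g : Q.semiInvariants rel θ k) :
    Q.total rel θ (Q.homogeneous rel θ k g) = g :=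
  DirectSum.coeAlgHom_of (Q.semiInvariants rel θ) k g

variable {Q rel θ}

theorem homogeneous_eq {k l : ℕ} (g : Q.semiInvariants rel θ k) (h : Q.semiInvariants rel θ l)
    (hkl : k = l) (hgh : (g : Q.RepRing rel) = h) :
    Q.homogeneous rel θ k g = Q.homogeneous rel θ l h := by
  subst hkl
  rw [Subtype.ext hgh]

theorem homogeneous_mul {k l : ℕ} (g : Q.semiInvariants rel θ k) (h : Q.semiInvariants rel θ l) :
    Q.homogeneous rel θ k g * Q.homogeneous rel θ l h =
      Q.homogeneous rel θ (k + l) ⟨g * h, SetLike.GradedMul.mul_mem g.2 h.2⟩ :=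
  DirectSum.of_mul_of (A := fun k => Q.semiInvariants rel θ k) g h

theorem homogeneous_one :
    Q.homogeneous rel θ 0 ⟨1, SetLike.GradedOne.one_mem⟩ = 1 := rfl

variable {f : Q.RepRing rel} (hf : f ∈ Q.semiInvariants rel θ 1)

theorem pow_mem_semiInvariants (hf : f ∈ Q.semiInvariants rel θ 1) (k : ℕ) :
    f ^ k ∈ Q.semiInvariants rel θ k := by
  simpa using SetLike.pow_mem_graded k hf

theorem homogeneous_pow (k : ℕ) : Q.homogeneous rel θ 1 ⟨f, hf⟩ ^ k =
    Q.homogeneous rel θ k ⟨f ^ k, pow_mem_semiInvariants hf k⟩ := by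
  induction k with
  | zero =>
    rw [pow_zero, ← homogeneous_one]
    exact homogeneous_eq _ _ rfl (pow_zero f).symm
  | succ k ih =>
    rw [pow_succ, ih, homogeneous_mul]
    exact homogeneous_eq _ _ rfl (pow_succ f k).symm

theorem homogeneous_mem (k : ℕ) (g : Q.semiInvariants rel θ k) :
    Q.homogeneous rel θ k g ∈ Q.semiInvariantGrading rel θ k := ⟨g, rfl⟩

/-- The homogeneous coordinate ring of the chart where the section `f` does not vanish. -/
abbrev ChartRing : Type :=
  HomogeneousLocalization.Away (Q.semiInvariantGrading rel θ) (Q.homogeneous rel θ 1 ⟨f, hf⟩)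

/-- The fraction `g / f ^ k`. -/
noncomputable def chartFrac (k : ℕ) (g : Q.semiInvariants rel θ k) : ChartRing hf :=
  HomogeneousLocalization.Away.mk _ (homogeneous_mem 1 ⟨f, hf⟩) k (Q.homogeneous rel θ k g)
    (by simpa using homogeneous_mem k g)

theorem exists_eq_chartFrac (x : ChartRing hf) : ∃ k g, x = chartFrac hf k g := by
  obtain ⟨k, _, hg, rfl⟩ :=
    HomogeneousLocalization.Away.mk_surjective _ (homogeneous_mem 1 ⟨f, hf⟩) x
  obtain ⟨g, rfl⟩ : _ ∈ Q.semiInvariantGrading rel θ k := by simpa using hg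
  exact ⟨k, g, rfl⟩

theorem chartFrac_eq_zero {k : ℕ} {g : Q.semiInvariants rel θ k} {M : ℕ}
    (h : f ^ M * (g : Q.RepRing rel) = 0) : chartFrac hf k g = 0 := by
  apply HomogeneousLocalization.val_injective
  rw [chartFrac, HomogeneousLocalization.Away.val_mk, HomogeneousLocalization.val_zero,
    Localization.mk_eq_mk', IsLocalization.mk'_eq_zero_iff]
  refine ⟨⟨_, M, rfl⟩, ?_⟩
  change Q.homogeneous rel θ 1 ⟨f, hf⟩ ^ M * _ = _
  rw [homogeneous_pow, homogeneous_mul]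
  simp only [h]
  exact map_zero (Q.homogeneous rel θ (M + k))

variable {B : Type*} [CommRing B] [Algebra ℂ B] (φ : Q.RepRing rel →ₐ[ℂ] B) (hφ : φ f = 1)

/-- A representation on which the section `f` has the value `1` is a point of the chart. -/
noncomputable def chartHom : ChartRing hf →+* B :=
  (IsLocalization.Away.lift (S := Localization.Away (Q.homogeneous rel θ 1 ⟨f, hf⟩))
    (g := (φ.comp (Q.total rel θ)).toRingHom) (Q.homogeneous rel θ 1 ⟨f, hf⟩) (by
      change IsUnit (φ (Q.total rel θ _))
      rw [total_homogeneous, hφ]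
      exact isUnit_one)).comp (algebraMap _ _)

theorem chartHom_chartFrac (k : ℕ) (g : Q.semiInvariants rel θ k) :
    chartHom hf φ hφ (chartFrac hf k g) = φ g := by
  rw [chartHom, RingHom.comp_apply, HomogeneousLocalization.algebraMap_apply, chartFrac,
    HomogeneousLocalization.Away.val_mk, Localization.mk_eq_mk', IsLocalization.Away.lift,
    IsLocalization.lift_mk'_spec]
  change φ (Q.total rel θ _) = φ (Q.total rel θ (Q.homogeneous rel θ 1 ⟨f, hf⟩ ^ k)) * _
  rw [map_pow, map_pow, total_homogeneous, total_homogeneous, hφ, one_pow, one_mul]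

theorem chartHom_bijective (hsurj : ∀ b, ∃ k, ∃ g ∈ Q.semiInvariants rel θ k, φ g = b)
    (hinj : ∀ k, ∀ g ∈ Q.semiInvariants rel θ k, φ g = 0 → ∃ M, f ^ M * g = 0) :
    Function.Bijective (chartHom hf φ hφ) := by
  constructor
  · rw [injective_iff_map_eq_zero]
    intro x hx
    obtain ⟨k, g, rfl⟩ := exists_eq_chartFrac hf x
    rw [chartHom_chartFrac] at hx
    obtain ⟨M, hM⟩ := hinj k g g.2 hx
    exact chartFrac_eq_zero hf hM
  · intro b
    obtain ⟨k, g, hg, rfl⟩ := hsurj b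
    exact ⟨chartFrac hf k ⟨g, hg⟩, chartHom_chartFrac hf φ hφ k ⟨g, hg⟩⟩

/-- The subalgebra of the values of semi-invariants under a representation on which the
section `f` has the value `1`. -/
def semiInvariantValues (hf : f ∈ Q.semiInvariants rel θ 1) (φ : Q.RepRing rel →ₐ[ℂ] B)
    (hφ : φ f = 1) : Subalgebra ℂ B where
  carrier := {b | ∃ k, ∃ g ∈ Q.semiInvariants rel θ k, φ g = b}
  mul_mem' := by
    rintro _ _ ⟨k, g, hg, rfl⟩ ⟨l, h, hh, rfl⟩
    exact ⟨k + l, g * h, SetLike.GradedMul.mul_mem hg hh, map_mul _ _ _⟩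
  add_mem' := by
    rintro _ _ ⟨k, g, hg, rfl⟩ ⟨l, h, hh, rfl⟩
    -- Semi-invariants of different degrees are brought to a common degree by powers of `f`, which
    -- do not change values.
    refine ⟨k + l, g * f ^ l + f ^ k * h,
      add_mem (SetLike.GradedMul.mul_mem hg (pow_mem_semiInvariants hf l))
        (SetLike.GradedMul.mul_mem (pow_mem_semiInvariants hf k) hh), ?_⟩
    simp [hφ]
  algebraMap_mem' c := by
    refine ⟨0, algebraMap ℂ _ c, ?_, AlgHom.commutes _ c⟩
    rw [Algebra.algebraMap_eq_smul_one]
    exact Submodule.smul_mem _ _ SetLike.GradedOne.one_mem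

theorem mem_semiInvariantValues {b : B} : b ∈ semiInvariantValues hf φ hφ ↔
    ∃ k, ∃ g ∈ Q.semiInvariants rel θ k, φ g = b := Iff.rfl

end ArrowQuiver

/-! ### The charts of the moduli space are affine planes. -/

namespace Recon

variable {n : ℕ} (α : Fin n → ℕ) (lam : ℕ → ℕ → ℂ)

/-- The semi-invariant which does not vanish in the chart `s`. -/
noncomputable abbrev chartSection (s : ℕ) : (quiver α).RepRing (StepRel α lam) :=
  sectionVal α lam (Finset.Icc 1 s)

theorem chartSection_mem (s : ℕ) :
    chartSection α lam s ∈ (quiver α).semiInvariants (StepRel α lam) (stability n) 1 :=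
  sectionVal_mem α lam _

theorem chartSection_eq (s : ℕ) : chartSection α lam s = ∏ v ∈ Finset.Icc 1 n,
    if v ≤ s then ∏ u ∈ Finset.range v, aVal α (coordVal α lam) u
      else ∏ u ∈ Finset.Ico v (n + 1), cVal α (coordVal α lam) u := by
  rw [chartSection, sectionVal_eq]
  refine Finset.prod_congr rfl fun v hv => ?_
  simp [(Finset.mem_Icc.1 hv).1]

/-- The universal representation of the chart `s`, whose arrows `a u` with `u < s` and `c u` with
`u > s` are trivialized, and which has the coordinates `a s` and `c s`. -/
structure IsChart (s : ℕ)
    (φ : (quiver α).RepRing (StepRel α lam) →ₐ[ℂ] MvPolynomial (Fin 2) ℂ) : Prop where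
  a_of_lt : ∀ u < s, φ (aVal α (coordVal α lam) u) = 1
  a_self : φ (aVal α (coordVal α lam) s) = MvPolynomial.X 0
  c_of_lt : ∀ u, s < u → u ≤ n → φ (cVal α (coordVal α lam) u) = 1
  c_self : φ (cVal α (coordVal α lam) s) = MvPolynomial.X 1

/-- The condition `Δ` enters here: it is what makes the zigzag produced by the recursion over
`ℂ[x,y]` satisfy all relations, including those at the vertex `0`. -/
theorem exists_isChart (hn : 1 ≤ n)
    (hΔ : ∀ j ≤ numExtra α,
      ∑ t ∈ Finset.range ((kTail α (j + 1) : ℕ) - kTail α j + 2), lam (j + 1) t = 0)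
    {s : ℕ} (hs : s ≤ n) : ∃ φ, IsChart α lam s φ := by
  set D := zigzagData α hn lam with hD
  obtain ⟨z, hz⟩ := D.exists_chartZ s (MvPolynomial.X 0 : MvPolynomial (Fin 2) ℂ)
    (MvPolynomial.X 1) hs
  have h := D.isZigzag_chart hs hz
  set a := D.chartA s (MvPolynomial.X 0 : MvPolynomial (Fin 2) ℂ) z
  set c := D.chartC s (MvPolynomial.X 1 : MvPolynomial (Fin 2) ℂ) z
  set k := D.chartK s z
  have hq : IsZigzag D (aVal α (arrowVal α a c k)) (cVal α (arrowVal α a c k))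
      (kVal α (arrowVal α a c k)) z :=
    h.congr (fun u hu => aVal_arrowVal α a c k hu) (fun u hu => cVal_arrowVal α a c k hu)
      (fun j hj => kVal_arrowVal α a c k h.k_zero h.k_last hj)
  have hrel := stepRel_of_isZigzag α _ lam hn hΔ hq
  have ha : ∀ u ≤ n, (quiver α).repLift _ _ hrel (aVal α (coordVal α lam) u) = a u := fun u hu =>
    ((quiver α).repLift_coord _ _ hrel _).trans (aVal_arrowVal α a c k hu)
  have hc : ∀ u ≤ n, (quiver α).repLift _ _ hrel (cVal α (coordVal α lam) u) = c u := fun u hu =>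
    ((quiver α).repLift_coord _ _ hrel _).trans (cVal_arrowVal α a c k hu)
  refine ⟨(quiver α).repLift _ _ hrel, fun u hu => ?_, ?_, fun u hu hun => ?_, ?_⟩
  · rw [ha u (by omega)]
    exact if_pos hu
  · rw [ha s hs]
    exact (if_neg (lt_irrefl s)).trans (if_pos rfl)
  · rw [hc u hun]
    exact if_pos hu
  · rw [hc s hs]
    exact (if_neg (lt_irrefl s)).trans (if_pos rfl)

namespace IsChart

variable {α lam} {s : ℕ} {φ : (quiver α).RepRing (StepRel α lam) →ₐ[ℂ] MvPolynomial (Fin 2) ℂ}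

theorem isZigzag (hn : 1 ≤ n) : IsZigzag (zigzagData α hn lam)
    (fun u => φ (aVal α (coordVal α lam) u)) (fun u => φ (cVal α (coordVal α lam) u))
    (fun j => φ (kVal α (coordVal α lam) j)) (fun j => φ (zVal α (coordVal α lam) j)) :=
  (isZigzag_coord α lam hn).map φ

theorem z_eq (h : IsChart α lam s φ) (hn : 1 ≤ n) (hs : s ≤ n) (j : ℕ) :
    φ (zVal α (coordVal α lam) j) = (zigzagData α hn lam).chartZ s (MvPolynomial.X 0)
      (MvPolynomial.X 1) (fun j => φ (zVal α (coordVal α lam) j)) j :=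
  (IsZigzag.eq_chart _ (isZigzag hn) hs h.a_of_lt h.a_self h.c_of_lt h.c_self).2.2.2 j

theorem z_zero_ne_zero (h : IsChart α lam s φ) (hn : 1 ≤ n) (hs : s ≤ n) :
    φ (zVal α (coordVal α lam) 0) ≠ 0 :=
  (zigzagData α hn lam).chart_z_zero_ne_zero hs (h.z_eq hn hs)

theorem prod_a (h : IsChart α lam s φ) {v : ℕ} (hv : v ≤ s) :
    φ (∏ u ∈ Finset.range v, aVal α (coordVal α lam) u) = 1 := by
  rw [map_prod]
  exact Finset.prod_eq_one fun u hu => h.a_of_lt u ((Finset.mem_range.1 hu).trans_le hv)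

theorem prod_a_succ (h : IsChart α lam s φ) :
    φ (∏ u ∈ Finset.range (s + 1), aVal α (coordVal α lam) u) = MvPolynomial.X 0 := by
  rw [Finset.prod_range_succ, map_mul, h.prod_a le_rfl, one_mul, h.a_self]

theorem prod_c (h : IsChart α lam s φ) {v : ℕ} (hv : s < v) :
    φ (∏ u ∈ Finset.Ico v (n + 1), cVal α (coordVal α lam) u) = 1 := by
  rw [map_prod]
  refine Finset.prod_eq_one fun u hu => ?_
  rw [Finset.mem_Ico] at hu
  exact h.c_of_lt u (by omega) (by omega)

theorem prod_c_self (h : IsChart α lam s φ) (hs : s ≤ n) :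
    φ (∏ u ∈ Finset.Ico s (n + 1), cVal α (coordVal α lam) u) = MvPolynomial.X 1 := by
  rw [Finset.prod_eq_prod_Ico_succ_bot (by omega), map_mul, h.prod_c (by omega), mul_one,
    h.c_self]

theorem section_eq_one (h : IsChart α lam s φ) : φ (chartSection α lam s) = 1 := by
  rw [chartSection_eq, map_prod]
  refine Finset.prod_eq_one fun v hv => ?_
  split_ifs with hvs
  · exact h.prod_a hvs
  · exact h.prod_c (by omega)

theorem section_succ (h : IsChart α lam s φ) (hs : s < n) :
    φ (chartSection α lam (s + 1)) = MvPolynomial.X 0 := by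
  rw [chartSection_eq, map_prod, Finset.prod_eq_single (s + 1)]
  · rw [if_pos le_rfl, h.prod_a_succ]
  · intro v _ hv
    split_ifs with hvs
    · exact h.prod_a (by omega)
    · exact h.prod_c (by omega)
  · intro hv
    exact absurd (Finset.mem_Icc.2 ⟨by omega, by omega⟩) hv

theorem section_pred (h : IsChart α lam s φ) (h0 : 1 ≤ s) (hs : s ≤ n) :
    φ (chartSection α lam (s - 1)) = MvPolynomial.X 1 := by
  rw [chartSection_eq, map_prod, Finset.prod_eq_single s]
  · rw [if_neg (by omega), h.prod_c_self hs]
  · intro v _ hv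
    split_ifs with hvs
    · exact h.prod_a (by omega)
    · exact h.prod_c (by omega)
  · intro hv
    exact absurd (Finset.mem_Icc.2 ⟨by omega, by omega⟩) hv

theorem z_last (h : IsChart α lam n φ) (hn : 1 ≤ n) :
    φ (zVal α (coordVal α lam) (1 + numExtra α + 1)) = MvPolynomial.X 0 := by
  have := (isZigzag_coord α lam hn).prod_a
  rw [← h.prod_a_succ]
  exact congrArg φ this.symm

theorem z_zero (h : IsChart α lam 0 φ) (hn : 1 ≤ n) :
    φ (zVal α (coordVal α lam) 0) = MvPolynomial.X 1 := by
  have := (isZigzag_coord α lam hn).prod_c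
  rw [← h.prod_c_self (Nat.zero_le _), ← Finset.range_eq_Ico]
  exact congrArg φ this.symm

theorem z_mem_semiInvariants {j : ℕ} (hj : j ≤ 1 + numExtra α + 1) :
    zVal α (coordVal α lam) j ∈
      (quiver α).semiInvariants (StepRel α lam) (stability n) 0 :=
  (quiver α).mem_semiInvariants_zero _ _ ⟨_, zVal_mem_invariants α lam hj⟩

/-- The neighbouring sections restrict to the coordinates: `f_{s+1}` to `x` and `f_{s-1}` to `y`. At
the ends of the chain of charts the full cycles `z_{m+1}` and `z_0` take their place. -/
theorem exists_semiInvariant (h : IsChart α lam s φ) (hn : 1 ≤ n) (hs : s ≤ n)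
    (b : MvPolynomial (Fin 2) ℂ) :
    ∃ k, ∃ g ∈ (quiver α).semiInvariants (StepRel α lam) (stability n) k, φ g = b := by
  rw [← ArrowQuiver.mem_semiInvariantValues (chartSection_mem α lam s) φ h.section_eq_one]
  suffices ⊤ ≤ ArrowQuiver.semiInvariantValues (chartSection_mem α lam s) φ h.section_eq_one from
    this trivial
  rw [← MvPolynomial.adjoin_range_X, Algebra.adjoin_le_iff]
  rintro _ ⟨i, rfl⟩
  fin_cases i
  · rcases hs.lt_or_eq with hs | rfl
    · exact ⟨1, _, chartSection_mem α lam (s + 1), h.section_succ hs⟩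
    · exact ⟨0, _, z_mem_semiInvariants le_rfl, h.z_last hn⟩
  · rcases Nat.eq_zero_or_pos s with rfl | h0
    · exact ⟨0, _, z_mem_semiInvariants (Nat.zero_le _), h.z_zero hn⟩
    · exact ⟨1, _, chartSection_mem α lam (s - 1), h.section_pred h0 hs⟩

/-- A representation on which the section does not vanish comes, up to the action of the group,
from the universal representation of the chart. -/
theorem exists_algHom (h : IsChart α lam s φ) (hn : 1 ≤ n) (hs : s ≤ n) {L : Type*} [CommRing L]
    [Algebra ℂ L] (i : (quiver α).RepRing (StepRel α lam) →ₐ[ℂ] L)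
    (hi : IsUnit (i (chartSection α lam s))) :
    ∃ ψ : MvPolynomial (Fin 2) ℂ →ₐ[ℂ] L, ∀ k,
      ∀ g ∈ (quiver α).semiInvariants (StepRel α lam) (stability n) k,
        i g = i (chartSection α lam s) ^ k * ψ (φ g) := by
  classical
  let A : ℕ → L := fun u => i (aVal α (coordVal α lam) u)
  let C : ℕ → L := fun u => i (cVal α (coordVal α lam) u)
  let K : ℕ → L := fun j => i (kVal α (coordVal α lam) j)
  -- The gauge: rescaling at `v` by the value of the path from `0` to `v` that occurs in the section
  -- turns the arrows of these paths into `1`. The values are units because they divide the section.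
  let t : ℕ → L := fun v =>
    if v ≤ s then ∏ u ∈ Finset.range v, A u else ∏ u ∈ Finset.Ico v (n + 1), C u
  have hft : i (chartSection α lam s) = ∏ v ∈ Finset.Icc 1 n, t v := by
    rw [chartSection_eq, map_prod]
    refine Finset.prod_congr rfl fun v _ => ?_
    simp only [t]
    split_ifs <;> rw [map_prod]
  have ht : ∀ v ≤ n + 1, IsUnit (t v) := by
    intro v hv
    by_cases hv' : v ∈ Finset.Icc 1 n
    · exact isUnit_of_dvd_unit (hft ▸ Finset.dvd_prod_of_mem t hv') hi
    · rw [Finset.mem_Icc] at hv'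
      obtain rfl | rfl : v = 0 ∨ v = n + 1 := by omega
      · simp [t]
      · simp [t, show ¬ n + 1 ≤ s by omega]
  let G : ℕ → Lˣ := fun v => if hv : IsUnit (t v) then hv.unit else 1
  have hG : ∀ v ≤ n + 1, (G v : L) = t v := fun v hv => by simp only [G, dif_pos (ht v hv)]; rfl
  have hG0 : G 0 = 1 := Units.ext (by rw [hG 0 (Nat.zero_le _)]; simp [t])
  have hGn : G (n + 1) = 1 := Units.ext (by
    rw [hG _ le_rfl]
    simp [t, show ¬ n + 1 ≤ s by omega])
  have hz1 := ((isZigzag_coord α lam hn).map i).twist G hG0 hGn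
  let ψ : MvPolynomial (Fin 2) ℂ →ₐ[ℂ] L := MvPolynomial.aeval
    ![G s * A s * (↑(G (s + 1))⁻¹ : L), G (s + 1) * C s * (↑(G s)⁻¹ : L)]
  have hz2 := (isZigzag (φ := φ) hn).map ψ
  obtain ⟨h1, h2, h3, -⟩ := IsZigzag.chart_unique (s := s) hs hz1 hz2
    (fun u hu => by
      rw [hG u (by omega), Units.mul_inv_eq_iff_eq_mul, hG (u + 1) (by omega)]
      simp only [t]
      rw [if_pos (by omega), if_pos (by omega), Finset.prod_range_succ, one_mul])
    (fun u hu hun => by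
      replace hun : u ≤ n := hun
      rw [hG (u + 1) (Nat.succ_le_succ hun), Units.mul_inv_eq_iff_eq_mul,
        hG u (hun.trans (Nat.le_succ _))]
      simp only [t]
      rw [if_neg (by omega), if_neg (by omega), one_mul,
        Finset.prod_eq_prod_Ico_succ_bot (a := u) (b := n + 1) (by omega), mul_comm])
    (fun u hu => by rw [h.a_of_lt u hu, map_one])
    (fun u hu hun => by rw [h.c_of_lt u hu hun, map_one])
    (by rw [h.a_self]; simp [ψ, A]) (by rw [h.c_self]; simp [ψ, C])
  have hGv : ∀ v ≤ n + 1, G (Fin.ofNat (n + 1) v : Fin (n + 1)) = G v := by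
    intro v hv
    rcases hv.lt_or_eq with hv | rfl
    · rw [Fin.val_ofNat, Nat.mod_eq_of_lt hv]
    · rw [ofNat_succ_self, hGn]
      exact hG0
  have hGs : ∀ v : Fin (n + 1), G (v + 1 : Fin (n + 1)) = G ((v : ℕ) + 1) := by
    intro v
    conv_lhs => rw [← ofNat_val v, ofNat_add_one]
    exact hGv _ (by omega)
  have harr : ∀ e, (G ((quiver α).tail e) : L) * i (coordVal α lam e) *
      (↑(G ((quiver α).head e))⁻¹ : L) = ψ (φ (coordVal α lam e)) := by
    intro e
    rcases e with v | v | j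
    · have h4 := h2 (v - 1 : Fin (n + 1)) (Nat.lt_succ_iff.1 (Fin.is_lt _))
      have h5 := hGs (v - 1)
      rw [sub_add_cancel] at h5
      simp only [cVal, ← ofNat_add_one, ofNat_val, sub_add_cancel, ← h5] at h4
      exact h4
    · have h4 := h1 v (Nat.lt_succ_iff.1 (Fin.is_lt _))
      simp only [aVal, ofNat_val, ← hGs] at h4
      exact h4
    · have h4 := h3 (j + 1) (show (j : ℕ) + 1 ≤ 1 + numExtra α by omega)
      have h5 : kArrow α (j + 1) = .k j := by simp [kArrow]
      simp only [kVal, h5] at h4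
      change _ * _ * (↑(G (0 : Fin (n + 1)))⁻¹ : L) = _
      rw [show G (0 : Fin (n + 1)) = 1 from hG0, inv_one, Units.val_one, mul_one]
      exact h4
  refine ⟨ψ, fun k g hg => ?_⟩
  rw [ArrowQuiver.semiInvariants_eq_span] at hg
  induction hg using Submodule.span_induction with
  | zero => simp
  | add x y _ _ hx hy => rw [map_add, map_add, map_add, hx, hy, mul_add]
  | smul c x _ hx => rw [map_smul, map_smul, map_smul, hx, mul_smul_comm]
  | mem x hx =>
    obtain ⟨d, hd, rfl⟩ := hx
    have h4 := (quiver α).aeval_twist (fun e => i (coordVal α lam e))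
      (fun v : Fin (n + 1) => G v) d 1
    simp only [harr] at h4
    have h5 : ∀ (F : (quiver α).RepRing (StepRel α lam) →ₐ[ℂ] L) (P : MvPolynomial _ ℂ),
        F (MvPolynomial.aeval (coordVal α lam) P) =
          MvPolynomial.aeval (fun e => F (coordVal α lam e)) P :=
      fun F P => (MvPolynomial.comp_aeval_apply _ _ _)
    rw [ArrowQuiver.mk_eq_aeval_coord, h5 i, show ψ (φ _) = _ from h5 (ψ.comp φ) _]
    refine ((Units.inv_mul_eq_iff_eq_mul _).1 h4.symm).trans ?_
    congr 1
    -- In weight `kθ` the gauge contributes `t v ^ k` at each nonzero vertex and nothing at `0`,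
    -- hence the `k`-th power of the section.
    have h6 : ∏ v ∈ Finset.Icc 1 n, t v = ∏ v : Fin n, t (v + 1) := by
      rw [Fin.prod_univ_eq_prod_range (fun v => t (v + 1)) n, Finset.range_eq_Ico,
        Finset.prod_Ico_add' t 0 n 1]
      rfl
    rw [hd, hft, h6, Fin.prod_univ_succ, ← Finset.prod_pow]
    simp only [Fin.val_zero, hG0, one_zpow, one_mul, Units.coe_prod]
    refine Finset.prod_congr rfl fun v _ => ?_
    rw [Pi.smul_apply, stability, if_neg (Fin.succ_ne_zero v), nsmul_one, zpow_natCast,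
      Units.val_pow_eq_pow_val, Fin.val_succ, hG _ (by omega)]

/-- Semi-invariants are determined, away from the zeros of the section, by their values on the
universal representation of the chart. -/
theorem exists_pow_mul_eq_zero (h : IsChart α lam s φ) (hn : 1 ≤ n) (hs : s ≤ n) (k : ℕ)
    (g : (quiver α).RepRing (StepRel α lam))
    (hg : g ∈ (quiver α).semiInvariants (StepRel α lam) (stability n) k) (h0 : φ g = 0) :
    ∃ M, chartSection α lam s ^ M * g = 0 := by
  -- Applied to the universal representation with the section inverted: there `g` equals a unit
  -- times the image of `φ g`, so it vanishes in the localization.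
  obtain ⟨ψ, hψ⟩ := h.exists_algHom hn hs
    (IsScalarTower.toAlgHom ℂ _ (Localization.Away (chartSection α lam s)))
    (IsLocalization.Away.algebraMap_isUnit (chartSection α lam s))
  have h1 := hψ k g hg
  rw [h0, map_zero, mul_zero] at h1
  obtain ⟨⟨_, M, rfl⟩, hM⟩ := (IsLocalization.map_eq_zero_iff
    (Submonoid.powers (chartSection α lam s)) (Localization.Away (chartSection α lam s)) g).1 h1
  exact ⟨M, hM⟩

theorem bijective (h : IsChart α lam s φ) (hn : 1 ≤ n) (hs : s ≤ n) : Function.Bijective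
    (ArrowQuiver.chartHom (chartSection_mem α lam s) φ h.section_eq_one) :=
  ArrowQuiver.chartHom_bijective _ _ _ (h.exists_semiInvariant hn hs)
    (h.exists_pow_mul_eq_zero hn hs)

end IsChart

end Recon

/-! ### Resolutions of singularities of affine schemes from regular affine charts -/

section Charts

theorem isRegularLocalRing_stalk_of_isOpenImmersion {X : Scheme.{0}} {B : Type} [CommRing B]
    [IsRegularRing B] (j : Spec (CommRingCat.of B) ⟶ X) [IsOpenImmersion j]
    (y : Spec (CommRingCat.of B)) : IsRegularLocalRing (X.presheaf.stalk (j y)) := by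
  have : y.asIdeal.IsPrime := PrimeSpectrum.isPrime y
  have : IsRegularLocalRing (Localization.AtPrime y.asIdeal) :=
    IsRegularRing.isRegularLocalRing_localization _
  exact .of_ringEquiv <| ((Spec.stalkIso (CommRingCat.of B) y).commRingCatIsoToRingEquiv.symm.trans
    (asIso (j.stalkMap y)).commRingCatIsoToRingEquiv.symm :
      Localization.AtPrime y.asIdeal ≃+* X.presheaf.stalk (j y))

theorem isReduced_of_charts {X : Scheme.{0}} {I : Type*} {B : I → Type} [∀ i, CommRing (B i)]
    [∀ i, IsDomain (B i)] (j : ∀ i, Spec (CommRingCat.of (B i)) ⟶ X)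
    [∀ i, IsOpenImmersion (j i)] (hcov : ∀ x, ∃ i, x ∈ Set.range (j i)) : IsReduced X := by
  have (x : X) : _root_.IsReduced (X.presheaf.stalk x) := by
    obtain ⟨i, y, rfl⟩ := hcov x
    exact isReduced_of_injective _
      (asIso ((j i).stalkMap y)).commRingCatIsoToRingEquiv.injective
  exact isReduced_of_isReduced_stalk X

/-- A space is irreducible if it is covered by irreducible open subsets all of which meet an open
subset of one of them. -/
theorem irreducibleSpace_of_cover {X I : Type*} [TopologicalSpace X] (U : I → Set X)
    (hirr : ∀ i, IsPreirreducible (U i)) (hcov : ∀ x, ∃ i, x ∈ U i)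
    {V : Set X} (hV : IsOpen V) (i₀ : I) (hVU : V ⊆ U i₀) (hne : ∀ i, (U i ∩ V).Nonempty) :
    IrreducibleSpace X := by
  -- A nonempty open `W` meets some `U i`, and inside this irreducible set it must meet `V`. So any
  -- two nonempty open sets can be compared inside `U i₀`.
  have key : ∀ W : Set X, IsOpen W → W.Nonempty → (U i₀ ∩ (W ∩ V)).Nonempty := by
    rintro W hW ⟨x, hx⟩
    obtain ⟨i, hi⟩ := hcov x
    obtain ⟨y, -, hyW, hyV⟩ := hirr i W V hW hV ⟨x, hi, hx⟩ (hne i)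
    exact ⟨y, hVU hyV, hyW, hyV⟩
  have : PreirreducibleSpace X := by
    constructor
    intro W W' hW hW' ⟨x, _, hx⟩ ⟨x', _, hx'⟩
    obtain ⟨y, -, ⟨hy, -⟩, hy', -⟩ := hirr i₀ _ _ (hW.inter hV) (hW'.inter hV)
      (key W hW ⟨x, hx⟩) (key W' hW' ⟨x', hx'⟩)
    exact ⟨y, trivial, hy, hy'⟩
  exact { toNonempty := (hne i₀).nonempty }

theorem isPreirreducible_range_of_isDomain {X : Scheme.{0}} {B : Type} [CommRing B] [IsDomain B]
    (j : Spec (CommRingCat.of B) ⟶ X) : IsPreirreducible (Set.range j) := by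
  have : IrreducibleSpace (PrimeSpectrum B) := inferInstance
  have h : IsPreirreducible (Set.univ : Set (Spec (CommRingCat.of B))) :=
    this.toPreirreducibleSpace.isPreirreducible_univ
  rw [← Set.image_univ]
  exact h.image _ j.continuous.continuousOn

/-- A ring homomorphism which becomes bijective after inverting `z` induces an isomorphism
over the basic open subset of `z`. -/
theorem isIso_morphismRestrict_specMap {R B : Type} [CommRing R] [CommRing B] (ψ : R →+* B) (z : R)
    (hinj : Function.Injective ψ)
    (hsurj : ∀ b, ∃ N r, ψ z ^ N * b = ψ r) :
    IsIso (Spec.map (CommRingCat.ofHom ψ) ∣_ (PrimeSpectrum.basicOpen z)) := by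
  have h : IsIso (Spec.map <| CommRingCat.ofHom
      (Localization.awayMap (CommRingCat.ofHom ψ).hom z)) := by
    have hb : Function.Bijective (Localization.awayMap ψ z) := by
      constructor
      · refine Localization.awayMap_injective_iff.2 fun r hr => ⟨0, ?_⟩
        rw [(map_eq_zero_iff ψ hinj).1 hr, mul_zero]
      · refine Localization.awayMap_surjective_iff.2 fun b => ?_
        obtain ⟨N, r, hr⟩ := hsurj b
        exact ⟨r, N, hr.symm⟩
    have : IsIso (CommRingCat.ofHom (Localization.awayMap ψ z)) :=
      (ConcreteCategory.isIso_iff_bijective _).2 hb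
    exact inferInstanceAs (IsIso (Spec.map (CommRingCat.ofHom (Localization.awayMap ψ z))))
  exact ((MorphismProperty.isomorphisms Scheme).arrow_mk_iso_iff
    (SpecMapRestrictBasicOpenIso (CommRingCat.ofHom ψ) z)).2 h

/-- Over the basic open set of `z` only the chart `i₀` remains, and there the morphism is an
isomorphism of localizations. Every chart is integral and meets the preimage of this set at its
generic point, so `X` is irreducible; reducedness and regularity are local. -/
theorem isResolutionOfSingularities_of_charts {X : Scheme.{0}} {R : Type} [CommRing R] [IsDomain R]
    (π : X ⟶ Spec (CommRingCat.of R)) [IsProper π] {I : Type*} {B : I → Type}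
    [∀ i, CommRing (B i)] [∀ i, IsDomain (B i)] [∀ i, IsRegularRing (B i)]
    (j : ∀ i, Spec (CommRingCat.of (B i)) ⟶ X) [∀ i, IsOpenImmersion (j i)]
    (hcov : ∀ x, ∃ i, x ∈ Set.range (j i)) (ψ : ∀ i, R →+* B i)
    (hψ : ∀ i, j i ≫ π = Spec.map (CommRingCat.ofHom (ψ i))) (z : R) (hz : ∀ i, ψ i z ≠ 0)
    (i₀ : I) (hi₀ : ∀ x, π x ∈ PrimeSpectrum.basicOpen z → x ∈ Set.range (j i₀))
    (hinj : Function.Injective (ψ i₀)) (hsurj : ∀ b, ∃ N r, ψ i₀ z ^ N * b = ψ i₀ r) :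
    IsResolutionOfSingularities π := by
  let U : (Spec (CommRingCat.of R)).Opens := PrimeSpectrum.basicOpen z
  have hred := isReduced_of_charts j hcov
  have hmeet : ∀ i, (Set.range (j i) ∩ ((π ⁻¹ᵁ U : X.Opens) : Set X)).Nonempty := by
    intro i
    obtain ⟨p, hp⟩ : ∃ p : Spec (CommRingCat.of (B i)), p.asIdeal = ⊥ :=
      ⟨(⊥ : PrimeSpectrum (B i)), rfl⟩
    refine ⟨_, ⟨p, rfl⟩, ?_⟩
    change π (j i p) ∈ U
    rw [← Scheme.Hom.comp_apply, hψ i]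
    change z ∉ Ideal.comap (ψ i) p.asIdeal
    simpa [hp] using hz i
  have hirr : IrreducibleSpace X := irreducibleSpace_of_cover (fun i => Set.range (j i))
    (fun i => isPreirreducible_range_of_isDomain (j i))
    hcov (π ⁻¹ᵁ U).isOpen i₀ (fun x hx => hi₀ x hx) hmeet
  have hz0 : z ≠ 0 := by
    rintro rfl
    exact hz i₀ (map_zero _)
  -- An open immersion that is surjective over the preimage of `U` is an isomorphism there.
  have hsurj' : IsIso ((j i₀) ∣_ (π ⁻¹ᵁ U)) := by
    have : Function.Surjective ((j i₀) ∣_ (π ⁻¹ᵁ U)) := by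
      rintro ⟨x, hx⟩
      obtain ⟨y, rfl⟩ := hi₀ x hx
      exact ⟨⟨y, hx⟩, Subtype.ext (morphismRestrict_base_coe _ _ _)⟩
    have : Surjective ((j i₀) ∣_ (π ⁻¹ᵁ U)) := ⟨this⟩
    exact (isIso_iff_isOpenImmersion_and_epi_base _).2 ⟨inferInstance, inferInstance⟩
  refine ⟨isIntegral_of_irreducibleSpace_of_isReduced X, inferInstance, inferInstance,
    ⟨U, ?_, ?_, ?_⟩, fun x => ?_⟩
  · have : IrreducibleSpace (PrimeSpectrum R) := inferInstance
    exact (PrimeSpectrum.basicOpen z).isOpen.dense ⟨(⊥ : PrimeSpectrum R), by simpa using hz0⟩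
  · exact (π ⁻¹ᵁ U).isOpen.dense ((hmeet i₀).mono Set.inter_subset_right)
  · have h1 := morphismRestrict_comp (j i₀) π U
    have h2 : IsIso ((j i₀ ≫ π) ∣_ U) := by
      rw [hψ i₀]
      exact isIso_morphismRestrict_specMap (ψ i₀) z hinj hsurj
    rw [h1] at h2
    exact @IsIso.of_isIso_comp_left _ _ _ _ _ ((j i₀) ∣_ (π ⁻¹ᵁ U)) (π ∣_ U) hsurj' h2
  · obtain ⟨i, y, rfl⟩ := hcov x
    exact isRegularLocalRing_stalk_of_isOpenImmersion (j i) y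

end Charts

/-! ### The canonical morphism in charts, the covering criterion and properness. -/

namespace ArrowQuiver

variable {V E : Type} [Fintype V] [DecidableEq V] (Q : ArrowQuiver V E)
  (rel : Q.PathAlgebra → Q.PathAlgebra → Prop) (θ : V → ℤ)

theorem mem_invariants_of_mem_semiInvariants_zero {f : Q.RepRing rel}
    (hf : f ∈ Q.semiInvariants rel θ 0) : f ∈ Q.invariants rel := fun μ => by
  simpa using hf μ

theorem invariantsToZero_bijective : Function.Bijective (Q.invariantsToZero rel θ) := by
  constructor
  · intro f g h
    have h1 := congrArg (fun x => Q.total rel θ x.1) h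
    change Q.total rel θ (Q.homogeneous rel θ 0 _) = Q.total rel θ (Q.homogeneous rel θ 0 _) at h1
    rw [total_homogeneous, total_homogeneous] at h1
    exact Subtype.ext h1
  · rintro ⟨_, f, rfl⟩
    exact ⟨⟨f, Q.mem_invariants_of_mem_semiInvariants_zero rel θ f.2⟩, rfl⟩

instance isIso_specMap_invariantsToZero :
    IsIso (Spec.map (CommRingCat.ofHom (Q.invariantsToZero rel θ))) := by
  have : IsIso (CommRingCat.ofHom (Q.invariantsToZero rel θ)) :=
    (ConcreteCategory.isIso_iff_bijective _).2 (Q.invariantsToZero_bijective rel θ)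
  infer_instance

variable {Q rel θ}

/-- The action of the invariants on the functions on a chart. -/
noncomputable def invariantsToChart {f : Q.RepRing rel} (hf : f ∈ Q.semiInvariants rel θ 1) :
    Q.invariants rel →+* ChartRing hf :=
  (HomogeneousLocalization.fromZeroRingHom _ _).comp (Q.invariantsToZero rel θ)

theorem chartHom_invariantsToChart {f : Q.RepRing rel} (hf : f ∈ Q.semiInvariants rel θ 1)
    {B : Type*} [CommRing B] [Algebra ℂ B] (φ : Q.RepRing rel →ₐ[ℂ] B) (hφ : φ f = 1)
    (r : Q.invariants rel) : chartHom hf φ hφ (invariantsToChart hf r) = φ r := by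
  rw [← chartHom_chartFrac hf φ hφ 0 ⟨r, Q.mem_semiInvariants_zero rel θ r⟩]
  congr 1

/-- The affine chart of the moduli space where the section `f` does not vanish. -/
noncomputable def chartι {f : Q.RepRing rel} (hf : f ∈ Q.semiInvariants rel θ 1) :
    Spec (CommRingCat.of (ChartRing hf)) ⟶ Q.gitQuotient rel θ :=
  Proj.awayι (Q.semiInvariantGrading rel θ) _ (homogeneous_mem 1 ⟨f, hf⟩) one_pos

instance {f : Q.RepRing rel} (hf : f ∈ Q.semiInvariants rel θ 1) : IsOpenImmersion (chartι hf) :=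
  inferInstanceAs (IsOpenImmersion (Proj.awayι _ _ _ _))

theorem chartι_gitToAffine {f : Q.RepRing rel} (hf : f ∈ Q.semiInvariants rel θ 1) :
    chartι hf ≫ Q.gitToAffine rel θ = Spec.map (CommRingCat.ofHom (invariantsToChart hf)) := by
  have := Proj.awayι_toSpecZero_assoc (Q.semiInvariantGrading rel θ) _
    (homogeneous_mem 1 ⟨f, hf⟩) one_pos (Spec.map (CommRingCat.ofHom (Q.invariantsToZero rel θ)))
  rw [← Spec.map_comp] at this
  exact this

theorem chartι_mem_range_iff {f g : Q.RepRing rel} (hf : f ∈ Q.semiInvariants rel θ 1)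
    (hg : g ∈ Q.semiInvariants rel θ 1) (y : Spec (CommRingCat.of (ChartRing hf))) :
    chartι hf y ∈ Set.range (chartι hg) ↔ chartFrac hf 1 ⟨g, hg⟩ ∉ y.asIdeal := by
  have h1 := Proj.awayι_preimage_basicOpen (Q.semiInvariantGrading rel θ)
    (homogeneous_mem 1 ⟨f, hf⟩) one_pos (homogeneous_mem 1 ⟨g, hg⟩) one_pos
  have h2 := Proj.opensRange_awayι (Q.semiInvariantGrading rel θ) _
    (homogeneous_mem 1 ⟨g, hg⟩) one_pos
  rw [← h2] at h1
  have h3 : HomogeneousLocalization.Away.isLocalizationElem (homogeneous_mem 1 ⟨f, hf⟩)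
      (homogeneous_mem 1 ⟨g, hg⟩) = chartFrac hf 1 ⟨g, hg⟩ := by
    apply HomogeneousLocalization.val_injective
    rw [chartFrac, HomogeneousLocalization.Away.val_mk, HomogeneousLocalization.Away.val_mk]
    simp only [pow_one]
  rw [h3] at h1
  exact Iff.of_eq (congrArg (y ∈ ·) h1)

/-- If the semi-invariants are generated over the invariants by sections of degree one, then the
moduli space is covered by the charts of these sections. -/
theorem exists_mem_range_chartι {I : Type*} (f : I → Q.RepRing rel)
    (hf : ∀ i, f i ∈ Q.semiInvariants rel θ 1)
    (hgen : Algebra.adjoin (Q.semiInvariantGrading rel θ 0)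
      (Set.range fun i => Q.homogeneous rel θ 1 ⟨f i, hf i⟩) = ⊤) (x : Q.gitQuotient rel θ) :
    ∃ i, x ∈ Set.range (chartι (hf i)) := by
  change ↥(Proj (Q.semiInvariantGrading rel θ)) at x
  have h1 := Proj.iSup_basicOpen_eq_top' (Q.semiInvariantGrading rel θ)
    (fun i => Q.homogeneous rel θ 1 ⟨f i, hf i⟩) (fun i => ⟨1, homogeneous_mem _ _⟩) hgen
  have h2 : x ∈ (⊤ : (Proj (Q.semiInvariantGrading rel θ)).Opens) := trivial
  rw [← h1, TopologicalSpace.Opens.mem_iSup] at h2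
  obtain ⟨i, hi⟩ := h2
  rw [← Proj.opensRange_awayι (Q.semiInvariantGrading rel θ) _
    (homogeneous_mem 1 ⟨f i, hf i⟩) one_pos] at hi
  exact ⟨i, hi⟩

/-- If finitely many elements generate the semi-invariants over the invariants, then the moduli
space is proper over the affine quotient. -/
theorem isProper_gitToAffine {I : Type*} [Finite I] (F : I → Q.SemiInvariantRing rel θ)
    (hgen : Algebra.adjoin (Q.semiInvariantGrading rel θ 0) (Set.range F) = ⊤) :
    IsProper (Q.gitToAffine rel θ) := by
  have : Algebra.FiniteType (Q.semiInvariantGrading rel θ 0) (Q.SemiInvariantRing rel θ) :=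
    ⟨Subalgebra.fg_def.2 ⟨_, Set.finite_range F, hgen⟩⟩
  exact inferInstanceAs (IsProper (Proj.toSpecZero (Q.semiInvariantGrading rel θ) ≫
    Spec.map (CommRingCat.ofHom (Q.invariantsToZero rel θ))))

end ArrowQuiver

/-! ### Generation by the chart sections, birationality and the resolution. -/

namespace Recon

variable {n : ℕ} (α : Fin n → ℕ) (lam : ℕ → ℕ → ℂ)

theorem mon_mem_semiInvariants {k : ℕ} {d : Arrow n (numExtra α) →₀ ℕ}
    (hd : (quiver α).weight d = k • stability n) : (quiver α).mon (StepRel α lam) d ∈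
      (quiver α).semiInvariants (StepRel α lam) (stability n) k := by
  rw [ArrowQuiver.semiInvariants_eq_span]
  exact Submodule.subset_span ⟨d, hd, rfl⟩

/-- The semi-invariants are generated over the invariants by the sections which define the
charts. -/
theorem adjoin_chartSection : Algebra.adjoin
    ((quiver α).semiInvariantGrading (StepRel α lam) (stability n) 0)
    (Set.range fun s : Fin (n + 1) => (quiver α).homogeneous (StepRel α lam) (stability n) 1
      ⟨chartSection α lam s, chartSection_mem α lam s⟩) = ⊤ := by
  rw [← top_le_iff]
  set S := Algebra.adjoin ((quiver α).semiInvariantGrading (StepRel α lam) (stability n) 0)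
    (Set.range fun s : Fin (n + 1) => (quiver α).homogeneous (StepRel α lam) (stability n) 1
      ⟨chartSection α lam s, chartSection_mem α lam s⟩)
  have hzero : ∀ g, (quiver α).homogeneous (StepRel α lam) (stability n) 0 g ∈ S := fun g =>
    S.algebraMap_mem ⟨_, ArrowQuiver.homogeneous_mem 0 g⟩
  have hprod : ∀ k (s : ℕ → ℕ), (∀ i, s i ≤ n) → ∀ h,
      (quiver α).homogeneous (StepRel α lam) (stability n) k
        ⟨∏ i ∈ Finset.range k, chartSection α lam (s i), h⟩ ∈ S := by
    intro k s hs
    induction k with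
    | zero => exact fun h => hzero _
    | succ k ih =>
      intro h
      have hk : ∏ i ∈ Finset.range k, chartSection α lam (s i) ∈
          (quiver α).semiInvariants (StepRel α lam) (stability n) k := by
        simpa using SetLike.prod_mem_graded (A := (quiver α).semiInvariants (StepRel α lam)
          (stability n)) (fun _ => 1) (fun i => chartSection α lam (s i)) (F := Finset.range k)
          fun i _ => chartSection_mem α lam (s i)
      have h1 := mul_mem (ih hk) (Algebra.subset_adjoin
        ⟨⟨s k, Nat.lt_succ_of_le (hs k)⟩, rfl⟩ : (quiver α).homogeneous (StepRel α lam)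
          (stability n) 1 ⟨chartSection α lam (s k), chartSection_mem α lam (s k)⟩ ∈ S)
      rw [ArrowQuiver.homogeneous_mul] at h1
      convert! h1 using 2
      exact Subtype.ext (Finset.prod_range_succ _ _)
  have hhom : ∀ k g, (quiver α).homogeneous (StepRel α lam) (stability n) k g ∈ S := by
    rintro k ⟨g, hg⟩
    have hg' := hg
    rw [ArrowQuiver.semiInvariants_eq_span] at hg'
    induction hg' using Submodule.span_induction with
    | zero =>
      rw [show (⟨0, hg⟩ : (quiver α).semiInvariants (StepRel α lam) (stability n) k) = 0 from rfl,
        map_zero]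
      exact zero_mem _
    | add x y hx hy hx' hy' =>
      rw [← ArrowQuiver.semiInvariants_eq_span] at hx hy
      rw [show (⟨x + y, hg⟩ : (quiver α).semiInvariants (StepRel α lam) (stability n) k) =
        ⟨x, hx⟩ + ⟨y, hy⟩ from rfl, map_add]
      exact add_mem (hx' hx) (hy' hy)
    | smul c x hx hx' =>
      rw [← ArrowQuiver.semiInvariants_eq_span] at hx
      have h1 := mul_mem (hzero ⟨c • 1, Submodule.smul_mem _ _ SetLike.GradedOne.one_mem⟩) (hx' hx)
      rw [ArrowQuiver.homogeneous_mul] at h1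
      rwa [ArrowQuiver.homogeneous_eq _ ⟨c • x, hg⟩ (zero_add k) (by simp)] at h1
    | mem x hx =>
      obtain ⟨d, hd, rfl⟩ := hx
      obtain ⟨d₀, s, hd₀, hs, rfl⟩ := exists_mon_eq_of_weight α hd
      have hmon : (quiver α).mon (StepRel α lam)
          (∑ i ∈ Finset.range k, sectionExp α (Finset.Icc 1 (s i))) ∈
          (quiver α).semiInvariants (StepRel α lam) (stability n) k := by
        apply mon_mem_semiInvariants
        rwa [map_add, hd₀, zero_add] at hd
      have h1 := hmon
      rw [ArrowQuiver.mon_sum] at h1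
      have h2 := mul_mem (hzero ⟨(quiver α).mon (StepRel α lam) d₀,
        mon_mem_semiInvariants α lam (by rw [hd₀, zero_smul])⟩) (hprod k s hs h1)
      rw [ArrowQuiver.homogeneous_mul] at h2
      rwa [ArrowQuiver.homogeneous_eq _ ⟨_, hg⟩ (zero_add k) ?_] at h2
      change _ * ∏ i ∈ Finset.range k, (quiver α).mon _ _ = (quiver α).mon _ _
      rw [ArrowQuiver.mon_add, ArrowQuiver.mon_sum]
  intro x _
  induction x using ArrowQuiver.semiInvariantRing_induction with
  | zero => exact zero_mem _
  | hom k f => exact hhom k f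
  | add x y hx hy => exact add_mem (hx trivial) (hy trivial)

namespace IsChart

variable {α lam} {s : ℕ} {φ : (quiver α).RepRing (StepRel α lam) →ₐ[ℂ] MvPolynomial (Fin 2) ℂ}

/-- The coordinates of the chart. -/
noncomputable def ringEquiv (h : IsChart α lam s φ) (hn : 1 ≤ n) (hs : s ≤ n) :
    ArrowQuiver.ChartRing (chartSection_mem α lam s) ≃+* MvPolynomial (Fin 2) ℂ :=
  RingEquiv.ofBijective _ (h.bijective hn hs)

/-- The invariants are determined by their values in the chart `0`. -/
theorem injOn_invariants (h : IsChart α lam 0 φ) (hn : 1 ≤ n) :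
    Function.Injective fun r : (quiver α).invariants (StepRel α lam) => φ r := by
  refine (injective_iff_map_eq_zero
    (φ.comp ((quiver α).invariants (StepRel α lam)).val)).2 fun r hr => Subtype.ext ?_
  exact (isZigzag_coord α lam hn).eq_zero_of_chart_zero φ (h.z_eq hn (Nat.zero_le _))
    (mem_cycleAlgebra_of_mem_invariants α lam hn r.2) hr

theorem z_one (h : IsChart α lam 0 φ) (hn : 1 ≤ n) :
    φ (zVal α (coordVal α lam) 1) = MvPolynomial.X 0 * MvPolynomial.X 1 := by
  have h1 := (isZigzag (φ := φ) hn).pair 0 (Nat.zero_le _)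
  rw [(zigzagData α hn lam).ι_zero, (zigzagData α hn lam).η_zero, h.a_self, h.c_self, map_zero,
    add_zero] at h1
  exact h1.symm

/-- Every function on the chart `0` becomes an invariant after multiplication with a power of
the first invariant. -/
theorem exists_pow_mul_eq (h : IsChart α lam 0 φ) (hn : 1 ≤ n) (p : MvPolynomial (Fin 2) ℂ) :
    ∃ N, ∃ r : (quiver α).invariants (StepRel α lam),
      φ (zVal α (coordVal α lam) 0) ^ N * p = φ r := by
  rw [h.z_zero hn]
  induction p using MvPolynomial.induction_on with
  | C c => exact ⟨0, algebraMap ℂ _ c, by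
      rw [pow_zero, one_mul]
      exact (φ.commutes c).symm⟩
  | add p q hp hq =>
    obtain ⟨N, r, hr⟩ := hp
    obtain ⟨M, t, ht⟩ := hq
    let z : (quiver α).invariants (StepRel α lam) :=
      ⟨_, zVal_mem_invariants α lam (Nat.zero_le _)⟩
    refine ⟨N + M, z ^ M * r + z ^ N * t, ?_⟩
    simp only [Subalgebra.coe_add, Subalgebra.coe_mul, Subalgebra.coe_pow, map_add, map_mul,
      map_pow, ← hr, ← ht, z, h.z_zero hn]
    ring
  | mul_X p i hp =>
    obtain ⟨N, r, hr⟩ := hp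
    fin_cases i
    -- The coordinate `x` is available only through `z 1 = x y`, at the cost of one more factor `y =
    -- z 0`.
    · refine ⟨N + 1, r * ⟨_, zVal_mem_invariants α lam (j := 1) (by omega)⟩, ?_⟩
      simp only [Subalgebra.coe_mul, map_mul, ← hr, h.z_one hn, Fin.zero_eta]
      ring
    · refine ⟨N, r * ⟨_, zVal_mem_invariants α lam (j := 0) (by omega)⟩, ?_⟩
      simp only [Subalgebra.coe_mul, map_mul, ← hr, h.z_zero hn, Fin.mk_one]
      ring

end IsChart

/-- Each factor `C_{0v}` of this section is part of the full clockwise cycle `z 0`. Consequently the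
locus `z 0 ≠ 0` lies entirely in the chart `0`. -/
theorem chartSection_zero_dvd (hn : 1 ≤ n) :
    chartSection α lam 0 ∣ zVal α (coordVal α lam) 0 ^ n := by
  have h1 : zVal α (coordVal α lam) 0 = ∏ u ∈ Finset.range (n + 1), cVal α (coordVal α lam) u :=
    (isZigzag_coord α lam hn).prod_c.symm
  have h2 : zVal α (coordVal α lam) 0 ^ n =
      ∏ _v ∈ Finset.Icc 1 n, zVal α (coordVal α lam) 0 := by simp
  rw [h2, chartSection_eq]
  refine Finset.prod_dvd_prod_of_dvd _ _ fun v hv => ?_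
  rw [Finset.mem_Icc] at hv
  rw [if_neg (by omega), h1]
  exact Finset.prod_dvd_prod_of_subset _ _ _ fun u hu =>
    Finset.mem_range.2 (Finset.mem_Ico.1 hu).2

/-- The canonical morphism is a resolution of singularities, for parameters which satisfy the
conditions imposed by the combinatorics of the quiver. -/
theorem isResolutionOfSingularities_resolutionMap (hn : 1 ≤ n)
    (hΔ : ∀ j ≤ numExtra α,
      ∑ t ∈ Finset.range ((kTail α (j + 1) : ℕ) - kTail α j + 2), lam (j + 1) t = 0) :
    IsResolutionOfSingularities (resolutionMap α lam) := by
  have hex : ∀ s : Fin (n + 1), ∃ φ, IsChart α lam s φ := fun s =>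
    exists_isChart α lam hn hΔ (Nat.lt_succ_iff.1 s.2)
  choose φ hφ using hex
  have hs : ∀ s : Fin (n + 1), (s : ℕ) ≤ n := fun s => Nat.lt_succ_iff.1 s.2
  let e : ∀ s : Fin (n + 1),
      ArrowQuiver.ChartRing (chartSection_mem α lam s) ≃+* MvPolynomial (Fin 2) ℂ :=
    fun s => (hφ s).ringEquiv hn (hs s)
  have he : ∀ s r, e s (ArrowQuiver.invariantsToChart (chartSection_mem α lam s) r) = φ s r :=
    fun s r => ArrowQuiver.chartHom_invariantsToChart _ _ (hφ s).section_eq_one r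
  have hdom : ∀ s : Fin (n + 1),
      IsDomain (ArrowQuiver.ChartRing (chartSection_mem α lam s)) := fun s => (e s).toMulEquiv.isDomain _
  have hreg : ∀ s : Fin (n + 1),
      IsRegularRing (ArrowQuiver.ChartRing (chartSection_mem α lam s)) := fun s =>
    IsRegularRing.of_ringEquiv (e s).symm
  have hinj := (hφ 0).injOn_invariants hn
  have hinv : IsDomain ((quiver α).invariants (StepRel α lam)) :=
    Function.Injective.isDomain
      ((φ 0).comp ((quiver α).invariants (StepRel α lam)).val).toRingHom hinj
  let π : (quiver α).gitQuotient (StepRel α lam) (stability n) ⟶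
      Spec (CommRingCat.of ((quiver α).invariants (StepRel α lam))) := resolutionMap α lam
  have hproper : IsProper π :=
    ArrowQuiver.isProper_gitToAffine _ (adjoin_chartSection α lam)
  have hπ : ∀ s : Fin (n + 1), ArrowQuiver.chartι (chartSection_mem α lam s) ≫ π = Spec.map
      (CommRingCat.ofHom (ArrowQuiver.invariantsToChart (chartSection_mem α lam s))) := fun s =>
    ArrowQuiver.chartι_gitToAffine _
  have hcov := ArrowQuiver.exists_mem_range_chartι (fun s : Fin (n + 1) => chartSection α lam s)
    (fun s => chartSection_mem α lam s) (adjoin_chartSection α lam)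
  let z : (quiver α).invariants (StepRel α lam) :=
    ⟨_, zVal_mem_invariants α lam (Nat.zero_le _)⟩
  refine isResolutionOfSingularities_of_charts π
    (fun s : Fin (n + 1) => ArrowQuiver.chartι (chartSection_mem α lam s)) hcov
    (fun s => ArrowQuiver.invariantsToChart (chartSection_mem α lam s))
    hπ z (fun s h0 => ?_) 0 (fun x hx => ?_)
    (fun r t hrt => ?_) (fun b => ?_)
  · refine (hφ s).z_zero_ne_zero hn (hs s) ?_
    rw [← he s z, h0, map_zero]
  · obtain ⟨s, y, rfl⟩ := hcov x
    rw [ArrowQuiver.chartι_mem_range_iff]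
    rw [← Scheme.Hom.comp_apply, hπ s] at hx
    have hx' : ArrowQuiver.invariantsToChart (chartSection_mem α lam s) z ∉ y.asIdeal := hx
    have hy : y.asIdeal.IsPrime := PrimeSpectrum.isPrime y
    obtain ⟨w, hw⟩ := chartSection_zero_dvd α lam hn
    intro h0
    refine hx' (hy.mem_of_pow_mem n ?_)
    -- The divisibility `f_0 ∣ z ^ n` is transported to the ring of the chart `s`. The cofactor `w`
    -- is not known to be a semi-invariant, so its value is pulled back from the polynomial ring.
    have h1 : ArrowQuiver.invariantsToChart (chartSection_mem α lam s) z ^ n =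
        ArrowQuiver.chartFrac (chartSection_mem α lam s) 1
          ⟨chartSection α lam 0, chartSection_mem α lam 0⟩ * (e s).symm (φ s w) := by
      apply (e s).injective
      rw [map_pow, he, map_mul, RingEquiv.apply_symm_apply]
      rw [show e s (ArrowQuiver.chartFrac _ 1 _) = _ from 
        ArrowQuiver.chartHom_chartFrac _ _ (hφ s).section_eq_one 1 _]
      rw [← map_pow, ← map_mul]
      exact congrArg (φ s) hw
    rw [h1]
    exact Ideal.mul_mem_right _ _ h0
  · apply hinj
    have := congrArg (e 0) hrt
    rwa [he, he] at this
  · obtain ⟨N, r, hr⟩ := (hφ 0).exists_pow_mul_eq hn (e 0 b)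
    refine ⟨N, r, (e 0).injective ?_⟩
    rw [map_mul, map_pow, he, he]
    exact hr

end Recon

/-! ### Hirzebruch–Jung continued fractions and Riemenschneider duality -/

theorem hjValue_cons (x : ℕ) (l : List ℕ) : hjValue (x :: l) = x - (hjValue l)⁻¹ := by
  cases l with
  | nil => simp [hjValue]
  | cons y l => rw [hjValue, one_div]

theorem one_lt_hjValue {l : List ℕ} (hl : l ≠ []) (h : ∀ x ∈ l, 2 ≤ x) : 1 < hjValue l := by
  induction l with
  | nil => exact absurd rfl hl
  | cons x l ih =>
    rw [hjValue_cons]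
    have hx : (2 : ℚ) ≤ x := by exact_mod_cast h x List.mem_cons_self
    rcases eq_or_ne l [] with rfl | hl'
    · simp only [hjValue, inv_zero]
      linarith
    · have := inv_lt_one_of_one_lt₀ (ih hl' fun y hy => h y (List.mem_cons_of_mem x hy))
      linarith

theorem inv_hjValue_mem {l : List ℕ} (h : ∀ x ∈ l, 2 ≤ x) :
    0 ≤ (hjValue l)⁻¹ ∧ (hjValue l)⁻¹ < 1 := by
  rcases eq_or_ne l [] with rfl | hl
  · simp [hjValue]
  · have := one_lt_hjValue hl h
    exact ⟨inv_nonneg.2 (by linarith), inv_lt_one_of_one_lt₀ this⟩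

/-- A Hirzebruch–Jung continued fraction expansion is determined by its value. -/
theorem hjValue_injOn {l l' : List ℕ} (h : ∀ x ∈ l, 2 ≤ x) (h' : ∀ x ∈ l', 2 ≤ x)
    (he : hjValue l = hjValue l') : l = l' := by
  induction l generalizing l' with
  | nil =>
    by_contra hne
    have := one_lt_hjValue (Ne.symm hne) h'
    rw [← he, hjValue] at this
    linarith
  | cons x l ih =>
    cases l' with
    | nil =>
      have := one_lt_hjValue (List.cons_ne_nil x l) h
      rw [he, hjValue] at this
      linarith
    | cons y l' =>
      have hl : ∀ z ∈ l, 2 ≤ z := fun z hz => h z (List.mem_cons_of_mem x hz)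
      have hl' : ∀ z ∈ l', 2 ≤ z := fun z hz => h' z (List.mem_cons_of_mem y hz)
      rw [hjValue_cons, hjValue_cons] at he
      obtain ⟨h1, h2⟩ := inv_hjValue_mem hl
      obtain ⟨h3, h4⟩ := inv_hjValue_mem hl'
      -- The remaining fractions lie in `[0, 1)`, so the two first entries differ by less than one.
      have h5 : (x : ℚ) < y + 1 := by linarith
      have h6 : (y : ℚ) < x + 1 := by linarith
      have hxy : x = y := by
        have h7 : x < y + 1 := by exact_mod_cast h5
        have h8 : y < x + 1 := by exact_mod_cast h6
        omega
      subst hxy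
      rw [ih hl hl' (inv_injective (by linarith))]

/-- The list in which the number `o + i` is repeated `x - 2` times for the `i`-th entry `x`
of a list. -/
def tailList : ℕ → List ℕ → List ℕ
  | _, [] => []
  | o, x :: l => List.replicate (x - 2) o ++ tailList (o + 1) l

/-- The differences of the consecutive entries of the list `p, t₁, t₂, …`, increased by two. -/
def gapList : ℕ → List ℕ → List ℕ
  | _, [] => []
  | p, t :: l => (t - p + 2) :: gapList t l

theorem two_le_of_mem_gapList {p : ℕ} {l : List ℕ} {x : ℕ} (hx : x ∈ gapList p l) : 2 ≤ x := by
  induction l generalizing p with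
  | nil => simp [gapList] at hx
  | cons t l ih =>
    rw [gapList, List.mem_cons] at hx
    rcases hx with rfl | hx
    · omega
    · exact ih hx

theorem length_gapList (p : ℕ) (l : List ℕ) : (gapList p l).length = l.length := by
  induction l generalizing p with
  | nil => rfl
  | cons t l ih => rw [gapList, List.length_cons, List.length_cons, ih]

theorem getD_gapList (p : ℕ) (l : List ℕ) (i e : ℕ) (hi : i < l.length) :
    (gapList p l).getD i 0 = l.getD i e - (p :: l).getD i e + 2 := by
  induction l generalizing p i with
  | nil => simp at hi
  | cons t l ih =>
    cases i with
    | zero => simp [gapList]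
    | succ i =>
      rw [gapList, List.getD_cons_succ, List.getD_cons_succ, List.getD_cons_succ]
      exact ih t i (by simpa using hi)

/-- **Riemenschneider duality**: the continued fraction formed by the gaps in the list of tails has
the value `w / (w - 1)`. -/
theorem hjValue_gapList {l : List ℕ} (hl : l ≠ []) (h : ∀ x ∈ l, 2 ≤ x) {o p : ℕ} (hp : p ≤ o) :
    hjValue (gapList p (tailList o l ++ [o + l.length - 1])) =
      (o - p : ℚ) + hjValue l / (hjValue l - 1) := by
  induction l generalizing o p with
  | nil => exact absurd rfl hl
  | cons x l ih =>
    have hl2 : ∀ y ∈ l, 2 ≤ y := fun y hy => h y (List.mem_cons_of_mem x hy)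
    obtain ⟨k, rfl⟩ := Nat.exists_eq_add_of_le' (h x List.mem_cons_self)
    clear h hl
    rw [hjValue_cons, tailList, Nat.add_sub_cancel]
    obtain ⟨h1, h2⟩ := inv_hjValue_mem hl2
    -- Here `k = x - 2` counts the copies of the tail `o`. The start `p` must vary, because an entry
    -- `2` contributes no tail and only widens the next gap.
    induction k generalizing p with
    | zero =>
      rcases eq_or_ne l [] with rfl | hl
      · simp only [tailList, List.replicate_zero, List.nil_append, List.length_cons,
          List.length_nil, zero_add, Nat.add_sub_cancel, gapList, hjValue, inv_zero]
        push_cast [Nat.cast_sub hp]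
        norm_num
      · have h3 := one_lt_hjValue hl hl2
        have h4 := ih hl hl2 (show p ≤ o + 1 by omega)
        rw [show o + 1 + l.length - 1 = o + (l.length + 1) - 1 by omega] at h4
        rw [List.replicate_zero, List.nil_append, List.length_cons, h4]
        have h5 : hjValue l - 1 ≠ 0 := by linarith
        have h6 : hjValue l ≠ 0 := by linarith
        have h7 : ((0 + 2 : ℕ) : ℚ) - (hjValue l)⁻¹ - 1 = (hjValue l - 1) / hjValue l := by
          field_simp
          push_cast
          ring
        rw [h7]
        field_simp
        push_cast
        ring
    | succ k ihk =>
      -- After one copy of `o` the gaps start at `o` itself, so the remaining fraction is `w / (w -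
      -- 1)`. The first gap then gives `o - p + 2 - (w - 1) / w`, which is `(o - p) + (w + 1) / w`.
      have h3 := ihk (le_refl o)
      rw [List.replicate_succ, List.cons_append, List.cons_append, gapList, hjValue_cons]
      simp only [List.length_cons] at h3 ⊢
      rw [h3]
      set w : ℚ := ((k + 2 : ℕ) : ℚ) - (hjValue l)⁻¹ with hw
      have hw1 : 1 < w := by
        push_cast at hw
        have : (0 : ℚ) ≤ k := Nat.cast_nonneg k
        linarith
      have hw2 : ((k + 1 + 2 : ℕ) : ℚ) - (hjValue l)⁻¹ = w + 1 := by
        rw [hw]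
        push_cast
        ring
      have hw3 : w ≠ 0 := by linarith
      have hw4 : w - 1 ≠ 0 := by linarith
      rw [hw2, sub_self, zero_add, inv_div, add_sub_cancel_right]
      push_cast [Nat.cast_sub hp]
      field_simp
      ring

theorem tailList_ofFn {n : ℕ} (α : Fin n → ℕ) (o : ℕ) : tailList o (List.ofFn α) =
    (List.finRange n).flatMap fun i => List.replicate (α i - 2) (o + i) := by
  induction n generalizing o with
  | zero => simp [tailList]
  | succ n ih =>
    rw [List.ofFn_succ, tailList, ih, List.finRange_succ, List.flatMap_cons, List.flatMap_map]
    simp [Nat.add_assoc, Nat.add_comm 1]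

/-! ### The dual expansion as the gaps between the tails of the arrows `k`. -/

namespace Recon

variable {n : ℕ} (α : Fin n → ℕ)

theorem map_val_extraTails :
    (extraTails α).map Fin.val = tailList 1 (List.ofFn α) := by
  rw [tailList_ofFn, extraTails, List.map_flatMap]
  simp [Nat.add_comm]

/-- With `w = r / a` one has `w / (w - 1) = r / (r - a)`, so duality gives both lists the same
value, and an expansion with entries at least `2` is determined by its value. The start `1` is
`l_0`, and the appended `n` is `l_{e-2}`. -/
theorem ofFn_eq_gapList {r a m : ℕ} (ha : 0 < a) (har : a < r) {α : Fin n → ℕ}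
    (hα : IsHJExpansion r a α) {β : Fin m → ℕ} (hβ : IsHJExpansion r (r - a) β) :
    1 ≤ n ∧ List.ofFn β = gapList 1 ((extraTails α).map Fin.val ++ [n]) := by
  have ha' : (0 : ℚ) < a := by exact_mod_cast ha
  have har' : (a : ℚ) < r := by exact_mod_cast har
  have hα1 : ∀ x ∈ List.ofFn α, 2 ≤ x := by
    rw [List.forall_mem_ofFn_iff]
    exact hα.1
  have hβ1 : ∀ x ∈ List.ofFn β, 2 ≤ x := by
    rw [List.forall_mem_ofFn_iff]
    exact hβ.1
  have hne : List.ofFn α ≠ [] := by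
    intro h0
    have h1 := hα.2
    rw [h0, hjValue] at h1
    have : (0 : ℚ) < r / a := div_pos (ha'.trans har') ha'
    linarith
  refine ⟨Nat.one_le_iff_ne_zero.2 fun h => hne (by subst h; rfl), ?_⟩
  refine hjValue_injOn hβ1 (fun x hx => two_le_of_mem_gapList hx) ?_
  have h1 := hjValue_gapList hne hα1 (le_refl 1)
  rw [List.length_ofFn, Nat.add_sub_cancel_left] at h1
  rw [map_val_extraTails, h1, hα.2, hβ.2, Nat.cast_sub har.le]
  have h2 : (r : ℚ) - a ≠ 0 := by linarith
  have h3 : (r : ℚ) / a - 1 = (r - a) / a := by field_simp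
  rw [h3]
  field_simp
  ring

/-- The entries of the dual continued fraction in terms of the quiver. -/
theorem sum_eq_zero_of_inDelta {r a m : ℕ} (ha : 0 < a) (har : a < r)
    (hα : IsHJExpansion r a α) {β : Fin m → ℕ} (hβ : IsHJExpansion r (r - a) β)
    {lam : ℕ → ℕ → ℂ} (hlam : InDelta β lam) {j : ℕ} (hj : j ≤ numExtra α) :
    ∑ t ∈ Finset.range ((kTail α (j + 1) : ℕ) - kTail α j + 2), lam (j + 1) t = 0 := by
  obtain ⟨hn, hβe⟩ := ofFn_eq_gapList ha har hα hβ
  set T := (extraTails α).map Fin.val ++ [n] with hT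
  have hlen : T.length = numExtra α + 1 := by simp [hT, length_extraTails]
  have hm : m = numExtra α + 1 := by
    rw [← hlen, ← length_gapList 1 T, ← hβe, List.length_ofFn]
  have hkT : ∀ i, (kTail α (i + 1) : ℕ) = T.getD i n := by
    intro i
    rw [kTail, if_neg (Nat.succ_ne_zero i), Nat.add_sub_cancel, hT]
    rcases lt_or_ge i (extraTails α).length with hi | hi
    · simp [List.getD_eq_getElem?_getD, List.getElem?_append, hi]
    · rw [List.getD_eq_default _ _ hi]
      rw [List.getD_append_right _ _ _ _ (by simpa using hi)]
      rcases Nat.eq_zero_or_pos (i - ((extraTails α).map Fin.val).length) with h | h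
      · rw [h]
        simp
      · rw [List.getD_eq_default _ _ (by simp only [List.length_cons, List.length_nil]; omega)]
        simp
  have hkT' : (kTail α j : ℕ) = (1 :: T).getD j n := by
    cases j with
    | zero => rw [kTail_zero α hn, List.getD_cons_zero]
    | succ j => rw [hkT, List.getD_cons_succ]
  have hβj : β ⟨j, by omega⟩ = (kTail α (j + 1) : ℕ) - kTail α j + 2 := by
    rw [hkT, hkT', ← getD_gapList 1 T j n (by omega), ← hβe,
      List.getD_eq_getElem _ _ (by rw [List.length_ofFn]; omega), List.getElem_ofFn]
  rw [← hβj]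
  exact hlam ⟨j, by omega⟩

end Recon

theorem corollary5 {n m : ℕ} (r a : ℕ) (ha : 0 < a) (har : a < r) (hra : Nat.Coprime r a)
    (α : Fin n → ℕ) (hα : IsHJExpansion r a α)
    (β : Fin m → ℕ) (hβ : IsHJExpansion r (r - a) β)
    (lam : ℕ → ℕ → ℂ) (hlam : Recon.InDelta β lam) :
    IsResolutionOfSingularities (Recon.resolutionMap α lam) :=
  Recon.isResolutionOfSingularities_resolutionMap α lam
    (Recon.ofFn_eq_gapList ha har hα hβ).1
    fun _ hj => Recon.sum_eq_zero_of_inDelta α ha har hα hβ hlam hj
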